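/- Let $n,\kappa\ge 1$ be integers, $m>0$, $\lambda>2\kappa$, $0<\alpha\le m(\lambda-2\kappa)$, and let $1<p,p_1,\dots,p_\kappa<\infty$ satisfy $\frac1p=\frac1{p_1}+\cdots+\frac1{p_\kappa}$. Let $p_0>0$, $0\le\delta_0<1$, $C_0\ge 0$, $A\ge 0$ and $K\ge 0$ be real constants. Let $\mu$ be a Borel measure on $\mathbb R^n$ with $\mu(B(x,r))\le A r^m$ for all $x\in\mathbb R^n$ and $r>0$. For $t>0$ let $s_t:(\mathbb R^n)^{\kappa+1}\to\mathbb C$ be such that $(t,x,\vec y)\mapsto s_t(x,\vec y)$ is measurable and, for all $t>0$, $x,x'\in\mathbb R^n$, $\vec y=(y_1,\dots,y_\kappa)\in(\mathbb R^n)^\kappa$, $1\le i\le\kappa$ and $y_i'\in\mathbb R^n$, $$|s_t(x,\vec y)|\le K\frac{t^{\kappa\alpha}}{\prod_{j=1}^\kappa(t+|x-y_j|)^{m+\alpha}},$$ $$|s_t(x,\vec y)-s_t(x',\vec y)|\le K\frac{t^{(\kappa-1)\alpha}|x-x'|^\alpha}{\prod_{j=1}^\kappa(t+|x-y_j|)^{m+\alpha}}\quad\text{if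 } |x-x'|<t/2,$$ $$|s_t(x,\vec y)-s_t(x,y_1,\dots,y_i',\dots,y_\kappa)|\le K\frac{t^{(\kappa-1)\alpha}|y_i-y_i'|^\alpha}{\prod_{j=1}^\kappa(t+|x-y_j|)^{m+\alpha}}\quad\text{if } |y_i-y_i'|<t/2.$$ For $\vec f=(f_1,\dots,f_\kappa)$ put $$\Theta_t^\mu(\vec f)(y)=\int_{(\mathbb R^n)^\kappa}s_t(y,\vec z)\prod_{i=1}^\kappa f_i(z_i)\,d\mu(z_1)\cdots d\mu(z_\kappa),$$ $$g^*_{\lambda,\mu}(\vec f)(x)=\Big(\int_0^\infty\!\!\int_{\mathbb R^n}\Big(\frac{t}{t+|x-y|}\Big)^{m\lambda}|\Theta_t^\mu(\vec f)(y)|^2\,\frac{d\mu(y)\,dt}{t^{m+1}}\Big)^{1/2},$$ and, for a cube $Q$ with sides parallel to the axes and side length $\ell(Q)>0$, let $g^*_{\lambda,\mu,Q}(\vec f)$ be defined in the same way with $\int_0^\infty$ replaced by $\int_0^{\ell(Q)}$. Let $Q\subset\mathbb R^n$ be such a cube and let $H_Q\subset\mathbb R^n$ satisfy $\mu(H_Q)\le\delta_0\,\mu(Q)$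 and $$\sup_{\zeta>0}\zeta^{p_0}\mu\big(\{x\in Q\setminus H_Q:\ g^*_{\lambda,\mu,Q}(\mathbf 1_Q,\dots,\mathbf 1_Q)(x)>\zeta\}\big)\le C_0\,\mu(Q).$$ Then there exists a measurable set $G_Q\subset Q\setminus H_Q$ with $\mu(G_Q)\ge\frac{1-\delta_0}{2}\mu(Q)$ such that $$\big\|\mathbf 1_{G_Q}\,g^*_{\lambda,\mu}(\vec f)\big\|_{L^p(\mu)}\le C\prod_{i=1}^\kappa\|f_i\|_{L^{p_i}(\mu)}$$ for all complex-valued $f_i\in L^{p_i}(\mu)$ that vanish $\mu$-almost everywhere outside $Q$, $i=1,\dots,\kappa$. Here $C<\infty$ depends only on $n,\kappa,m,\lambda,\alpha,p,p_1,\dots,p_\kappa,p_0,\delta_0,C_0,A,K$; in particular it does not depend on $Q$, $H_Q$, $\mu$, the kernel $s_t$ or the $f_i$. -/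

import Mathlib

open MeasureTheory
open scoped NNReal ENNReal

noncomputable section

/-- Euclidean space of dimension `n`. -/
abbrev RSpace (n : ℕ) : Type := EuclideanSpace ℝ (Fin n)

/-- `Q` is a cube with side length `ℓ > 0`, sides parallel to the axes: a product of `n` intervals
with endpoints `a i` and `a i + ℓ`. Each interval may be open, closed or half-open. -/
def IsCube {n : ℕ} (Q : Set (RSpace n)) (ℓ : ℝ) : Prop :=
  0 < ℓ ∧ ∃ (a : Fin n → ℝ) (I : Fin n → Set ℝ),
    (∀ i, Set.Ioo (a i) (a i + ℓ) ⊆ I i ∧ I i ⊆ Set.Icc (a i) (a i + ℓ)) ∧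
    Q = {x | ∀ i, x i ∈ I i}

/-- The Borel measure `μ` satisfies `μ (B (x, r)) ≤ A r ^ m` for all `x` and all `r > 0`. -/
def IsPowerBounded {n : ℕ} (m A : ℝ) (μ : Measure (RSpace n)) : Prop :=
  ∀ (x : RSpace n) (r : ℝ), 0 < r → μ (Metric.ball x r) ≤ ENNReal.ofReal (A * r ^ m)

/-- The kernel `s_t(x, y_1, …, y_κ)`, `t > 0`, is (jointly) measurable and satisfies the size
condition and the Hölder conditions of order `α` with constant `K`. -/
structure IsLPSKernel {n κ : ℕ} (m α K : ℝ)
    (s : ℝ → RSpace n → (Fin κ → RSpace n) → ℂ) : Prop where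
  measurable : Measurable fun q : ℝ × RSpace n × (Fin κ → RSpace n) => s q.1 q.2.1 q.2.2
  size : ∀ t : ℝ, 0 < t → ∀ (x : RSpace n) (y : Fin κ → RSpace n),
    ‖s t x y‖ ≤ K * (t ^ ((κ : ℝ) * α) / ∏ i, (t + ‖x - y i‖) ^ (m + α))
  holder_fst : ∀ t : ℝ, 0 < t → ∀ (x x' : RSpace n) (y : Fin κ → RSpace n),
    ‖x - x'‖ < t / 2 →
    ‖s t x y - s t x' y‖ ≤
      K * (t ^ (((κ : ℝ) - 1) * α) * ‖x - x'‖ ^ α / ∏ i, (t + ‖x - y i‖) ^ (m + α))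
  holder_snd : ∀ t : ℝ, 0 < t → ∀ (x : RSpace n) (y : Fin κ → RSpace n) (j : Fin κ)
    (y' : RSpace n), ‖y j - y'‖ < t / 2 →
    ‖s t x y - s t x (Function.update y j y')‖ ≤
      K * (t ^ (((κ : ℝ) - 1) * α) * ‖y j - y'‖ ^ α / ∏ i, (t + ‖x - y i‖) ^ (m + α))

/-- `Θ_t^μ(f_1, …, f_κ)(y) = ∫ s_t(y, z) ∏ f_i(z_i) dμ(z_1) ⋯ dμ(z_κ)`. -/
def Theta {n κ : ℕ} (μ : Measure (RSpace n)) (s : ℝ → RSpace n → (Fin κ → RSpace n) → ℂ)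
    (f : Fin κ → RSpace n → ℂ) (t : ℝ) (y : RSpace n) : ℂ :=
  ∫ z : Fin κ → RSpace n, s t y z * ∏ i, f i (z i) ∂(Measure.pi fun _ => μ)

/-- The square function
`(∫_{t ∈ T} ∫ (t / (t + |x - y|)) ^ (m lam) |Θ_t^μ(f)(y)|² dμ(y) dt / t ^ (m + 1)) ^ (1 / 2)`,
with values in `[0, ∞]`, for a set `T` of scales. -/
def gStarOn {n κ : ℕ} (T : Set ℝ) (m lam : ℝ) (μ : Measure (RSpace n))
    (s : ℝ → RSpace n → (Fin κ → RSpace n) → ℂ) (f : Fin κ → RSpace n → ℂ)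
    (x : RSpace n) : ℝ≥0∞ :=
  (∫⁻ t in T, ∫⁻ y,
    ENNReal.ofReal ((t / (t + ‖x - y‖)) ^ (m * lam) / t ^ (m + 1)) *
      ‖Theta μ s f t y‖ₑ ^ 2 ∂μ) ^ (1 / 2 : ℝ)

/-- The multilinear Littlewood-Paley-Stein function `g*_{λ,μ}(f)`. -/
def gStar {n κ : ℕ} (m lam : ℝ) (μ : Measure (RSpace n))
    (s : ℝ → RSpace n → (Fin κ → RSpace n) → ℂ) (f : Fin κ → RSpace n → ℂ) :
    RSpace n → ℝ≥0∞ :=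
  gStarOn (Set.Ioi 0) m lam μ s f

/-- The local function `g*_{λ,μ,Q}(f)` for a cube `Q` of side length `ℓ`: only the scales
`0 < t < ℓ` are used. -/
def gStarLocal {n κ : ℕ} (ℓ m lam : ℝ) (μ : Measure (RSpace n))
    (s : ℝ → RSpace n → (Fin κ → RSpace n) → ℂ) (f : Fin κ → RSpace n → ℂ) :
    RSpace n → ℝ≥0∞ :=
  gStarOn (Set.Ioo 0 ℓ) m lam μ s f

end

/-! ### Layer cake and strong type bounds -/

/-! Chebyshev's inequality at a level ζ depending only on C₀, δ₀ and p₀ removes from Q \ H a set of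
measure at most (1 - δ₀)/2 · μ(Q); what remains, after replacing H by a measurable hull, is G
(`exists_good_set`). So the local square function of the indicators of Q is at most ζ on G. The rest
is a pointwise domination of the full square function on G by quantities that Hölder's inequality
can integrate.

Scales t ≥ ℓ need only the size of the kernel: each average of f_l is at most a multiple of (ℓ/t)^m
times a maximal function at x, and the integral over the scales converges (`lintegral_large_le`).

For t comparable to ℓ 2^(-j), take a shifted dyadic grid with conditional expectations E_k, and
suppose that x is far from the boundaries of the cells of generations at most j. Replace f_l by the
constant multiple E_j f_l(x) of the indicator of Q, one slot at a time. The main term is ∏ E_j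
f_l(x) times Θ_t of the indicators, controlled by ζ and Doob's maximal functions. In each error term
one slot holds f - E_j f(x) 1_Q, which is split into martingale increments. For k ≥ j the increment
has mean zero on cells of size 2^(-k) ℓ, and Hölder continuity of the kernel in that slot gains a
power of 2^(j-k). For k < j the increment matters at z only if z and x lie in different cells of
generation k + 1; then they are far apart because x is good, and the decay of the kernel gains
(`enorm_Theta_slot_le`). The remaining slots are controlled by maximal functions. The local part is
thus dominated by products of maximal functions in which at most one factor is replaced by the
square root of `sqFn`, a square function of averaged martingale increments (`tsum_scalePart_le`).

The L^q bound for that square function is `sqFn_increment_bound`. As μ is only power bounded,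
averages are compared with a maximal function normalised by r^m, which is bounded on L^s by a Vitali
covering argument. For q ≥ 2 duality moves the averages onto the test function; for q < 2 a Rubio de
Francia weight takes over. What is left are the Burkholder inequalities for martingales, in a
weighted form when q < 2, and Doob's inequality.

A given grid need not be good for x at every scale. But at each scale a random shift is good with
probability at least 3/4, and `rpow_tsum_le_lintegral` bounds a power of the sum over all scales by
the mean of the same power of the sum over the good scales. No independence is needed. Tonelli then
reduces the estimate to one fixed grid. -/

theorem lintegral_Ioo_rpow {r b : ℝ} (hr : 0 < r) (hb : 0 ≤ b) :
    ∫⁻ a in Set.Ioo 0 b, ENNReal.ofReal (r * a ^ (r - 1)) = ENNReal.ofReal (b ^ r) := by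
  have h1 : IntervalIntegrable (fun a : ℝ => r * a ^ (r - 1)) volume 0 b :=
    (intervalIntegral.intervalIntegrable_rpow' (by linarith)).const_mul r
  rw [← ofReal_integral_eq_lintegral_ofReal]
  · rw [← integral_Ioc_eq_integral_Ioo, ← intervalIntegral.integral_of_le hb,
      intervalIntegral.integral_const_mul, integral_rpow (Or.inl (by linarith))]
    rw [sub_add_cancel, Real.zero_rpow hr.ne', sub_zero, mul_div_cancel₀ _ hr.ne']
  · exact ((intervalIntegrable_iff_integrableOn_Ioc_of_le hb).1 h1).mono_set Set.Ioo_subset_Ioc_self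
  · refine (ae_restrict_iff' measurableSet_Ioo).2 (.of_forall fun a ha => ?_)
    exact mul_nonneg hr.le (Real.rpow_nonneg ha.1.le _)

/-- The layer-cake formula for one extended number; the value ∞ is allowed, so no finiteness has to
be checked where it is used. -/
theorem rpow_eq_lintegral_layer {r : ℝ} (hr : 0 < r) (y : ℝ≥0∞) :
    ∫⁻ a in Set.Ioi (0 : ℝ), ENNReal.ofReal (r * a ^ (r - 1)) *
      {a : ℝ | ENNReal.ofReal a < y}.indicator 1 a = y ^ r := by
  -- Lower bound by any finite b below the target. For a finite target take b equal to it; for an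
  -- infinite one let b grow.
  have key : ∀ b : ℝ, 0 ≤ b → ∀ z : ℝ≥0∞, ENNReal.ofReal b ≤ z → ENNReal.ofReal (b ^ r) ≤
      ∫⁻ a in Set.Ioi (0 : ℝ), ENNReal.ofReal (r * a ^ (r - 1)) *
        {a : ℝ | ENNReal.ofReal a < z}.indicator 1 a := by
    intro b hb z hz
    rw [← lintegral_Ioo_rpow hr hb, ← lintegral_indicator measurableSet_Ioo,
      ← lintegral_indicator measurableSet_Ioi]
    refine lintegral_mono fun a => ?_
    by_cases ha : a ∈ Set.Ioo 0 b
    · have h2 : ENNReal.ofReal a < z :=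
        lt_of_lt_of_le ((ENNReal.ofReal_lt_ofReal_iff (ha.1.trans ha.2)).2 ha.2) hz
      simp [ha.1, ha.2, h2]
    · simp only [Set.indicator_of_notMem ha]
      exact zero_le
  rcases eq_or_ne y ⊤ with rfl | hy
  · rw [ENNReal.top_rpow_of_pos hr, eq_top_iff]
    refine ENNReal.le_of_forall_nnreal_lt fun b _ => ?_
    have := key ((b : ℝ) ^ (1 / r)) (by positivity) ⊤ le_top
    rw [← Real.rpow_mul (NNReal.coe_nonneg b), one_div_mul_cancel hr.ne', Real.rpow_one] at this
    simpa using this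
  · lift y to ℝ≥0 using hy
    have e : ENNReal.ofReal ((y : ℝ) ^ r) = (y : ℝ≥0∞) ^ r := by
      rw [← ENNReal.ofReal_rpow_of_nonneg (NNReal.coe_nonneg y) hr.le, ENNReal.ofReal_coe_nnreal]
    refine le_antisymm ?_ ?_
    · rw [← e, ← lintegral_Ioo_rpow hr (NNReal.coe_nonneg y),
        ← lintegral_indicator measurableSet_Ioo, ← lintegral_indicator measurableSet_Ioi]
      refine lintegral_mono fun a => ?_
      by_cases ha : 0 < a
      · by_cases h2 : a < y
        · simp [ha, h2, Set.indicator]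
          split_ifs <;> simp
        · have : ¬ ENNReal.ofReal a < (y : ℝ≥0∞) := by
            rw [← ENNReal.ofReal_coe_nnreal, ENNReal.ofReal_lt_ofReal_iff_of_nonneg ha.le]; exact h2
          simp [ha, Set.indicator, h2, this]
      · simp [Set.indicator, ha]
    · rw [← e]
      exact key y y.2 y (by simp)

/-- Marcinkiewicz interpolation in a form that serves both `maxFn` and `procMax`. Multiply the
hypothesis by s a^(s-2), integrate in a and apply Tonelli: at x the inner integral runs over a <
g(x)/c and produces (g(x)/c)^(s-1)/(s-1), which joins the factor g(x). -/
theorem lintegral_rpow_le_of_weak_type {X : Type*} [MeasurableSpace X] {μ : Measure X} [SFinite μ]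
    {F g : X → ℝ≥0∞} (hF : Measurable F) (hg : Measurable g) {c s : ℝ} (hc : 0 < c) (hs : 1 < s)
    {B : ℝ≥0∞}
    (h : ∀ a : ℝ, 0 < a → ENNReal.ofReal a * μ {x | ENNReal.ofReal a < F x} ≤
      B * ∫⁻ x in {x | ENNReal.ofReal (c * a) < g x}, g x ∂μ) :
    ∫⁻ x, F x ^ s ∂μ ≤ B * ENNReal.ofReal (s / (s - 1) * c⁻¹ ^ (s - 1)) * ∫⁻ x, g x ^ s ∂μ := by
  have hs0 : 0 < s := by linarith
  have hs1 : 0 < s - 1 := by linarith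
  have hmF : Measurable fun q : X × ℝ => {x | ENNReal.ofReal q.2 < F x}.indicator
      (1 : X → ℝ≥0∞) q.1 := by
    have : MeasurableSet {q : X × ℝ | ENNReal.ofReal q.2 < F q.1} :=
      measurableSet_lt (by fun_prop) (by fun_prop)
    exact measurable_one.indicator this
  have hmg : Measurable fun q : X × ℝ => {x | ENNReal.ofReal (c * q.2) < g x}.indicator
      g q.1 := by
    have : MeasurableSet {q : X × ℝ | ENNReal.ofReal (c * q.2) < g q.1} :=
      measurableSet_lt (by fun_prop) (by fun_prop)
    exact (hg.comp measurable_fst).indicator this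
  calc ∫⁻ x, F x ^ s ∂μ
      = ∫⁻ x, (∫⁻ a in Set.Ioi (0 : ℝ), ENNReal.ofReal (s * a ^ (s - 1)) *
          {x | ENNReal.ofReal a < F x}.indicator 1 x) ∂μ := by
        refine lintegral_congr fun x => ?_
        rw [← rpow_eq_lintegral_layer hs0]; rfl
    _ = ∫⁻ a in Set.Ioi (0 : ℝ), (∫⁻ x, ENNReal.ofReal (s * a ^ (s - 1)) *
          {x | ENNReal.ofReal a < F x}.indicator 1 x ∂μ) := by
        refine lintegral_lintegral_swap (Measurable.aemeasurable ?_)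
        exact Measurable.mul (by fun_prop) hmF
    _ = ∫⁻ a in Set.Ioi (0 : ℝ), ENNReal.ofReal (s * a ^ (s - 1)) *
          μ {x | ENNReal.ofReal a < F x} := by
        refine lintegral_congr fun a => ?_
        have hm : MeasurableSet {x | ENNReal.ofReal a < F x} := measurableSet_lt measurable_const hF
        rw [lintegral_const_mul _ (measurable_one.indicator hm), lintegral_indicator_one hm]
    _ ≤ ∫⁻ a in Set.Ioi (0 : ℝ), ENNReal.ofReal (s * a ^ (s - 2)) *
          (B * ∫⁻ x in {x | ENNReal.ofReal (c * a) < g x}, g x ∂μ) := by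
        refine setLIntegral_mono' measurableSet_Ioi fun a (ha : 0 < a) => ?_
        have : s * a ^ (s - 1) = s * a ^ (s - 2) * a := by
          rw [mul_assoc]; congr 1
          rw [← Real.rpow_add_one ha.ne']; congr 1; ring
        rw [this, ENNReal.ofReal_mul' ha.le, mul_assoc]
        exact mul_le_mul_right (h a ha) _
    _ = ∫⁻ a in Set.Ioi (0 : ℝ), B * (∫⁻ x, ENNReal.ofReal (s * a ^ (s - 2)) *
          {x | ENNReal.ofReal (c * a) < g x}.indicator g x ∂μ) := by
        refine lintegral_congr fun a => ?_
        have hm : MeasurableSet {x | ENNReal.ofReal (c * a) < g x} :=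
          measurableSet_lt measurable_const hg
        rw [lintegral_const_mul _ (hg.indicator hm), lintegral_indicator hm, mul_left_comm]
    _ = B * ∫⁻ x, (∫⁻ a in Set.Ioi (0 : ℝ), ENNReal.ofReal (s * a ^ (s - 2)) *
          {x | ENNReal.ofReal (c * a) < g x}.indicator g x) ∂μ := by
        have hm : Measurable fun q : X × ℝ => ENNReal.ofReal (s * q.2 ^ (s - 2)) *
          {x | ENNReal.ofReal (c * q.2) < g x}.indicator g q.1 := Measurable.mul (by fun_prop) hmg
        rw [lintegral_const_mul, ← lintegral_lintegral_swap (f := fun x a =>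
          ENNReal.ofReal (s * a ^ (s - 2)) * {x | ENNReal.ofReal (c * a) < g x}.indicator g x)
          hm.aemeasurable]
        exact hm.lintegral_prod_left'
    _ = B * ∫⁻ x, ENNReal.ofReal (s / (s - 1) * c⁻¹ ^ (s - 1)) * g x ^ s ∂μ := by
        congr 1
        refine lintegral_congr fun x => ?_
        have h1 : ∀ a : ℝ, 0 < a → ENNReal.ofReal (s * a ^ (s - 2)) *
            {x | ENNReal.ofReal (c * a) < g x}.indicator g x =
            (ENNReal.ofReal (s / (s - 1)) * g x) * (ENNReal.ofReal ((s - 1) * a ^ (s - 1 - 1)) *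
            {a : ℝ | ENNReal.ofReal a < ENNReal.ofReal c⁻¹ * g x}.indicator 1 a) := by
          intro a ha
          have e1 : s * a ^ (s - 2) = s / (s - 1) * ((s - 1) * a ^ (s - 1 - 1)) := by
            rw [show s - 1 - 1 = s - 2 by ring]; field_simp
          have e2 : {x | ENNReal.ofReal (c * a) < g x}.indicator g x = g x *
              {a : ℝ | ENNReal.ofReal a < ENNReal.ofReal c⁻¹ * g x}.indicator 1 a := by
            have : ENNReal.ofReal (c * a) < g x ↔ ENNReal.ofReal a < ENNReal.ofReal c⁻¹ * g x := by
              rw [ENNReal.ofReal_inv_of_pos hc, ENNReal.ofReal_mul hc.le, mul_comm _ (g x),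
                ← div_eq_mul_inv, ENNReal.lt_div_iff_mul_lt (by simp [hc]) (by simp), mul_comm]
            simp only [Set.indicator, Set.mem_ofPred_eq, this, Pi.one_apply]
            split_ifs <;> simp
          rw [e1, e2, ENNReal.ofReal_mul (by positivity)]
          ring
        rw [setLIntegral_congr_fun measurableSet_Ioi h1, lintegral_const_mul,
          rpow_eq_lintegral_layer hs1, ENNReal.mul_rpow_of_nonneg _ _ hs1.le,
          ENNReal.ofReal_mul (by positivity), ENNReal.ofReal_rpow_of_pos (by positivity)]
        · have : g x ^ s = g x * g x ^ (s - 1) := by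
            conv_lhs => rw [show s = 1 + (s - 1) by ring,
              ENNReal.rpow_add_of_nonneg _ _ zero_le_one hs1.le, ENNReal.rpow_one]
          rw [this]; ring
        · refine Measurable.mul (by fun_prop) (measurable_one.indicator ?_)
          exact measurableSet_lt (by fun_prop) (by fun_prop)
    _ = _ := by rw [lintegral_const_mul _ (by fun_prop), mul_assoc]

/-! ### The fractional-order maximal function and Poisson-type averages -/

/-- The maximal function `sup_i 2 ^ (-i m) ∫_{B(x, 2 ^ i)} h dμ`. -/
noncomputable def maxFn {n : ℕ} (m : ℝ) (μ : Measure (RSpace n)) (h : RSpace n → ℝ≥0∞)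
    (x : RSpace n) : ℝ≥0∞ :=
  ⨆ i : ℤ, ENNReal.ofReal (((2 : ℝ) ^ i) ^ (-m)) * ∫⁻ z in Metric.ball x ((2 : ℝ) ^ i), h z ∂μ

section
variable {n : ℕ} {m A : ℝ} {μ : Measure (RSpace n)}

theorem IsPowerBounded.isLocallyFiniteMeasure (hμ : IsPowerBounded m A μ) :
    IsLocallyFiniteMeasure μ :=
  ⟨fun x => ⟨Metric.ball x 1, Metric.ball_mem_nhds x one_pos,
    (hμ x 1 one_pos).trans_lt ENNReal.ofReal_lt_top⟩⟩

theorem measurable_setLIntegral_ball [SFinite μ] {h : RSpace n → ℝ≥0∞} (hh : Measurable h) (r : ℝ) :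
    Measurable fun x => ∫⁻ z in Metric.ball x r, h z ∂μ := by
  have hm : MeasurableSet {q : RSpace n × RSpace n | dist q.2 q.1 < r} :=
    measurableSet_lt (by fun_prop) (by fun_prop)
  have : (fun x => ∫⁻ z in Metric.ball x r, h z ∂μ) = fun x => ∫⁻ z,
      {q : RSpace n × RSpace n | dist q.2 q.1 < r}.indicator (fun q => h q.2) (x, z) ∂μ := by
    funext x
    rw [← lintegral_indicator Metric.isOpen_ball.measurableSet]
    rfl
  rw [this]
  exact ((hh.comp measurable_snd).indicator hm).lintegral_prod_right'

theorem measurable_maxFn [SFinite μ] {h : RSpace n → ℝ≥0∞} (hh : Measurable h) :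
    Measurable (maxFn m μ h) :=
  .iSup fun _ => (measurable_setLIntegral_ball hh _).const_mul _

theorem maxFn_add_le {h₁ h₂ : RSpace n → ℝ≥0∞} (hh : Measurable h₁) (x : RSpace n) :
    maxFn m μ (h₁ + h₂) x ≤ maxFn m μ h₁ x + maxFn m μ h₂ x := by
  refine iSup_le fun i => ?_
  simp only [Pi.add_apply]
  rw [lintegral_add_left hh, mul_add]
  exact add_le_add (le_iSup (fun i : ℤ => ENNReal.ofReal (((2 : ℝ) ^ i) ^ (-m)) *
    ∫⁻ z in Metric.ball x ((2 : ℝ) ^ i), h₁ z ∂μ) i) (le_iSup (fun i : ℤ =>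
    ENNReal.ofReal (((2 : ℝ) ^ i) ^ (-m)) * ∫⁻ z in Metric.ball x ((2 : ℝ) ^ i), h₂ z ∂μ) i)

theorem maxFn_const_mul (c : ℝ≥0∞) (hc : c ≠ ⊤) (h : RSpace n → ℝ≥0∞) (x : RSpace n) :
    maxFn m μ (fun z => c * h z) x = c * maxFn m μ h x := by
  simp only [maxFn, ENNReal.mul_iSup]
  congr 1; funext i
  rw [lintegral_const_mul' _ _ hc, mul_left_comm]

theorem maxFn_tsum_le {h : ℕ → RSpace n → ℝ≥0∞} (hh : ∀ k, Measurable (h k)) (x : RSpace n) :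
    maxFn m μ (fun z => ∑' k, h k z) x ≤ ∑' k, maxFn m μ (h k) x := by
  refine iSup_le fun i => ?_
  rw [lintegral_tsum fun k => (hh k).aemeasurable, ← ENNReal.tsum_mul_left]
  exact ENNReal.tsum_le_tsum fun k => le_iSup (fun i : ℤ => ENNReal.ofReal (((2 : ℝ) ^ i) ^ (-m)) *
    ∫⁻ z in Metric.ball x ((2 : ℝ) ^ i), h k z ∂μ) i

/-- Enlarging the ball to the next dyadic radius, which is at most 2r, costs the factor 2^m. -/
theorem setLIntegral_ball_le_maxFn (hm : 0 < m) {r : ℝ} (hr : 0 < r) (h : RSpace n → ℝ≥0∞)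
    (x : RSpace n) :
    ∫⁻ z in Metric.ball x r, h z ∂μ ≤ ENNReal.ofReal (2 ^ m * r ^ m) * maxFn m μ h x := by
  obtain ⟨i, hi1, hi2⟩ := exists_mem_Ioc_zpow hr (one_lt_two (α := ℝ))
  have h2 : (0 : ℝ) < 2 ^ (i + 1) := by positivity
  have h3 : (2 : ℝ) ^ (i + 1) ≤ 2 * r := by
    rw [zpow_add_one₀ (by norm_num)]; linarith
  calc ∫⁻ z in Metric.ball x r, h z ∂μ ≤ ∫⁻ z in Metric.ball x (2 ^ (i + 1)), h z ∂μ :=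
        lintegral_mono_set (Metric.ball_subset_ball hi2)
    _ = ENNReal.ofReal (((2 : ℝ) ^ (i + 1)) ^ m) * (ENNReal.ofReal (((2 : ℝ) ^ (i + 1)) ^ (-m)) *
        ∫⁻ z in Metric.ball x (2 ^ (i + 1)), h z ∂μ) := by
        rw [← mul_assoc, ← ENNReal.ofReal_mul (by positivity), ← Real.rpow_add h2]
        simp
    _ ≤ _ := by
        rw [← Real.mul_rpow (by norm_num) hr.le]
        gcongr
        exact le_iSup (fun i : ℤ => ENNReal.ofReal (((2 : ℝ) ^ i) ^ (-m)) *
          ∫⁻ z in Metric.ball x ((2 : ℝ) ^ i), h z ∂μ) (i + 1)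

/-- Averages are normalised by r^m and not by the measure of the ball, so the growth bound alone
gives boundedness on L^∞. No doubling is involved. -/
theorem maxFn_le_of_le (hμ : IsPowerBounded m A μ)
    {h : RSpace n → ℝ≥0∞} {c : ℝ≥0∞} (hc : ∀ z, h z ≤ c) (x : RSpace n) :
    maxFn m μ h x ≤ ENNReal.ofReal A * c := by
  refine iSup_le fun i => ?_
  have h2 : (0 : ℝ) < 2 ^ i := by positivity
  calc ENNReal.ofReal (((2 : ℝ) ^ i) ^ (-m)) * ∫⁻ z in Metric.ball x (2 ^ i), h z ∂μ
      ≤ ENNReal.ofReal (((2 : ℝ) ^ i) ^ (-m)) * (c * ENNReal.ofReal (A * (2 ^ i) ^ m)) := by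
        gcongr
        refine (lintegral_mono fun z => hc z).trans ?_
        rw [setLIntegral_const]
        gcongr
        exact hμ x _ h2
    _ = ENNReal.ofReal A * c := by
        rw [mul_left_comm, ← ENNReal.ofReal_mul (by positivity), mul_left_comm,
          ← Real.rpow_add h2]
        simp [mul_comm]

/-- Weak type `(1, 1)` of the maximal function. -/
theorem maxFn_weak_type (hm : 0 < m) (hA : 0 < A) (hμ : IsPowerBounded m A μ)
    (h : RSpace n → ℝ≥0∞) {a : ℝ} (ha : 0 < a) :
    ENNReal.ofReal a * μ {x | ENNReal.ofReal a < maxFn m μ h x} ≤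
      ENNReal.ofReal (A * 6 ^ m) * ∫⁻ z, h z ∂μ := by
  rcases eq_or_ne (∫⁻ z, h z ∂μ) ⊤ with hI | hI
  · rw [hI, ENNReal.mul_top (by simpa using by positivity)]
    exact le_top
  have hex : ∀ x ∈ {x | ENNReal.ofReal a < maxFn m μ h x}, ∃ i : ℤ,
      ENNReal.ofReal (a * ((2 : ℝ) ^ i) ^ m) ≤ ∫⁻ z in Metric.ball x ((2 : ℝ) ^ i), h z ∂μ := by
    intro x hx
    obtain ⟨i, hi⟩ := lt_iSup_iff.1 (show ENNReal.ofReal a < maxFn m μ h x from hx)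
    refine ⟨i, ?_⟩
    have h2 : (0 : ℝ) < 2 ^ i := by positivity
    calc ENNReal.ofReal (a * ((2 : ℝ) ^ i) ^ m)
        = ENNReal.ofReal (((2 : ℝ) ^ i) ^ m) * ENNReal.ofReal a := by
          rw [ENNReal.ofReal_mul ha.le, mul_comm]
      _ ≤ ENNReal.ofReal (((2 : ℝ) ^ i) ^ m) * (ENNReal.ofReal (((2 : ℝ) ^ i) ^ (-m)) *
          ∫⁻ z in Metric.ball x ((2 : ℝ) ^ i), h z ∂μ) := by gcongr
      _ = _ := by
          rw [← mul_assoc, ← ENNReal.ofReal_mul (by positivity), ← Real.rpow_add h2]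
          simp
  choose! i hi using hex
  set I := (∫⁻ z, h z ∂μ).toReal with hIdef
  -- The selected radii are bounded because h has finite integral; the Vitali lemma needs this.
  have hR : ∀ x ∈ {x | ENNReal.ofReal a < maxFn m μ h x}, (2 : ℝ) ^ i x ≤ (I / a) ^ (1 / m) := by
    intro x hx
    have h2 : (0 : ℝ) < 2 ^ i x := by positivity
    have h3 : a * ((2 : ℝ) ^ i x) ^ m ≤ I := by
      rw [hIdef, ← ENNReal.ofReal_le_iff_le_toReal hI]
      exact (hi x hx).trans (setLIntegral_le_lintegral _ _)
    calc (2 : ℝ) ^ i x = (((2 : ℝ) ^ i x) ^ m) ^ (1 / m) := by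
          rw [← Real.rpow_mul h2.le, mul_one_div_cancel hm.ne', Real.rpow_one]
      _ ≤ _ := by
          gcongr
          rw [le_div_iff₀ ha]; linarith
  obtain ⟨u, hu, hdisj, hcov⟩ := Vitali.exists_disjoint_subfamily_covering_enlargement_closedBall
    {x | ENNReal.ofReal a < maxFn m μ h x} id (fun x => (2 : ℝ) ^ i x) _ hR 5 (by norm_num)
  have hcount : u.Countable := hdisj.countable_of_nonempty_interior fun x _ =>
    ⟨x, Metric.ball_subset_interior_closedBall (Metric.mem_ball_self (by positivity))⟩
  -- The closed balls enlarged 5 times are put into open balls enlarged 6 times, since the growth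
  -- condition speaks of open balls. This is the 6 in the constant.
  have hsub : {x | ENNReal.ofReal a < maxFn m μ h x} ⊆
      ⋃ b ∈ u, Metric.ball b (6 * (2 : ℝ) ^ i b) := by
    intro x hx
    obtain ⟨b, hb, hxb⟩ := hcov x hx
    have h2 : (0 : ℝ) < 2 ^ i b := by positivity
    refine Set.mem_biUnion hb (Metric.closedBall_subset_ball ?_ (hxb (Metric.mem_closedBall_self
      (by positivity))))
    linarith
  calc ENNReal.ofReal a * μ {x | ENNReal.ofReal a < maxFn m μ h x}
      ≤ ENNReal.ofReal a * ∑' b : u, μ (Metric.ball b.1 (6 * (2 : ℝ) ^ i b)) := by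
        gcongr
        exact (measure_mono hsub).trans (measure_biUnion_le μ hcount _)
    _ = ∑' b : u, ENNReal.ofReal a * μ (Metric.ball b.1 (6 * (2 : ℝ) ^ i b)) :=
        ENNReal.tsum_mul_left.symm
    _ ≤ ∑' b : u, ENNReal.ofReal (A * 6 ^ m) *
          ∫⁻ z in Metric.closedBall (id b.1) ((2 : ℝ) ^ i b.1), h z ∂μ := by
        refine ENNReal.tsum_le_tsum fun b => ?_
        have h2 : (0 : ℝ) < 2 ^ i b := by positivity
        calc ENNReal.ofReal a * μ (Metric.ball b.1 (6 * (2 : ℝ) ^ i b))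
            ≤ ENNReal.ofReal a * ENNReal.ofReal (A * (6 * 2 ^ i b.1) ^ m) := by
              gcongr
              exact hμ _ _ (by positivity)
          _ = ENNReal.ofReal (A * 6 ^ m) * ENNReal.ofReal (a * (2 ^ i b.1) ^ m) := by
              rw [← ENNReal.ofReal_mul ha.le, ← ENNReal.ofReal_mul (by positivity),
                Real.mul_rpow (by norm_num) h2.le]
              congr 1; ring
          _ ≤ _ := by
              gcongr
              exact (hi _ (hu b.2)).trans (lintegral_mono_set Metric.ball_subset_closedBall)
    _ = ENNReal.ofReal (A * 6 ^ m) *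
          ∫⁻ z in ⋃ b ∈ u, Metric.closedBall (id b) ((2 : ℝ) ^ i b), h z ∂μ := by
        rw [ENNReal.tsum_mul_left, lintegral_biUnion hcount
          (fun b _ => Metric.isClosed_closedBall.measurableSet) hdisj]
    _ ≤ _ := by
        exact mul_le_mul_right (setLIntegral_le_lintegral _ _) _

/-- Truncating the function at a height comparable to the level: a sublinear operator that is of
weak type `(1, 1)` and bounded on `L^∞` is of strong type `(s, s)`. -/
theorem maxFn_strong_type (hm : 0 < m) (hA : 0 < A) {s : ℝ} (hs : 1 < s) :
    ∃ C : ℝ≥0, ∀ μ : Measure (RSpace n), IsPowerBounded m A μ → ∀ h : RSpace n → ℝ≥0∞,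
      Measurable h → ∫⁻ x, maxFn m μ h x ^ s ∂μ ≤ C * ∫⁻ x, h x ^ s ∂μ := by
  refine ⟨(2 * (A * 6 ^ m) * (s / (s - 1) * ((2 * A)⁻¹)⁻¹ ^ (s - 1))).toNNReal,
    fun μ hμ h hh => ?_⟩
  have := hμ.isLocallyFiniteMeasure
  have hs1 : 0 < s - 1 := by linarith
  -- With c = 1/(2A), the part of h below c·a has maximal function at most a/2, so only the part
  -- above c·a counts at level a.
  have key := lintegral_rpow_le_of_weak_type (μ := μ) (measurable_maxFn (m := m) (μ := μ) hh) hh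
    (c := (2 * A)⁻¹) (by positivity) hs (B := ENNReal.ofReal (2 * (A * 6 ^ m))) ?_
  · rw [← ENNReal.ofReal_mul (by positivity)] at key
    exact key
  intro a ha
  set S := {x | ENNReal.ofReal ((2 * A)⁻¹ * a) < h x} with hS
  have hSm : MeasurableSet S := measurableSet_lt measurable_const hh
  have hsplit : h = S.indicator h + Sᶜ.indicator h := (Set.indicator_self_add_compl S h).symm
  have hsmall : ∀ x, maxFn m μ (Sᶜ.indicator h) x ≤ ENNReal.ofReal (a / 2) := by
    intro x
    refine (maxFn_le_of_le hμ (c := ENNReal.ofReal ((2 * A)⁻¹ * a)) (fun z => ?_) x).trans ?_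
    · by_cases hz : z ∈ S
      · simp [hz]
      · rw [Set.indicator_of_mem (by simpa using hz)]
        simpa [hS] using hz
    · rw [← ENNReal.ofReal_mul hA.le]
      apply ENNReal.ofReal_le_ofReal
      rw [mul_inv]; field_simp; rfl
  have hsub : {x | ENNReal.ofReal a < maxFn m μ h x} ⊆
      {x | ENNReal.ofReal (a / 2) < maxFn m μ (S.indicator h) x} := by
    intro x (hx : ENNReal.ofReal a < maxFn m μ h x)
    by_contra hcon
    have hcon : maxFn m μ (S.indicator h) x ≤ ENNReal.ofReal (a / 2) := not_lt.1 hcon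
    refine absurd hx (not_lt.2 ?_)
    rw [hsplit]
    calc _ ≤ _ := maxFn_add_le (hh.indicator hSm) x
      _ ≤ ENNReal.ofReal (a / 2) + ENNReal.ofReal (a / 2) := add_le_add hcon (hsmall x)
      _ = ENNReal.ofReal a := by
        rw [← ENNReal.ofReal_add (by positivity) (by positivity), add_halves]
  calc ENNReal.ofReal a * μ {x | ENNReal.ofReal a < maxFn m μ h x}
      ≤ ENNReal.ofReal 2 * (ENNReal.ofReal (a / 2) *
          μ {x | ENNReal.ofReal (a / 2) < maxFn m μ (S.indicator h) x}) := by
        rw [← mul_assoc, ← ENNReal.ofReal_mul (by norm_num), mul_div_cancel₀ _ (by norm_num)]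
        gcongr
    _ ≤ ENNReal.ofReal 2 * (ENNReal.ofReal (A * 6 ^ m) * ∫⁻ z, S.indicator h z ∂μ) := by
        exact mul_le_mul_right (maxFn_weak_type hm hA hμ _ (by positivity)) _
    _ = _ := by
        rw [← mul_assoc, ← ENNReal.ofReal_mul (by norm_num), lintegral_indicator hSm]

end

/-- The Poisson-type kernel `t ^ b / (t + r) ^ (m + b)`. -/
noncomputable def poissonKer (m b t r : ℝ) : ℝ := t ^ b / (t + r) ^ (m + b)

/-- The average `∫ t ^ b / (t + |y - z|) ^ (m + b) h(z) dμ(z)`. -/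
noncomputable def poissonAvg {n : ℕ} (m b : ℝ) (μ : Measure (RSpace n)) (t : ℝ)
    (h : RSpace n → ℝ≥0∞) (y : RSpace n) : ℝ≥0∞ :=
  ∫⁻ z, ENNReal.ofReal (poissonKer m b t ‖y - z‖) * h z ∂μ

/-- The average of the square of `poissonAvg` against `t ^ (-m) (1 + |x - y| / t) ^ (-2 m - b)`. -/
noncomputable def sqAvg {n : ℕ} (m b : ℝ) (μ : Measure (RSpace n)) (t : ℝ)
    (h : RSpace n → ℝ≥0∞) (x : RSpace n) : ℝ≥0∞ :=
  ∫⁻ y, ENNReal.ofReal (t ^ (-m) * (1 + ‖x - y‖ / t) ^ (-(2 * m + b))) *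
    poissonAvg m b μ t h y ^ 2 ∂μ

/-- The constant in the domination of `poissonAvg` by the maximal function. -/
noncomputable def poissonConst (m b : ℝ) : ℝ≥0 := (4 ^ m * (1 - 2 ^ (-b))⁻¹ : ℝ).toNNReal

/-- Cauchy–Schwarz for k h = (k u)^(1/2) (k h²/u)^(1/2). The weight u may vanish only where h does.
-/
theorem lintegral_mul_sq_le {X : Type*} [MeasurableSpace X] {μ : Measure X} {k h u : X → ℝ≥0∞}
    (hk : Measurable k) (hh : Measurable h) (hu : Measurable u) (hut : ∀ᵐ x ∂μ, u x ≠ ⊤)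
    (hhu : ∀ x, u x = 0 → h x = 0) :
    (∫⁻ x, k x * h x ∂μ) ^ 2 ≤ (∫⁻ x, k x * u x ∂μ) * ∫⁻ x, k x * (h x ^ 2 / u x) ∂μ := by
  have key := ENNReal.lintegral_mul_le_Lp_mul_Lq μ (Real.HolderConjugate.two_two)
    (f := fun x => (k x * u x) ^ (1 / 2 : ℝ)) (g := fun x => (k x * (h x ^ 2 / u x)) ^ (1 / 2 : ℝ))
    (by fun_prop) (by fun_prop)
  have e : ∀ z : ℝ≥0∞, (z ^ (1 / 2 : ℝ)) ^ (2 : ℝ) = z := fun z => by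
    rw [← ENNReal.rpow_mul]; norm_num
  have e' : ∀ z : ℝ≥0∞, (z ^ 2) ^ (1 / 2 : ℝ) = z := fun z => by
    rw [← ENNReal.rpow_natCast, ← ENNReal.rpow_mul]; norm_num
  simp only [e, Pi.mul_apply] at key
  have h1 : ∫⁻ x, k x * h x ∂μ ≤
      ∫⁻ x, (k x * u x) ^ (1 / 2 : ℝ) * (k x * (h x ^ 2 / u x)) ^ (1 / 2 : ℝ) ∂μ := by
    refine lintegral_mono_ae ?_
    filter_upwards [hut] with x hx
    rw [← ENNReal.mul_rpow_of_nonneg _ _ (by norm_num)]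
    by_cases h0 : u x = 0
    · simp [hhu x h0]
    · have : k x * u x * (k x * (h x ^ 2 / u x)) = (k x * h x) ^ 2 := by
        rw [mul_pow, mul_mul_mul_comm, ENNReal.mul_div_cancel h0 hx, sq (k x)]
      rw [this, e']
  calc _ ≤ ((∫⁻ x, k x * u x ∂μ) ^ (1 / 2 : ℝ) *
        (∫⁻ x, k x * (h x ^ 2 / u x) ∂μ) ^ (1 / 2 : ℝ)) ^ 2 := by gcongr; exact h1.trans key
    _ = _ := by
      rw [mul_pow]
      simp only [← ENNReal.rpow_natCast, Nat.cast_ofNat, e]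

section
variable {n : ℕ} {m b A t : ℝ} {μ : Measure (RSpace n)}

theorem poissonKer_nonneg (ht : 0 ≤ t) {r : ℝ} (hr : 0 ≤ r) : 0 ≤ poissonKer m b t r := by
  unfold poissonKer; positivity

theorem measurable_poissonKer (x : RSpace n) :
    Measurable fun y : RSpace n => ENNReal.ofReal (poissonKer m b t ‖x - y‖) := by
  unfold poissonKer; fun_prop

theorem measurable_poissonKer_uncurry :
    Measurable fun q : RSpace n × RSpace n => ENNReal.ofReal (poissonKer m b t ‖q.1 - q.2‖) := by
  unfold poissonKer; fun_prop

theorem measurable_poissonAvg [SFinite μ] {h : RSpace n → ℝ≥0∞} (hh : Measurable h) :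
    Measurable (poissonAvg m b μ t h) :=
  (measurable_poissonKer_uncurry.mul (hh.comp measurable_snd)).lintegral_prod_right'

theorem measurable_sqAvg [SFinite μ] {h : RSpace n → ℝ≥0∞} (hh : Measurable h) :
    Measurable (sqAvg m b μ t h) := by
  have h1 : Measurable fun q : RSpace n × RSpace n =>
      ENNReal.ofReal (t ^ (-m) * (1 + ‖q.1 - q.2‖ / t) ^ (-(2 * m + b))) := by fun_prop
  exact (h1.mul (((measurable_poissonAvg hh).comp measurable_snd).pow_const 2)).lintegral_prod_right'

theorem poissonAvg_mono {h₁ h₂ : RSpace n → ℝ≥0∞} (h : ∀ z, h₁ z ≤ h₂ z) (y : RSpace n) :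
    poissonAvg m b μ t h₁ y ≤ poissonAvg m b μ t h₂ y :=
  lintegral_mono fun z => mul_le_mul_right (h z) _

theorem poissonAvg_const_mul {c : ℝ≥0∞} (hc : c ≠ ⊤) (h : RSpace n → ℝ≥0∞) (y : RSpace n) :
    poissonAvg m b μ t (fun z => c * h z) y = c * poissonAvg m b μ t h y := by
  unfold poissonAvg
  rw [← lintegral_const_mul' _ _ hc]
  exact lintegral_congr fun z => mul_left_comm _ _ _

theorem poissonAvg_add {h₁ h₂ : RSpace n → ℝ≥0∞} (hh : Measurable h₁) (y : RSpace n) :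
    poissonAvg m b μ t (fun z => h₁ z + h₂ z) y =
      poissonAvg m b μ t h₁ y + poissonAvg m b μ t h₂ y := by
  simp only [poissonAvg, mul_add]
  exact lintegral_add_left ((measurable_poissonKer y).mul hh) _

/-- The averaging operator is self-adjoint because its kernel is symmetric. -/
theorem lintegral_poissonAvg_mul [SFinite μ] {h g : RSpace n → ℝ≥0∞} (hh : Measurable h)
    (hg : Measurable g) :
    ∫⁻ x, poissonAvg m b μ t h x * g x ∂μ = ∫⁻ x, h x * poissonAvg m b μ t g x ∂μ := by
  have h1 : ∀ x, poissonAvg m b μ t h x * g x =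
      ∫⁻ z, ENNReal.ofReal (poissonKer m b t ‖x - z‖) * h z * g x ∂μ := fun x =>
    (lintegral_mul_const _ ((measurable_poissonKer x).mul hh)).symm
  have h2 : ∀ x, h x * poissonAvg m b μ t g x =
      ∫⁻ z, h x * (ENNReal.ofReal (poissonKer m b t ‖x - z‖) * g z) ∂μ := fun x =>
    (lintegral_const_mul _ ((measurable_poissonKer x).mul hg)).symm
  simp only [h1, h2]
  rw [lintegral_lintegral_swap]
  · refine lintegral_congr fun x => lintegral_congr fun z => ?_
    rw [norm_sub_rev]; ring
  · exact ((measurable_poissonKer_uncurry.mul (hh.comp measurable_snd)).mul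
      (hg.comp measurable_fst)).aemeasurable

/-- Only one term is needed: the i for which t + r lies between 2^i t and 2^(i+1) t. -/
theorem poissonKer_le_tsum (hm : 0 < m) (hb : 0 < b) (ht : 0 < t) {r : ℝ} (hr : 0 ≤ r) :
    ENNReal.ofReal (poissonKer m b t r) ≤ ∑' i : ℕ,
      ENNReal.ofReal (((2 : ℝ) ^ i) ^ (-(m + b)) * t ^ (-m)) *
        (Set.Iio ((2 : ℝ) ^ (i + 1) * t)).indicator 1 r := by
  obtain ⟨i, hi1, hi2⟩ := exists_nat_pow_near (x := (t + r) / t) (y := 2)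
    (by rw [le_div_iff₀ ht]; linarith) one_lt_two
  rw [le_div_iff₀ ht] at hi1
  rw [div_lt_iff₀ ht] at hi2
  refine le_trans ?_ (ENNReal.le_tsum i)
  rw [Set.indicator_of_mem (by simp only [Set.mem_Iio]; linarith), Pi.one_apply, mul_one]
  apply ENNReal.ofReal_le_ofReal
  unfold poissonKer
  calc t ^ b / (t + r) ^ (m + b) ≤ t ^ b / (2 ^ i * t) ^ (m + b) := by gcongr
    _ = _ := by
      rw [Real.mul_rpow (by positivity) ht.le, Real.rpow_neg (by positivity),
        Real.rpow_neg ht.le, Real.rpow_add ht]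
      field_simp

/-- The ball of radius 2^(i+1) t about y lies in the ball about x whose radius is larger by the
factor 1 + |x - y|/t. Moving the centre from y to x therefore costs the m-th power of that factor,
and the factors 2^(-b i) of the dyadic pieces sum geometrically. -/
theorem poissonAvg_le_maxFn (hm : 0 < m) (hb : 0 < b) (ht : 0 < t) {h : RSpace n → ℝ≥0∞}
    (hh : Measurable h) (x y : RSpace n) :
    poissonAvg m b μ t h y ≤
      poissonConst m b * ENNReal.ofReal ((1 + ‖x - y‖ / t) ^ m) * maxFn m μ h x := by
  set ρ := 1 + ‖x - y‖ / t with hρ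
  have hρ0 : 0 < ρ := by positivity
  have hq : (2 : ℝ) ^ (-b) < 1 := Real.rpow_lt_one_of_one_lt_of_neg one_lt_two (by linarith)
  calc poissonAvg m b μ t h y
      ≤ ∫⁻ z, ∑' i : ℕ, ENNReal.ofReal (((2 : ℝ) ^ i) ^ (-(m + b)) * t ^ (-m)) *
          (Metric.ball y ((2 : ℝ) ^ (i + 1) * t)).indicator h z ∂μ := by
        refine lintegral_mono fun z => ?_
        refine (mul_le_mul_left (poissonKer_le_tsum hm hb ht (norm_nonneg (y - z))) _).trans ?_
        rw [← ENNReal.tsum_mul_right]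
        refine ENNReal.tsum_le_tsum fun i => ?_
        rw [mul_assoc]
        refine mul_le_mul_right ?_ _
        by_cases hz : ‖y - z‖ < 2 ^ (i + 1) * t
        · have : z ∈ Metric.ball y (2 ^ (i + 1) * t) := by
            rwa [Metric.mem_ball', dist_eq_norm]
          simp [this, hz]
        · simp [hz, Set.indicator]
    _ = ∑' i : ℕ, ENNReal.ofReal (((2 : ℝ) ^ i) ^ (-(m + b)) * t ^ (-m)) *
          ∫⁻ z in Metric.ball y ((2 : ℝ) ^ (i + 1) * t), h z ∂μ := by
        rw [lintegral_tsum fun i => ((hh.indicator Metric.isOpen_ball.measurableSet).const_mul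
          _).aemeasurable]
        refine tsum_congr fun i => ?_
        rw [lintegral_const_mul _ (hh.indicator Metric.isOpen_ball.measurableSet),
          lintegral_indicator Metric.isOpen_ball.measurableSet]
    _ ≤ ∑' i : ℕ, ENNReal.ofReal (4 ^ m * (2 ^ (-b)) ^ i) *
          (ENNReal.ofReal (ρ ^ m) * maxFn m μ h x) := by
        refine ENNReal.tsum_le_tsum fun i => ?_
        have hsub : Metric.ball y ((2 : ℝ) ^ (i + 1) * t) ⊆
            Metric.ball x ((2 : ℝ) ^ (i + 1) * t * ρ) := by
          refine Metric.ball_subset_ball' ?_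
          rw [dist_comm, dist_eq_norm, hρ, mul_add, mul_one]
          gcongr
          have : (1 : ℝ) ≤ 2 ^ (i + 1) := one_le_pow₀ one_le_two
          have h2 : 2 ^ (i + 1) * t * (‖x - y‖ / t) = 2 ^ (i + 1) * ‖x - y‖ := by field_simp
          rw [h2]
          exact le_mul_of_one_le_left (norm_nonneg _) this
        calc _ ≤ ENNReal.ofReal (((2 : ℝ) ^ i) ^ (-(m + b)) * t ^ (-m)) *
              (ENNReal.ofReal (2 ^ m * ((2 : ℝ) ^ (i + 1) * t * ρ) ^ m) * maxFn m μ h x) := by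
              refine mul_le_mul_right ?_ _
              exact (lintegral_mono_set hsub).trans
                (setLIntegral_ball_le_maxFn hm (by positivity) _ _)
          _ = _ := by
              rw [← mul_assoc, ← mul_assoc, ← ENNReal.ofReal_mul (by positivity),
                ← ENNReal.ofReal_mul (by positivity)]
              congr 2
              have e4 : (4 : ℝ) ^ m = 2 ^ m * 2 ^ m := by
                rw [← Real.mul_rpow (by norm_num) (by norm_num)]; norm_num
              have ei : ((2 : ℝ) ^ (-b)) ^ i = ((2 : ℝ) ^ i) ^ (-b) := by
                rw [← Real.rpow_natCast, ← Real.rpow_mul (by norm_num), mul_comm,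
                  Real.rpow_mul (by norm_num), Real.rpow_natCast]
              rw [Real.mul_rpow (by positivity) hρ0.le, Real.mul_rpow (by positivity) ht.le,
                pow_succ, Real.mul_rpow (by positivity) (by norm_num), e4, ei, neg_add,
                Real.rpow_add (by positivity), Real.rpow_neg (x := 2 ^ i) (by positivity) m,
                Real.rpow_neg ht.le]
              field_simp
    _ = _ := by
        rw [ENNReal.tsum_mul_right, ← ENNReal.ofReal_tsum_of_nonneg (fun i => by positivity)
          ((summable_geometric_of_lt_one (by positivity) hq).mul_left _), tsum_mul_left,
          tsum_geometric_of_lt_one (by positivity) hq, mul_assoc]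
        rfl

theorem poissonAvg_le_maxFn_self (hm : 0 < m) (hb : 0 < b) (ht : 0 < t) {h : RSpace n → ℝ≥0∞}
    (hh : Measurable h) (y : RSpace n) :
    poissonAvg m b μ t h y ≤ poissonConst m b * maxFn m μ h y := by
  simpa using poissonAvg_le_maxFn (μ := μ) hm hb ht hh y y

theorem poissonAvg_one_le (hm : 0 < m) (hb : 0 < b) (ht : 0 < t) (hμ : IsPowerBounded m A μ)
    (y : RSpace n) : poissonAvg m b μ t (fun _ => 1) y ≤ poissonConst m b * ENNReal.ofReal A := by
  refine (poissonAvg_le_maxFn_self hm hb ht measurable_const y).trans ?_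
  have := maxFn_le_of_le hμ (h := fun _ => 1) (c := 1) (fun _ => le_rfl) y
  exact mul_le_mul_right (by simpa using this) _

/-- Cauchy–Schwarz with weight u leaves the average of u at y, which is replaced by the maximal
function of u at x at the price (1 + |x - y|/t)^m. The exponent 2m + b in `sqAvg` is chosen so that
after paying this price exactly the Poisson kernel of order b remains. -/
theorem sqAvg_le [SFinite μ] (hm : 0 < m) (hb : 0 < b) (ht : 0 < t) {h u : RSpace n → ℝ≥0∞}
    (hh : Measurable h) (hu : Measurable u) (hut : ∀ᵐ x ∂μ, u x ≠ ⊤)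
    (hhu : ∀ x, u x = 0 → h x = 0) (x : RSpace n) :
    sqAvg m b μ t h x ≤ poissonConst m b * maxFn m μ u x *
      poissonAvg m b μ t (poissonAvg m b μ t fun z => h z ^ 2 / u z) x := by
  set H := poissonAvg m b μ t fun z => h z ^ 2 / u z with hH
  have hHm : Measurable H := measurable_poissonAvg (by fun_prop)
  calc sqAvg m b μ t h x
      ≤ ∫⁻ y, poissonConst m b * maxFn m μ u x *
          (ENNReal.ofReal (poissonKer m b t ‖x - y‖) * H y) ∂μ := by
        refine lintegral_mono fun y => ?_
        have hr : 0 < 1 + ‖x - y‖ / t := by positivity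
        have e : t ^ (-m) * (1 + ‖x - y‖ / t) ^ (-(2 * m + b)) * (1 + ‖x - y‖ / t) ^ m =
            poissonKer m b t ‖x - y‖ := by
          rw [mul_assoc, ← Real.rpow_add hr, show -(2 * m + b) + m = -(m + b) by ring]
          have : t + ‖x - y‖ = t * (1 + ‖x - y‖ / t) := by field_simp
          rw [poissonKer, this, Real.mul_rpow ht.le hr.le, Real.rpow_neg ht.le, Real.rpow_neg hr.le,
            Real.rpow_add ht]
          field_simp
        calc _ ≤ ENNReal.ofReal (t ^ (-m) * (1 + ‖x - y‖ / t) ^ (-(2 * m + b))) *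
              (poissonAvg m b μ t u y * H y) := by
              refine mul_le_mul_right ?_ _
              exact lintegral_mul_sq_le (measurable_poissonKer y) hh hu hut hhu
          _ ≤ ENNReal.ofReal (t ^ (-m) * (1 + ‖x - y‖ / t) ^ (-(2 * m + b))) *
              (poissonConst m b * ENNReal.ofReal ((1 + ‖x - y‖ / t) ^ m) * maxFn m μ u x * H y) :=
              mul_le_mul_right (mul_le_mul_left (poissonAvg_le_maxFn hm hb ht hu x y) _) _
          _ = _ := by
              rw [← e, ENNReal.ofReal_mul (q := (1 + ‖x - y‖ / t) ^ m) (by positivity)]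
              ring
    _ = _ := lintegral_const_mul _ ((measurable_poissonKer x).mul hHm)

/-- Take u = 1 in `sqAvg_le` and move the two averages onto g by self-adjointness, where each
becomes a maximal function. This is the form used for exponents at least 2. -/
theorem lintegral_sqAvg_mul_le (hm : 0 < m) (hb : 0 < b) (ht : 0 < t)
    (hμ : IsPowerBounded m A μ) {h g : RSpace n → ℝ≥0∞} (hh : Measurable h) (hg : Measurable g) :
    ∫⁻ x, sqAvg m b μ t h x * g x ∂μ ≤ (poissonConst m b ^ 3 * A.toNNReal : ℝ≥0) *
      ∫⁻ x, h x ^ 2 * maxFn m μ (maxFn m μ g) x ∂μ := by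
  have := hμ.isLocallyFiniteMeasure
  set P := poissonAvg m b μ t
  have h1 : ∀ x, sqAvg m b μ t h x ≤ (poissonConst m b * ENNReal.ofReal A) *
      P (P fun z => h z ^ 2) x := by
    intro x
    have := sqAvg_le (μ := μ) (u := fun _ => 1) hm hb ht hh measurable_const (by simp) (by simp) x
    simp only [div_one] at this
    refine this.trans (mul_le_mul_left (mul_le_mul_right ?_ _) _)
    simpa using maxFn_le_of_le hμ (h := fun _ => 1) (c := 1) (fun _ => le_rfl) x
  have hPg : ∀ x, P (P g) x ≤ poissonConst m b * (poissonConst m b * maxFn m μ (maxFn m μ g) x) := by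
    intro x
    refine (poissonAvg_mono (fun z => poissonAvg_le_maxFn_self hm hb ht hg z) x).trans ?_
    rw [poissonAvg_const_mul ENNReal.coe_ne_top]
    exact mul_le_mul_right (poissonAvg_le_maxFn_self hm hb ht (measurable_maxFn hg) x) _
  calc ∫⁻ x, sqAvg m b μ t h x * g x ∂μ
      ≤ ∫⁻ x, (poissonConst m b * ENNReal.ofReal A) * (P (P fun z => h z ^ 2) x * g x) ∂μ := by
        refine lintegral_mono fun x => ?_
        rw [← mul_assoc]
        exact mul_le_mul_left (h1 x) _
    _ = (poissonConst m b * ENNReal.ofReal A) * ∫⁻ x, h x ^ 2 * P (P g) x ∂μ := by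
        have hc : (poissonConst m b * ENNReal.ofReal A : ℝ≥0∞) ≠ ⊤ := by finiteness
        have hP2 : Measurable (P fun z => h z ^ 2) := measurable_poissonAvg (by fun_prop)
        rw [lintegral_const_mul' _ _ hc,
          lintegral_poissonAvg_mul hP2 hg,
          lintegral_poissonAvg_mul (by fun_prop) (measurable_poissonAvg hg)]
    _ ≤ (poissonConst m b * ENNReal.ofReal A) * ∫⁻ x, (poissonConst m b * poissonConst m b) *
          (h x ^ 2 * maxFn m μ (maxFn m μ g) x) ∂μ := by
        refine mul_le_mul_right (lintegral_mono fun x => ?_) _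
        refine (mul_le_mul_right (hPg x) _).trans (le_of_eq ?_)
        ring
    _ = _ := by
        have hc : (poissonConst m b * poissonConst m b : ℝ≥0∞) ≠ ⊤ := by finiteness
        rw [lintegral_const_mul' _ _ hc, ← mul_assoc]
        congr 1
        push_cast
        rw [ENNReal.ofReal]; ring

/-- Take u = v in `sqAvg_le`: the A₁-type condition on v cancels the division by v, and the two
averages that remain are moved onto the constant 1, where they are bounded. This is the form used
for exponents below 2. -/
theorem lintegral_sqAvg_div_le (hm : 0 < m) (hb : 0 < b) (ht : 0 < t)
    (hμ : IsPowerBounded m A μ) {h v : RSpace n → ℝ≥0∞} (hh : Measurable h) (hv : Measurable v)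
    (hvt : ∀ᵐ x ∂μ, v x ≠ ⊤) (hhv : ∀ x, v x = 0 → h x = 0) {B : ℝ≥0}
    (hB : ∀ x, maxFn m μ v x ≤ B * v x) :
    ∫⁻ x, sqAvg m b μ t h x / v x ∂μ ≤ (poissonConst m b ^ 3 * A.toNNReal ^ 2 * B : ℝ≥0) *
      ∫⁻ x, h x ^ 2 / v x ∂μ := by
  have := hμ.isLocallyFiniteMeasure
  set P := poissonAvg m b μ t
  set H : RSpace n → ℝ≥0∞ := fun z => h z ^ 2 / v z
  have hHm : Measurable H := by fun_prop
  have hP1 : ∀ x, P (P fun _ => 1) x ≤ (poissonConst m b * ENNReal.ofReal A) *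
      (poissonConst m b * ENNReal.ofReal A) := by
    intro x
    have hc : (poissonConst m b * ENNReal.ofReal A : ℝ≥0∞) ≠ ⊤ := by finiteness
    refine (poissonAvg_mono (fun z => (poissonAvg_one_le hm hb ht hμ z).trans
      (mul_one _).symm.le) x).trans ?_
    rw [poissonAvg_const_mul hc]
    exact mul_le_mul_right (poissonAvg_one_le hm hb ht hμ x) _
  calc ∫⁻ x, sqAvg m b μ t h x / v x ∂μ
      ≤ ∫⁻ x, (poissonConst m b * B) * (P (P H) x * 1) ∂μ := by
        refine lintegral_mono fun x => ?_
        calc sqAvg m b μ t h x / v x ≤ poissonConst m b * (B * v x) * P (P H) x / v x := by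
              refine ENNReal.div_le_div_right ((sqAvg_le hm hb ht hh hv hvt hhv x).trans ?_) _
              exact mul_le_mul_left (mul_le_mul_right (hB x) _) _
          _ = poissonConst m b * B * P (P H) x * (v x / v x) := by
              rw [div_eq_mul_inv, div_eq_mul_inv]; ring
          _ ≤ _ := by
              rw [← mul_assoc]
              exact mul_le_mul_right ENNReal.div_self_le_one _
    _ = (poissonConst m b * B) * ∫⁻ x, H x * P (P fun _ => 1) x ∂μ := by
        have hP2 : Measurable (P H) := measurable_poissonAvg hHm
        have hc : (poissonConst m b * B : ℝ≥0∞) ≠ ⊤ := by finiteness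
        rw [lintegral_const_mul' _ _ hc,
          lintegral_poissonAvg_mul hP2 measurable_const,
          lintegral_poissonAvg_mul hHm (measurable_poissonAvg measurable_const)]
    _ ≤ (poissonConst m b * B) * ∫⁻ x, H x * ((poissonConst m b * ENNReal.ofReal A) *
      (poissonConst m b * ENNReal.ofReal A)) ∂μ := by
        refine mul_le_mul_right (lintegral_mono fun x => ?_) _
        exact mul_le_mul_right (hP1 x) _
    _ = _ := by
        rw [lintegral_mul_const _ hHm, mul_comm (∫⁻ x, H x ∂μ), ← mul_assoc]
        congr 1
        push_cast
        rw [ENNReal.ofReal]; ring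

end

/-! ### Weights and duality -/

/-- Hölder for counting measure applied to w^(1/s') · (w^(1/s) a). -/
theorem ENNReal.tsum_mul_rpow_le {ι : Type*} (w a : ι → ℝ≥0∞) {s : ℝ} (hs : 1 < s) :
    (∑' k, w k * a k) ^ s ≤ (∑' k, w k) ^ (s - 1) * ∑' k, w k * a k ^ s := by
  have hs0 : 0 < s := by linarith
  have hconj := (Real.HolderConjugate.conjExponent hs).symm
  set s' := s.conjExponent
  let _ : MeasurableSpace ι := ⊤
  have key := ENNReal.lintegral_mul_le_Lp_mul_Lq Measure.count hconj
    (f := fun k => w k ^ (1 / s')) (g := fun k => w k ^ (1 / s) * a k)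
    (Measurable.of_discrete).aemeasurable (Measurable.of_discrete).aemeasurable
  have hs' : 0 < s' := hconj.pos
  have e1 : ∀ k, w k ^ (1 / s') * (w k ^ (1 / s) * a k) = w k * a k := fun k => by
    rw [← mul_assoc, ← ENNReal.rpow_add_of_nonneg _ _ (by positivity) (by positivity)]
    have : 1 / s' + 1 / s = 1 := by simpa using hconj.inv_add_inv_eq_one
    rw [this, ENNReal.rpow_one]
  have e2 : ∀ k, (w k ^ (1 / s')) ^ s' = w k := fun k => by
    rw [← ENNReal.rpow_mul, one_div_mul_cancel hs'.ne', ENNReal.rpow_one]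
  have e3 : ∀ k, (w k ^ (1 / s) * a k) ^ s = w k * a k ^ s := fun k => by
    rw [ENNReal.mul_rpow_of_nonneg _ _ hs0.le, ← ENNReal.rpow_mul, one_div_mul_cancel hs0.ne',
      ENNReal.rpow_one]
  simp only [Pi.mul_apply, e1, e2, e3, lintegral_count] at key
  calc _ ≤ ((∑' k, w k) ^ (1 / s') * (∑' k, w k * a k ^ s) ^ (1 / s)) ^ s := by gcongr
    _ = _ := by
      rw [ENNReal.mul_rpow_of_nonneg _ _ hs0.le, ← ENNReal.rpow_mul, ← ENNReal.rpow_mul,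
        one_div_mul_cancel hs0.ne', ENNReal.rpow_one]
      congr 2
      have h2 : 1 / s' = 1 - 1 / s := by
        have := hconj.inv_add_inv_eq_one
        rw [one_div, one_div]; linarith
      rw [h2]; field_simp

/-- Test with g = min(F, N)^(q-1). The truncation and the finite measure make the truncated integral
finite, so one may divide by its power 1/q'; then N tends to infinity. -/
theorem lintegral_rpow_le_of_dual {X : Type*} [MeasurableSpace X] {ν : Measure X}
    [IsFiniteMeasure ν] {q : ℝ} (hq : 1 < q) {F : X → ℝ≥0∞} (hF : Measurable F) {B : ℝ≥0∞}
    (h : ∀ g : X → ℝ≥0∞, Measurable g →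
      ∫⁻ x, F x * g x ∂ν ≤ B * (∫⁻ x, g x ^ q.conjExponent ∂ν) ^ (1 / q.conjExponent)) :
    ∫⁻ x, F x ^ q ∂ν ≤ B ^ q := by
  have hq0 : 0 < q := by linarith
  have hq1 : 0 < q - 1 := by linarith
  have hconj := Real.HolderConjugate.conjExponent hq
  set q' := q.conjExponent
  have hq' : 0 < q' := hconj.symm.pos
  have hqq' : (q - 1) * q' = q := by
    have := hconj.mul_eq_add; linarith
  have hbound : ∀ N : ℕ, ∫⁻ x, (min (F x) N) ^ q ∂ν ≤ B ^ q := by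
    intro N
    set I := ∫⁻ x, (min (F x) N) ^ q ∂ν with hI
    have hIfin : I ≠ ⊤ := by
      refine ne_top_of_le_ne_top (b := ∫⁻ _, (N : ℝ≥0∞) ^ q ∂ν) ?_
        (lintegral_mono fun x => by gcongr; exact min_le_right _ _)
      rw [lintegral_const]
      finiteness
    rcases eq_or_ne I 0 with h0 | h0
    · rw [h0]; exact zero_le
    have h1 : I ≤ B * I ^ (1 / q') := by
      have := h (fun x => (min (F x) N) ^ (q - 1)) (by fun_prop)
      simp only [← ENNReal.rpow_mul, hqq'] at this
      refine le_trans (lintegral_mono fun x => ?_) this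
      calc (min (F x) N) ^ q = (min (F x) N) * (min (F x) N) ^ (q - 1) := by
            conv_lhs => rw [show q = 1 + (q - 1) by ring,
              ENNReal.rpow_add_of_nonneg _ _ zero_le_one hq1.le, ENNReal.rpow_one]
        _ ≤ _ := mul_le_mul_left (min_le_left _ _) _
    have h2 : I = I ^ (1 / q) * I ^ (1 / q') := by
      rw [← ENNReal.rpow_add _ _ h0 hIfin]
      have : 1 / q + 1 / q' = 1 := by simpa using hconj.inv_add_inv_eq_one
      rw [this, ENNReal.rpow_one]
    have h3 : I ^ (1 / q) ≤ B := by
      have hpos : I ^ (1 / q') ≠ 0 := by simp [h0, hIfin]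
      have hfin : I ^ (1 / q') ≠ ⊤ := by finiteness
      rw [h2] at h1
      rw [← h2] at h1
      have h4 : I ^ (1 / q) * I ^ (1 / q') ≤ B * I ^ (1 / q') := by rwa [← h2]
      exact (ENNReal.mul_le_mul_iff_left hpos hfin).1 h4
    calc I = (I ^ (1 / q)) ^ q := by
          rw [← ENNReal.rpow_mul, one_div_mul_cancel hq0.ne', ENNReal.rpow_one]
      _ ≤ _ := by gcongr
  refine le_of_tendsto' (lintegral_tendsto_of_tendsto_of_monotone (f := fun N : ℕ => fun x =>
    (min (F x) N) ^ q) (fun N => by fun_prop) ?_ ?_) hbound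
  · refine .of_forall fun x N M hNM => ?_
    dsimp only
    gcongr
  · refine .of_forall fun x => ?_
    refine Filter.Tendsto.ennrpow_const q ?_
    have := (tendsto_const_nhds (x := F x)).min ENNReal.tendsto_nat_nhds_top
    simpa using this

section
variable {n : ℕ} {m A : ℝ}

/-- The Rubio de Francia algorithm for the maximal function. -/
theorem exists_weight_maxFn_le (hm : 0 < m) (hA : 0 < A) {s : ℝ} (hs : 1 < s) :
    ∃ B : ℝ≥0, ∀ μ : Measure (RSpace n), IsPowerBounded m A μ → ∀ g : RSpace n → ℝ≥0∞,
      Measurable g → ∃ v : RSpace n → ℝ≥0∞, Measurable v ∧ (∀ x, g x ≤ v x) ∧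
        (∀ x, maxFn m μ v x ≤ B * v x) ∧ ∫⁻ x, v x ^ s ∂μ ≤ 2 ^ s * ∫⁻ x, g x ^ s ∂μ := by
  obtain ⟨C, hC⟩ := maxFn_strong_type (n := n) hm hA hs
  have hs0 : 0 < s := by linarith
  -- D bounds the operator norm of the maximal function on L^s; the + 1 makes it invertible.
  set D : ℝ≥0 := (C + 1) ^ (1 / s) with hD
  have hD0 : D ≠ 0 := by positivity
  have hDs : (C : ℝ≥0∞) ≤ (D : ℝ≥0∞) ^ s := by
    rw [← ENNReal.coe_rpow_of_nonneg _ hs0.le, hD, ← NNReal.rpow_mul, one_div_mul_cancel hs0.ne',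
      NNReal.rpow_one]
    exact_mod_cast le_self_add
  refine ⟨2 * D, fun μ hμ g hg => ?_⟩
  have := hμ.isLocallyFiniteMeasure
  set a : ℕ → RSpace n → ℝ≥0∞ := fun k x => ((D : ℝ≥0∞)⁻¹) ^ k * (maxFn m μ)^[k] g x with ha
  have hmeas : ∀ k, Measurable ((maxFn m μ)^[k] g) := by
    intro k
    induction k with
    | zero => exact hg
    | succ k ih => rw [Function.iterate_succ_apply']; exact measurable_maxFn ih
  have hameas : ∀ k, Measurable (a k) := fun k => (hmeas k).const_mul _
  have hDinv : (D : ℝ≥0∞)⁻¹ ≠ ⊤ := by simpa using hD0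
  have hsucc : ∀ k x, maxFn m μ (a k) x = D * a (k + 1) x := by
    intro k x
    have hc : ((D : ℝ≥0∞)⁻¹) ^ k ≠ ⊤ := by finiteness
    rw [ha]
    simp only
    rw [maxFn_const_mul _ hc, Function.iterate_succ_apply', pow_succ, ← mul_assoc]
    congr 1
    rw [mul_comm (_ ^ k), ← mul_assoc, ENNReal.mul_inv_cancel (by simpa using hD0) (by simp),
      one_mul]
  have hint : ∀ k, ∫⁻ x, a k x ^ s ∂μ ≤ ∫⁻ x, g x ^ s ∂μ := by
    intro k
    induction k with
    | zero => simp [ha]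
    | succ k ih =>
      have h1 : ∀ x, a (k + 1) x = (D : ℝ≥0∞)⁻¹ * maxFn m μ (a k) x := fun x => by
        rw [hsucc, ← mul_assoc, ENNReal.inv_mul_cancel (by simpa using hD0) (by simp), one_mul]
      have hc : ((D : ℝ≥0∞)⁻¹) ^ s ≠ ⊤ := by finiteness
      simp only [h1, ENNReal.mul_rpow_of_nonneg _ _ hs0.le]
      rw [lintegral_const_mul' _ _ hc]
      calc _ ≤ ((D : ℝ≥0∞)⁻¹) ^ s * (C * ∫⁻ x, a k x ^ s ∂μ) :=
            mul_le_mul_right (hC μ hμ _ (hameas k)) _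
        _ ≤ ((D : ℝ≥0∞)⁻¹) ^ s * ((D : ℝ≥0∞) ^ s * ∫⁻ x, g x ^ s ∂μ) := by gcongr
        _ = _ := by
            rw [← mul_assoc, ← ENNReal.mul_rpow_of_nonneg _ _ hs0.le,
              ENNReal.inv_mul_cancel (by simpa using hD0) (by simp), ENNReal.one_rpow, one_mul]
  have hgeom : ∑' k : ℕ, ((2 : ℝ≥0∞)⁻¹) ^ k = 2 := by
    rw [ENNReal.tsum_geometric, ENNReal.one_sub_inv_two, inv_inv]
  refine ⟨fun x => ∑' k, (2⁻¹ : ℝ≥0∞) ^ k * a k x, ?_, ?_, ?_, ?_⟩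
  · exact .tsum fun k => (hameas k).const_mul _
  · intro x
    refine le_trans ?_ (ENNReal.le_tsum 0)
    simp [ha]
  · intro x
    refine (maxFn_tsum_le (fun k => (hameas k).const_mul _) x).trans ?_
    -- The maximal function shifts the series by one index at the price 2D, so v reproduces itself
    -- up to its first term.
    have h2 : ∀ k, maxFn m μ (fun z => (2⁻¹ : ℝ≥0∞) ^ k * a k z) x =
        (2 * D : ℝ≥0) * ((2⁻¹ : ℝ≥0∞) ^ (k + 1) * a (k + 1) x) := by
      intro k
      have hc : ((2 : ℝ≥0∞)⁻¹) ^ k ≠ ⊤ := by finiteness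
      rw [maxFn_const_mul _ hc, hsucc, pow_succ]
      push_cast
      rw [show (2 : ℝ≥0∞) * D * (2⁻¹ ^ k * 2⁻¹ * a (k + 1) x) =
        (2 * 2⁻¹) * (2⁻¹ ^ k * (D * a (k + 1) x)) by ring, ENNReal.mul_inv_cancel (by simp)
        (by simp), one_mul]
    simp only [h2]
    rw [ENNReal.tsum_mul_left]
    refine mul_le_mul_right ?_ _
    conv_rhs => rw [tsum_eq_zero_add' ENNReal.summable]
    exact le_add_self
  · calc ∫⁻ x, (∑' k, (2⁻¹ : ℝ≥0∞) ^ k * a k x) ^ s ∂μ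
        ≤ ∫⁻ x, 2 ^ (s - 1) * ∑' k, (2⁻¹ : ℝ≥0∞) ^ k * a k x ^ s ∂μ := by
          refine lintegral_mono fun x => (ENNReal.tsum_mul_rpow_le _ _ hs).trans ?_
          rw [hgeom]
      _ = 2 ^ (s - 1) * ∑' k, (2⁻¹ : ℝ≥0∞) ^ k * ∫⁻ x, a k x ^ s ∂μ := by
          have hc : (2 : ℝ≥0∞) ^ (s - 1) ≠ ⊤ := by
            refine ENNReal.rpow_ne_top_of_nonneg (by linarith) (by simp)
          rw [lintegral_const_mul' _ _ hc, lintegral_tsum fun k => by fun_prop]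
          congr 1
          exact tsum_congr fun k => lintegral_const_mul _ (by fun_prop)
      _ ≤ 2 ^ (s - 1) * ∑' k, (2⁻¹ : ℝ≥0∞) ^ k * ∫⁻ x, g x ^ s ∂μ := by
          refine mul_le_mul_right (ENNReal.tsum_le_tsum fun k => ?_) _
          exact mul_le_mul_right (hint k) _
      _ = _ := by
          rw [ENNReal.tsum_mul_right, hgeom, ← mul_assoc]
          congr 1
          conv_lhs => rw [← ENNReal.rpow_one (2 : ℝ≥0∞), ← ENNReal.rpow_mul,
            ← ENNReal.rpow_add _ _ (by simp) (by simp)]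
          congr 1; ring

end

/-! ### Martingale square functions -/

section
variable {Ω : Type*} {mΩ : MeasurableSpace Ω} {ν : Measure Ω} {ℱ : Filtration ℕ mΩ}
  {E : ℕ → Ω → ℂ}

theorem stronglyMeasurable_max {Ω : Type*} {m : MeasurableSpace Ω} {f g : Ω → ℝ}
    (hf : StronglyMeasurable[m] f) (hg : StronglyMeasurable[m] g) :
    StronglyMeasurable[m] fun x => max (f x) (g x) :=
  StronglyMeasurable.sup hf hg

/-- The running maximum of the absolute values of a process. -/
noncomputable def runMax (E : ℕ → Ω → ℂ) (k : ℕ) (x : Ω) : ℝ := partialSups (fun i => ‖E i x‖) k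

theorem norm_le_runMax {i k : ℕ} (h : i ≤ k) (x : Ω) : ‖E i x‖ ≤ runMax E k x :=
  le_partialSups_of_le (fun i => ‖E i x‖) h

theorem runMax_mono {i k : ℕ} (h : i ≤ k) (x : Ω) : runMax E i x ≤ runMax E k x :=
  (partialSups (fun i => ‖E i x‖)).mono h

theorem runMax_nonneg (k : ℕ) (x : Ω) : 0 ≤ runMax E k x :=
  (norm_nonneg _).trans (norm_le_runMax (Nat.zero_le k) x)

theorem runMax_succ (k : ℕ) (x : Ω) : runMax E (k + 1) x = max (runMax E k x) ‖E (k + 1) x‖ :=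
  partialSups_add_one _ _

theorem MeasureTheory.Martingale.stronglyMeasurable_runMax (hE : Martingale E ℱ ν) (k : ℕ) :
    StronglyMeasurable[ℱ k] (runMax E k) := by
  induction k with
  | zero => exact (hE.1 0).norm
  | succ k ih =>
    have : runMax E (k + 1) = fun x => max (runMax E k x) ‖E (k + 1) x‖ :=
      funext fun x => runMax_succ k x
    rw [this]
    have h1 : StronglyMeasurable[ℱ (k + 1)] (runMax E k) := ih.mono (ℱ.mono (Nat.le_succ k))
    have h2 : StronglyMeasurable[ℱ (k + 1)] fun x => ‖E (k + 1) x‖ := (hE.1 (k + 1)).norm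
    exact stronglyMeasurable_max h1 h2

theorem memLp_runMax {p : ℝ≥0∞} (hE : ∀ k, MemLp (E k) p ν) (k : ℕ) : MemLp (runMax E k) p ν := by
  induction k with
  | zero => exact (hE 0).norm
  | succ k ih =>
    have : runMax E (k + 1) = fun x => max (runMax E k x) ‖E (k + 1) x‖ :=
      funext fun x => runMax_succ k x
    rw [this]
    exact ih.sup (hE (k + 1)).norm

theorem MeasureTheory.Martingale.integral_inner_sub_eq_zero [IsFiniteMeasure ν] (hE : Martingale E ℱ ν) (k : ℕ)
    {g : Ω → ℂ} (hg : StronglyMeasurable[ℱ k] g)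
    (hint : Integrable (fun x => inner ℝ (g x) (E (k + 1) x - E k x)) ν) :
    ∫ x, inner ℝ (g x) (E (k + 1) x - E k x) ∂ν = 0 := by
  have hD : Integrable (fun x => E (k + 1) x - E k x) ν := (hE.integrable _).sub (hE.integrable _)
  have h1 := condExp_bilin_of_stronglyMeasurable_left (innerSL ℝ) hg hint hD
  have h0 : ν[fun x => E (k + 1) x - E k x|ℱ k] =ᵐ[ν] 0 := by
    have h2 := condExp_sub (hE.integrable (k + 1)) (hE.integrable k) (ℱ k)
    have h3 := hE.2 k (k + 1) (Nat.le_succ k)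
    have h4 := hE.2 k k le_rfl
    filter_upwards [h2, h3, h4] with x e2 e3 e4
    simp only [Pi.sub_apply] at e2
    change (ν[E (k + 1) - E k|ℱ k]) x = 0
    rw [e2, e3, e4, sub_self]
  rw [← integral_condExp (ℱ.le k)]
  refine integral_eq_zero_of_ae ?_
  filter_upwards [h1, h0] with x e1 e0
  refine e1.trans ?_
  rw [e0]
  simp

/-- The left side equals b a^(p-1) - a b^(p-1), and a^(p-1) ≤ b^(p-1). It absorbs the change of the
weight a^(p-2) when the running maximum grows from a to b. -/
theorem rpow_sub_le_of_le {p a b : ℝ} (hp1 : 1 < p) (ha : 0 < a) (hab : a ≤ b) :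
    a * b * (a ^ (p - 2) - b ^ (p - 2)) ≤ b ^ p - a ^ p := by
  have hb : 0 < b := ha.trans_le hab
  have h1 : a * a ^ (p - 2) = a ^ (p - 1) := by
    rw [show p - 1 = p - 2 + 1 by ring, Real.rpow_add_one ha.ne', mul_comm]
  have h2 : b * b ^ (p - 2) = b ^ (p - 1) := by
    rw [show p - 1 = p - 2 + 1 by ring, Real.rpow_add_one hb.ne', mul_comm]
  have h3 : a * a ^ (p - 1) = a ^ p := by
    conv_rhs => rw [show p = p - 1 + 1 by ring, Real.rpow_add_one ha.ne', mul_comm]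
  have h4 : b * b ^ (p - 1) = b ^ p := by
    conv_rhs => rw [show p = p - 1 + 1 by ring, Real.rpow_add_one hb.ne', mul_comm]
  have h5 : a ^ (p - 1) ≤ b ^ (p - 1) := Real.rpow_le_rpow ha.le hab (by linarith)
  have e : a * b * (a ^ (p - 2) - b ^ (p - 2)) = b * a ^ (p - 1) - a * b ^ (p - 1) := by
    rw [← h1, ← h2]; ring
  rw [e, ← h3, ← h4]
  nlinarith

theorem integrable_of_le_rpow {F : Type*} [NormedAddCommGroup F] {p : ℝ} (hp : 0 < p) {M : Ω → ℝ}
    (hM : MemLp M (ENNReal.ofReal p) ν) (hM0 : ∀ x, 0 ≤ M x) {g : Ω → F}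
    (hg : AEStronglyMeasurable g ν) (c : ℝ) (h : ∀ x, ‖g x‖ ≤ c * M x ^ p) : Integrable g ν := by
  have h1 : Integrable (fun x => M x ^ p) ν := by
    have := hM.integrable_norm_rpow (by simpa using hp) (by simp)
    refine this.congr (.of_forall fun x => ?_)
    simp only
    rw [ENNReal.toReal_ofReal hp.le, Real.norm_of_nonneg (hM0 x)]
  exact (h1.const_mul c).mono' hg (.of_forall h)

/-- The weighted square function bound behind the Burkholder inequality for exponents `p < 2`. -/
theorem MeasureTheory.Martingale.integral_sq_weight_le [IsFiniteMeasure ν] (hE : Martingale E ℱ ν) {p ε : ℝ}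
    (hp1 : 1 < p) (hp2 : p ≤ 2) (hε : 0 < ε) (hEp : ∀ k, MemLp (E k) (ENNReal.ofReal p) ν)
    (N : ℕ) :
    Integrable (fun x => ∑ k ∈ Finset.range N,
      ‖E (k + 1) x - E k x‖ ^ 2 * (ε + runMax E N x) ^ (p - 2)) ν ∧
    ∫ x, ∑ k ∈ Finset.range N, ‖E (k + 1) x - E k x‖ ^ 2 * (ε + runMax E N x) ^ (p - 2) ∂ν ≤
      6 * ∫ x, (ε + runMax E N x) ^ p ∂ν := by
  have hp0 : 0 < p := by linarith
  -- Adding ε keeps the running maximum away from zero, since the exponent p - 2 may be negative.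
  set M : ℕ → Ω → ℝ := fun k x => ε + runMax E k x with hM
  have hMpos : ∀ k x, 0 < M k x := fun k x => by
    have := runMax_nonneg (E := E) k x
    simp only [hM]; linarith
  have hMmono : ∀ {i k : ℕ}, i ≤ k → ∀ x, M i x ≤ M k x := fun h x =>
    add_le_add le_rfl (runMax_mono h x)
  have hEM : ∀ {i k : ℕ}, i ≤ k → ∀ x, ‖E i x‖ ≤ M k x := fun h x =>
    (norm_le_runMax h x).trans (by simp only [hM]; linarith)
  have hMmeas : ∀ k, StronglyMeasurable[ℱ k] (M k) := fun k =>
    stronglyMeasurable_const.add (Martingale.stronglyMeasurable_runMax hE k)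
  have hMmeas' : ∀ k, StronglyMeasurable (M k) := fun k => (hMmeas k).mono (ℱ.le k)
  have hEmeas' : ∀ k, StronglyMeasurable (E k) := fun k => (hE.1 k).mono (ℱ.le k)
  have hMLp : ∀ k, MemLp (M k) (ENNReal.ofReal p) ν := fun k =>
    (memLp_const ε).add (memLp_runMax hEp k)
  have hpow : ∀ k (r : ℝ), Measurable fun x => M k x ^ r := fun k r =>
    (hMmeas' k).measurable.pow_const r
  have hmeas2 : ∀ k (r : ℝ), StronglyMeasurable[ℱ k] fun x => M k x ^ r := fun k r =>
    ((hMmeas k).measurable.pow_const r).stronglyMeasurable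
  have hmul : ∀ a : ℝ, 0 < a → a ^ 2 * a ^ (p - 2) = a ^ p := fun a ha => by
    rw [← Real.rpow_natCast, ← Real.rpow_add ha]; norm_num
  have hcross : ∀ k, Integrable (fun x => inner ℝ (M k x ^ (p - 2) • E k x)
      (E (k + 1) x - E k x)) ν := by
    intro k
    refine integrable_of_le_rpow hp0 (hMLp (k + 1)) (fun x => (hMpos _ x).le) ?_ 2 fun x => ?_
    · exact (((hpow k _).stronglyMeasurable.smul (hEmeas' k)).inner
        ((hEmeas' (k + 1)).sub (hEmeas' k))).aestronglyMeasurable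
    · have ha := hMpos k x
      have hb := hMpos (k + 1) x
      have hab := hMmono (Nat.le_succ k) x
      have h1 : ‖E k x‖ ≤ M k x := hEM le_rfl x
      have h2 : ‖E (k + 1) x - E k x‖ ≤ 2 * M (k + 1) x := by
        have h3 := norm_sub_le (E (k + 1) x) (E k x)
        have h4 := hEM (le_refl (k + 1)) x
        linarith
      calc _ ≤ ‖M k x ^ (p - 2) • E k x‖ * ‖E (k + 1) x - E k x‖ := norm_inner_le_norm _ _
        _ ≤ (M k x ^ (p - 2) * M k x) * (2 * M (k + 1) x) := by
            rw [norm_smul, Real.norm_of_nonneg (by positivity)]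
            gcongr
        _ = 2 * (M k x ^ (p - 1) * M (k + 1) x) := by
            rw [← Real.rpow_add_one ha.ne', show p - 2 + 1 = p - 1 by ring]; ring
        _ ≤ 2 * (M (k + 1) x ^ (p - 1) * M (k + 1) x) := by
            have : M k x ^ (p - 1) ≤ M (k + 1) x ^ (p - 1) :=
              Real.rpow_le_rpow ha.le hab (by linarith)
            gcongr
        _ = _ := by rw [← Real.rpow_add_one hb.ne', sub_add_cancel]
  -- A telescoping potential |E_k|² M_k^(p-2) + 5 M_k^p, up to a term of mean zero. Expand the
  -- squared increment d = E_{k+1} - E_k. Passing from the new weight to the old one costs at most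
  -- |E_k|² + 2⟨E_k, d⟩ ≤ (1 + 4) M_k M_{k+1} times the drop of the weight, and `rpow_sub_le_of_le`
  -- converts this into 5 (M_{k+1}^p - M_k^p).
  have hstep : ∀ k x, ‖E (k + 1) x - E k x‖ ^ 2 * M (k + 1) x ^ (p - 2) ≤
      (‖E (k + 1) x‖ ^ 2 * M (k + 1) x ^ (p - 2) + 5 * M (k + 1) x ^ p) -
      (‖E k x‖ ^ 2 * M k x ^ (p - 2) + 5 * M k x ^ p) -
      2 * inner ℝ (M k x ^ (p - 2) • E k x) (E (k + 1) x - E k x) := by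
    intro k x
    have ha := hMpos k x
    have hb := hMpos (k + 1) x
    have hab := hMmono (Nat.le_succ k) x
    have h1 : ‖E k x‖ ≤ M k x := hEM le_rfl x
    have h2 : ‖E (k + 1) x - E k x‖ ≤ 2 * M (k + 1) x := by
      have h3 := norm_sub_le (E (k + 1) x) (E k x)
      have h4 := hEM (le_refl (k + 1)) x
      linarith
    have hw : M (k + 1) x ^ (p - 2) ≤ M k x ^ (p - 2) :=
      Real.rpow_le_rpow_of_nonpos ha hab (by linarith)
    have hkey := rpow_sub_le_of_le hp1 ha hab
    rw [real_inner_smul_left]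
    have hin : |inner ℝ (E k x) (E (k + 1) x - E k x)| ≤ M k x * (2 * M (k + 1) x) :=
      (abs_real_inner_le_norm _ _).trans (mul_le_mul h1 h2 (norm_nonneg _) ha.le)
    have hsq : ‖E (k + 1) x - E k x‖ ^ 2 = ‖E (k + 1) x‖ ^ 2 - ‖E k x‖ ^ 2 -
        2 * inner ℝ (E k x) (E (k + 1) x - E k x) := by
      have : E (k + 1) x = E k x + (E (k + 1) x - E k x) := by ring
      have h5 := norm_add_sq_real (E k x) (E (k + 1) x - E k x)
      rw [← this] at h5
      linarith
    have hek : ‖E k x‖ ^ 2 ≤ M k x * M (k + 1) x := by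
      rw [sq]; exact mul_le_mul h1 (h1.trans hab) (norm_nonneg _) ha.le
    rw [hsq]
    set w := M k x ^ (p - 2)
    set w' := M (k + 1) x ^ (p - 2)
    set I := inner ℝ (E k x) (E (k + 1) x - E k x)
    have hww : 0 ≤ w - w' := sub_nonneg.2 hw
    have hI := (abs_le.1 hin).2
    have t1 : I * (w - w') ≤ M k x * (2 * M (k + 1) x) * (w - w') :=
      mul_le_mul_of_nonneg_right hI hww
    have t2 : ‖E k x‖ ^ 2 * (w - w') ≤ M k x * M (k + 1) x * (w - w') :=
      mul_le_mul_of_nonneg_right hek hww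
    linarith [t1, t2, hkey]
  -- As p ≤ 2 the final weight is the smallest one. The constant is 6 = 5 + 1, since |E_N|²
  -- M_N^(p-2) ≤ M_N^p.
  have hsum : ∀ x, ∑ k ∈ Finset.range N, ‖E (k + 1) x - E k x‖ ^ 2 * M N x ^ (p - 2) ≤
      6 * M N x ^ p - ∑ k ∈ Finset.range N,
      2 * inner ℝ (M k x ^ (p - 2) • E k x) (E (k + 1) x - E k x) := by
    intro x
    have h1 : ∑ k ∈ Finset.range N, ‖E (k + 1) x - E k x‖ ^ 2 * M N x ^ (p - 2) ≤
        ∑ k ∈ Finset.range N, ‖E (k + 1) x - E k x‖ ^ 2 * M (k + 1) x ^ (p - 2) := by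
      refine Finset.sum_le_sum fun k hk => ?_
      have : M N x ^ (p - 2) ≤ M (k + 1) x ^ (p - 2) :=
        Real.rpow_le_rpow_of_nonpos (hMpos _ x) (hMmono (Finset.mem_range.1 hk) x) (by linarith)
      gcongr
    have h2 := Finset.sum_le_sum fun k (_ : k ∈ Finset.range N) => hstep k x
    rw [Finset.sum_sub_distrib, Finset.sum_range_sub
      (fun k => ‖E k x‖ ^ 2 * M k x ^ (p - 2) + 5 * M k x ^ p)] at h2
    have h3 : ‖E N x‖ ^ 2 * M N x ^ (p - 2) ≤ M N x ^ p := by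
      rw [← hmul _ (hMpos N x)]
      have := hEM (le_refl N) x
      have := hMpos N x
      gcongr
    have h4 : 0 ≤ ‖E 0 x‖ ^ 2 * M 0 x ^ (p - 2) + 5 * M 0 x ^ p := by
      have := hMpos 0 x
      positivity
    linarith
  have hMint : Integrable (fun x => M N x ^ p) ν := by
    refine integrable_of_le_rpow hp0 (hMLp N) (fun x => (hMpos _ x).le)
      (hpow N p).aestronglyMeasurable 1 fun x => ?_
    have := hMpos N x
    rw [Real.norm_of_nonneg (by positivity), one_mul]
  have hcrossum : Integrable (fun x => ∑ k ∈ Finset.range N,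
      2 * inner ℝ (M k x ^ (p - 2) • E k x) (E (k + 1) x - E k x)) ν :=
    integrable_finsetSum _ fun k _ => (hcross k).const_mul 2
  have hint : Integrable (fun x => ∑ k ∈ Finset.range N,
      ‖E (k + 1) x - E k x‖ ^ 2 * M N x ^ (p - 2)) ν := by
    refine ((hMint.const_mul 6).sub hcrossum).mono' ?_ (.of_forall fun x => ?_)
    · refine (Finset.stronglyMeasurable_fun_sum _ fun k _ => ?_).aestronglyMeasurable
      exact (((hEmeas' (k + 1)).sub (hEmeas' k)).norm.pow 2).mul (hpow N _).stronglyMeasurable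
    · rw [Real.norm_of_nonneg]
      · exact hsum x
      · have := hMpos N x
        positivity
  refine ⟨hint, (integral_mono hint ((hMint.const_mul 6).sub hcrossum) hsum).trans (le_of_eq ?_)⟩
  have hz : ∫ x, ∑ k ∈ Finset.range N,
      2 * inner ℝ (M k x ^ (p - 2) • E k x) (E (k + 1) x - E k x) ∂ν = 0 := by
    rw [integral_finsetSum _ fun k _ => (hcross k).const_mul 2]
    refine Finset.sum_eq_zero fun k _ => ?_
    rw [integral_const_mul, Martingale.integral_inner_sub_eq_zero hE k
      (g := fun x => M k x ^ (p - 2) • E k x) ((hmeas2 k _).smul (hE.1 k)) (hcross k), mul_zero]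
  have := integral_sub (hMint.const_mul 6) hcrossum
  simp only [Pi.sub_apply] at this ⊢
  rw [this, hz, sub_zero, integral_const_mul]

end

/-! ### The Garsia–Burkholder inequality for exponents at least 2 -/

section
variable {Ω : Type*} {mΩ : MeasurableSpace Ω} {ν : Measure Ω} {ℱ : Filtration ℕ mΩ}
  {E : ℕ → Ω → ℂ}

/-- The sum of the squared martingale differences. -/
noncomputable def sqSum (E : ℕ → Ω → ℂ) (k : ℕ) (x : Ω) : ℝ :=
  ∑ i ∈ Finset.range k, ‖E (i + 1) x - E i x‖ ^ 2

theorem sqSum_nonneg (k : ℕ) (x : Ω) : 0 ≤ sqSum E k x := by unfold sqSum; positivity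

theorem sqSum_mono {i k : ℕ} (h : i ≤ k) (x : Ω) : sqSum E i x ≤ sqSum E k x :=
  Finset.sum_le_sum_of_subset_of_nonneg (by simpa using h) fun _ _ _ => by positivity

theorem sqSum_le (k : ℕ) (x : Ω) : sqSum E k x ≤ 4 * k * runMax E k x ^ 2 := by
  unfold sqSum
  calc _ ≤ ∑ i ∈ Finset.range k, (2 * runMax E k x) ^ 2 := by
        refine Finset.sum_le_sum fun i hi => ?_
        have h1 := norm_sub_le (E (i + 1) x) (E i x)
        have h2 := norm_le_runMax (E := E) (Finset.mem_range.1 hi) x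
        have h3 := norm_le_runMax (E := E) (Finset.mem_range.1 hi).le x
        gcongr
        simp only [Nat.succ_eq_add_one] at h2
        linarith
    _ = _ := by simp; ring

theorem MeasureTheory.Martingale.stronglyMeasurable_sqSum (hE : Martingale E ℱ ν) (k : ℕ) :
    StronglyMeasurable[ℱ k] (sqSum E k) := by
  have h : ∀ i ∈ Finset.range k, StronglyMeasurable[ℱ k] fun x => ‖E (i + 1) x - E i x‖ ^ 2 := by
    intro i hi
    have h1 : StronglyMeasurable[ℱ k] (E (i + 1)) :=
      (hE.1 (i + 1)).mono (ℱ.mono (Finset.mem_range.1 hi))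
    have h2 : StronglyMeasurable[ℱ k] (E i) := (hE.1 i).mono (ℱ.mono (Finset.mem_range.1 hi).le)
    exact ((h1.sub h2).norm).pow 2
  exact Finset.stronglyMeasurable_fun_sum _ h

/-- Bernoulli's inequality at a/b - 1. -/
theorem rpow_sub_rpow_le {q a b : ℝ} (hq : 1 ≤ q) (ha : 0 ≤ a) (hab : a ≤ b) :
    b ^ q - a ^ q ≤ q * ((b - a) * b ^ (q - 1)) := by
  rcases hab.eq_or_lt with rfl | hlt
  · simp
  have hb : 0 < b := ha.trans_lt hlt
  have h := one_add_mul_self_le_rpow_one_add (s := a / b - 1) (p := q)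
    (by have := div_nonneg ha hb.le; linarith) hq
  rw [add_sub_cancel, Real.div_rpow ha hb.le, le_div_iff₀ (by positivity)] at h
  have hbq : b ^ q = b * b ^ (q - 1) := by
    conv_lhs => rw [show q = q - 1 + 1 by ring, Real.rpow_add_one hb.ne', mul_comm]
  have e : (1 + q * (a / b - 1)) * b ^ q = b ^ q - q * ((b - a) * b ^ (q - 1)) := by
    rw [hbq]; field_simp; ring
  linarith

/-- An explicit Young inequality, by cases on whether A exceeds 8qM. The coefficient 1/2 of A^q
allows that term to be absorbed. -/
theorem mul_rpow_sub_one_le {q A M : ℝ} (hq : 1 ≤ q) (hA : 0 ≤ A) (hM : 0 ≤ M) :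
    4 * q * (A ^ (q - 1) * M) ≤ (A ^ q + (8 * q * M) ^ q) / 2 := by
  have hq0 : 0 < q := by linarith
  have hpow : ∀ z : ℝ, 0 ≤ z → z ^ (q - 1) * z = z ^ q := fun z hz => by
    conv_rhs => rw [show q = q - 1 + 1 by ring, Real.rpow_add_one' hz (by linarith)]
  have h8 : 0 ≤ 8 * q * M := by positivity
  rcases le_total (8 * q * M) A with h | h
  · calc 4 * q * (A ^ (q - 1) * M) = A ^ (q - 1) * (8 * q * M) / 2 := by ring
      _ ≤ A ^ (q - 1) * A / 2 := by gcongr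
      _ = A ^ q / 2 := by rw [hpow A hA]
      _ ≤ _ := by
        have : 0 ≤ (8 * q * M) ^ q := by positivity
        linarith
  · calc 4 * q * (A ^ (q - 1) * M) ≤ 4 * q * ((8 * q * M) ^ (q - 1) * M) := by
          have := Real.rpow_le_rpow hA h (sub_nonneg.2 hq)
          gcongr
      _ = (8 * q * M) ^ (q - 1) * (8 * q * M) / 2 := by ring
      _ = (8 * q * M) ^ q / 2 := by rw [hpow _ h8]
      _ ≤ _ := by
        have : 0 ≤ A ^ q := by positivity
        linarith

/-- Summation by parts: the power of a sum of increments against the tails of the sum. -/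
theorem rpow_sum_le_sum_tail {q : ℝ} (hq : 1 ≤ q) {A : ℕ → ℝ} (hA0 : A 0 = 0) (hA : Monotone A)
    (N : ℕ) :
    A N ^ q ≤ q * ∑ j ∈ Finset.range N,
      (A (j + 1) ^ (q - 1) - if j = 0 then 0 else A j ^ (q - 1)) * (A N - A j) := by
  have hpos : ∀ k, 0 ≤ A k := fun k => hA0 ▸ hA (Nat.zero_le k)
  have h1 : A N ^ q ≤ q * ∑ j ∈ Finset.range N, (A (j + 1) - A j) * A (j + 1) ^ (q - 1) := by
    have := Finset.sum_le_sum fun j (_ : j ∈ Finset.range N) =>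
      rpow_sub_rpow_le hq (hpos j) (hA (Nat.le_succ j))
    rw [Finset.sum_range_sub (fun j => A j ^ q), hA0, Real.zero_rpow (by linarith), sub_zero] at this
    rwa [Finset.mul_sum]
  have h2 : ∀ L ≤ N, ∑ j ∈ Finset.range L, (A (j + 1) - A j) * A (j + 1) ^ (q - 1) =
      (∑ j ∈ Finset.range L,
        (A (j + 1) ^ (q - 1) - if j = 0 then 0 else A j ^ (q - 1)) * (A N - A j)) -
        (if L = 0 then 0 else A L ^ (q - 1)) * (A N - A L) := by
    intro L hL
    induction L with
    | zero => simp
    | succ L ih =>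
      rw [Finset.sum_range_succ, Finset.sum_range_succ, ih (by omega), if_neg (Nat.succ_ne_zero L)]
      ring
  rw [h2 N le_rfl] at h1
  simpa using h1

/-- The Garsia–Burkholder inequality for exponents `2 q ≥ 2`. -/
theorem MeasureTheory.Martingale.integral_sqSum_rpow_le [IsFiniteMeasure ν] (hE : Martingale E ℱ ν)
    {q : ℝ} (hq : 1 ≤ q) (hEp : ∀ k, MemLp (E k) (ENNReal.ofReal (2 * q)) ν) (N : ℕ) :
    Integrable (fun x => sqSum E N x ^ q) ν ∧
    ∫ x, sqSum E N x ^ q ∂ν ≤ (8 * q) ^ q * ∫ x, runMax E N x ^ (2 * q) ∂ν := by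
  have hq0 : 0 < q := by linarith
  have h2q : 0 < 2 * q := by linarith
  set M := runMax E N with hM
  have hM0 : ∀ x, 0 ≤ M x := runMax_nonneg N
  have hMLp : MemLp M (ENNReal.ofReal (2 * q)) ν := memLp_runMax hEp N
  have hMmeas : StronglyMeasurable M :=
    (Martingale.stronglyMeasurable_runMax hE N).mono (ℱ.le N)
  have hAmeas : ∀ k, StronglyMeasurable[ℱ k] (sqSum E k) := Martingale.stronglyMeasurable_sqSum hE
  have hAmeas' : ∀ k, StronglyMeasurable (sqSum E k) := fun k => (hAmeas k).mono (ℱ.le k)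
  have hEmeas' : ∀ k, StronglyMeasurable (E k) := fun k => (hE.1 k).mono (ℱ.le k)
  -- The value at j = 0 is set to 0 by hand: for q = 1 the power is 0 ^ 0 = 1, and the telescoping
  -- sum of the X_j would lose its first term.
  set Y : ℕ → Ω → ℝ := fun j x => if j = 0 then 0 else sqSum E j x ^ (q - 1) with hY
  set X : ℕ → Ω → ℝ := fun j x => sqSum E (j + 1) x ^ (q - 1) - Y j x with hX
  have hYnn : ∀ j x, 0 ≤ Y j x := fun j x => by
    have := sqSum_nonneg (E := E) j x
    simp only [hY]; split_ifs <;> positivity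
  have hX0 : ∀ j x, 0 ≤ X j x := fun j x => by
    have h1 := sqSum_nonneg (E := E) j x
    have h2 := sqSum_nonneg (E := E) (j + 1) x
    simp only [hX, hY]
    split_ifs
    · rw [sub_zero]; positivity
    · exact sub_nonneg.2 (Real.rpow_le_rpow h1 (sqSum_mono (Nat.le_succ j) x) (by linarith))
  have hpow : ∀ j, StronglyMeasurable[ℱ j] fun x => sqSum E j x ^ (q - 1) := fun j =>
    ((hAmeas j).measurable.pow_const (q - 1)).stronglyMeasurable
  have hYmeas : ∀ j, StronglyMeasurable[ℱ j] (Y j) := fun j => by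
    by_cases h : j = 0
    · simp only [hY, h, if_true]; exact stronglyMeasurable_const
    · simp only [hY, h, if_false]; exact hpow j
  have hXmeas : ∀ j, StronglyMeasurable[ℱ (j + 1)] (X j) := fun j =>
    (hpow (j + 1)).sub ((hYmeas j).mono (ℱ.mono (Nat.le_succ j)))
  have hXmeas' : ∀ j, StronglyMeasurable (X j) := fun j => (hXmeas j).mono (ℱ.le _)
  have hXle : ∀ j < N, ∀ x, X j x ≤ (4 * N) ^ (q - 1) * M x ^ (2 * (q - 1)) := by
    intro j hj x
    have h1 := sqSum_nonneg (E := E) (j + 1) x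
    calc X j x ≤ sqSum E (j + 1) x ^ (q - 1) := by
          have := hYnn j x
          simp only [hX]; linarith
      _ ≤ (4 * N * M x ^ 2) ^ (q - 1) :=
          Real.rpow_le_rpow h1 ((sqSum_mono hj x).trans (sqSum_le N x)) (by linarith)
      _ = _ := by
          rw [Real.mul_rpow (by positivity) (by have := hM0 x; positivity), Real.rpow_mul (hM0 x)]
          norm_num
  have hMpow : ∀ x, M x ^ (2 * (q - 1)) * M x ^ 2 = M x ^ (2 * q) := fun x => by
    rw [← Real.rpow_natCast, ← Real.rpow_add_of_nonneg (hM0 x) (by linarith) (by norm_num)]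
    congr 1; push_cast; ring
  -- Integrability of every quantity below: it is at most X_j times a multiple of M², hence at most
  -- a multiple of M^(2q).
  have hdom : ∀ j < N, ∀ {F : Type} [NormedAddCommGroup F] (g : Ω → F), AEStronglyMeasurable g ν →
      ∀ c : ℝ, (∀ x, ‖g x‖ ≤ X j x * (c * M x ^ 2)) → 0 ≤ c → Integrable g ν := by
    intro j hj F _ g hg c hgc hc
    refine integrable_of_le_rpow h2q hMLp hM0 hg ((4 * N) ^ (q - 1) * c) fun x => ?_
    refine (hgc x).trans ?_
    have := hM0 x
    calc _ ≤ ((4 * N) ^ (q - 1) * M x ^ (2 * (q - 1))) * (c * M x ^ 2) := by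
          gcongr; exact hXle j hj x
      _ = (4 * N) ^ (q - 1) * c * (M x ^ (2 * (q - 1)) * M x ^ 2) := by ring
      _ = _ := by rw [hMpow]
  have hEM : ∀ i ≤ N, ∀ x, ‖E i x‖ ≤ M x := fun i hi x => norm_le_runMax hi x
  have hdiff : ∀ i ≤ N, ∀ j ≤ N, ∀ x, ‖E i x - E j x‖ ≤ 2 * M x := fun i hi j hj x => by
    have := norm_sub_le (E i x) (E j x)
    have := hEM i hi x
    have := hEM j hj x
    linarith
  -- orthogonality of the increments against the weights `X j`
  have htail : ∀ j < N, ∀ L, j ≤ L → L ≤ N →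
      ∫ x, X j x * (sqSum E L x - sqSum E j x) ∂ν = ∫ x, X j x * ‖E L x - E j x‖ ^ 2 ∂ν := by
    intro j hj L hjL
    induction L, hjL using Nat.le_induction with
    | base => intro _; simp
    | succ L hjL ih =>
      intro hL
      have hL' : L ≤ N := by omega
      have i1 : Integrable (fun x => X j x * (sqSum E L x - sqSum E j x)) ν := by
        refine hdom j hj _ (((hXmeas' j).mul ((hAmeas' L).sub (hAmeas' j))).aestronglyMeasurable)
          (4 * N) (fun x => ?_) (by positivity)
        have h0 := sqSum_nonneg (E := E) j x
        have h1 := sqSum_mono (E := E) hjL x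
        have h2 := (sqSum_mono (E := E) hL' x).trans (sqSum_le N x)
        rw [norm_mul, Real.norm_of_nonneg (hX0 j x), Real.norm_of_nonneg (by linarith)]
        have := hX0 j x
        gcongr
        linarith
      have i2 : Integrable (fun x => X j x * ‖E (L + 1) x - E L x‖ ^ 2) ν := by
        refine hdom j hj _ (((hXmeas' j).mul
          (((hEmeas' (L + 1)).sub (hEmeas' L)).norm.pow 2)).aestronglyMeasurable)
          4 (fun x => ?_) (by positivity)
        have h1 := hdiff (L + 1) hL L hL' x
        have := hX0 j x
        rw [norm_mul, Real.norm_of_nonneg (hX0 j x), Real.norm_of_nonneg (by positivity)]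
        gcongr
        nlinarith [norm_nonneg (E (L + 1) x - E L x)]
      have i3 : Integrable (fun x => X j x * ‖E L x - E j x‖ ^ 2) ν := by
        refine hdom j hj _ (((hXmeas' j).mul
          (((hEmeas' L).sub (hEmeas' j)).norm.pow 2)).aestronglyMeasurable)
          4 (fun x => ?_) (by positivity)
        have h1 := hdiff L hL' j hj.le x
        have := hX0 j x
        rw [norm_mul, Real.norm_of_nonneg (hX0 j x), Real.norm_of_nonneg (by positivity)]
        gcongr
        nlinarith [norm_nonneg (E L x - E j x)]
      have i4 : Integrable (fun x => inner ℝ (X j x • (E L x - E j x)) (E (L + 1) x - E L x)) ν := by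
        refine hdom j hj _ (((hXmeas' j).smul ((hEmeas' L).sub (hEmeas' j))).inner
          ((hEmeas' (L + 1)).sub (hEmeas' L))).aestronglyMeasurable 4 (fun x => ?_) (by positivity)
        have h1 := hdiff L hL' j hj.le x
        have h2 := hdiff (L + 1) hL L hL' x
        have := hX0 j x
        have := hM0 x
        refine (norm_inner_le_norm _ _).trans ?_
        rw [norm_smul, Real.norm_of_nonneg (hX0 j x), mul_assoc]
        refine mul_le_mul_of_nonneg_left ?_ (hX0 j x)
        calc _ ≤ (2 * M x) * (2 * M x) := mul_le_mul h1 h2 (norm_nonneg _) (by positivity)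
          _ = _ := by ring
      have hz : ∫ x, inner ℝ (X j x • (E L x - E j x)) (E (L + 1) x - E L x) ∂ν = 0 := by
        -- X_j is measurable only at time j + 1, so orthogonality needs j < L. For L = j the factor
        -- E_L - E_j vanishes instead.
        rcases hjL.eq_or_lt with rfl | hlt
        · simp
        · refine Martingale.integral_inner_sub_eq_zero hE L (g := fun x => X j x • (E L x - E j x))
            ?_ i4
          have m1 : StronglyMeasurable[ℱ L] (X j) := (hXmeas j).mono (ℱ.mono hlt)
          have m2 : StronglyMeasurable[ℱ L] (E j) := (hE.1 j).mono (ℱ.mono hjL)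
          exact m1.smul ((hE.1 L).sub m2)
      have e1 : ∀ x, X j x * (sqSum E (L + 1) x - sqSum E j x) =
          X j x * (sqSum E L x - sqSum E j x) + X j x * ‖E (L + 1) x - E L x‖ ^ 2 := fun x => by
        simp only [sqSum, Finset.sum_range_succ]; ring
      have e2 : ∀ x, X j x * ‖E (L + 1) x - E j x‖ ^ 2 =
          X j x * ‖E L x - E j x‖ ^ 2 + X j x * ‖E (L + 1) x - E L x‖ ^ 2 +
          2 * inner ℝ (X j x • (E L x - E j x)) (E (L + 1) x - E L x) := fun x => by
        have h5 := norm_add_sq_real (E L x - E j x) (E (L + 1) x - E L x)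
        rw [show E L x - E j x + (E (L + 1) x - E L x) = E (L + 1) x - E j x by ring] at h5
        rw [h5, real_inner_smul_left]; ring
      simp only [e1, e2]
      have i5 : Integrable (fun x => X j x * ‖E L x - E j x‖ ^ 2 +
          X j x * ‖E (L + 1) x - E L x‖ ^ 2) ν := i3.add i2
      rw [integral_add i1 i2, integral_add i5 (i4.const_mul 2), integral_add i3 i2,
        integral_const_mul, hz, ih hL']
      ring
  have hAint : Integrable (fun x => sqSum E N x ^ q) ν := by
    refine integrable_of_le_rpow h2q hMLp hM0
      ((hAmeas' N).measurable.pow_const q).aestronglyMeasurable ((4 * N) ^ q) fun x => ?_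
    have h1 := sqSum_nonneg (E := E) N x
    rw [Real.norm_of_nonneg (by positivity)]
    calc _ ≤ (4 * N * M x ^ 2) ^ q := Real.rpow_le_rpow h1 (sqSum_le N x) hq0.le
      _ = _ := by
          rw [Real.mul_rpow (by positivity) (by have := hM0 x; positivity), Real.rpow_mul (hM0 x)]
          norm_num
  refine ⟨hAint, ?_⟩
  have hMint : Integrable (fun x => M x ^ (2 * q)) ν := by
    refine integrable_of_le_rpow h2q hMLp hM0
      (hMmeas.measurable.pow_const _).aestronglyMeasurable 1 fun x => ?_
    have := hM0 x
    rw [Real.norm_of_nonneg (by positivity), one_mul]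
  have hXint : ∀ j < N, Integrable (fun x => X j x * (sqSum E N x - sqSum E j x)) ν := by
    intro j hj
    refine hdom j hj _ (((hXmeas' j).mul ((hAmeas' N).sub (hAmeas' j))).aestronglyMeasurable)
      (4 * N) (fun x => ?_) (by positivity)
    have h0 := sqSum_nonneg (E := E) j x
    have h1 := sqSum_mono (E := E) hj.le x
    have h2 := sqSum_le (E := E) N x
    rw [norm_mul, Real.norm_of_nonneg (hX0 j x), Real.norm_of_nonneg (by linarith)]
    have := hX0 j x
    gcongr
    linarith
  have hXint2 : ∀ j < N, Integrable (fun x => X j x * (4 * M x ^ 2)) ν := by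
    intro j hj
    refine hdom j hj _ (((hXmeas' j).mul ((hMmeas.pow 2).const_mul 4)).aestronglyMeasurable)
      4 (fun x => ?_) (by positivity)
    have := hX0 j x
    rw [Real.norm_of_nonneg (by positivity)]
  -- Summation by parts turns the power into tails A_N - A_j weighted by X_j; orthogonality replaces
  -- each tail by |E_N - E_j|² ≤ 4M². The X_j sum to at most A_N^(q-1), and Young's inequality
  -- leaves half of the left side, which is absorbed.
  have hmain : ∫ x, sqSum E N x ^ q ∂ν ≤
      ∫ x, (sqSum E N x ^ q + (8 * q * M x ^ 2) ^ q) / 2 ∂ν := by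
    calc ∫ x, sqSum E N x ^ q ∂ν
        ≤ ∫ x, q * ∑ j ∈ Finset.range N, X j x * (sqSum E N x - sqSum E j x) ∂ν := by
          refine integral_mono hAint ((integrable_finsetSum _ fun j hj =>
            hXint j (Finset.mem_range.1 hj)).const_mul q) fun x => ?_
          exact rpow_sum_le_sum_tail hq (A := fun k => sqSum E k x) (by simp [sqSum])
            (fun i k h => sqSum_mono h x) N
      _ = q * ∑ j ∈ Finset.range N, ∫ x, X j x * ‖E N x - E j x‖ ^ 2 ∂ν := by
          rw [integral_const_mul, integral_finsetSum _ fun j hj => hXint j (Finset.mem_range.1 hj)]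
          congr 1
          refine Finset.sum_congr rfl fun j hj => ?_
          exact htail j (Finset.mem_range.1 hj) N (Finset.mem_range.1 hj).le le_rfl
      _ ≤ q * ∑ j ∈ Finset.range N, ∫ x, X j x * (4 * M x ^ 2) ∂ν := by
          refine mul_le_mul_of_nonneg_left (Finset.sum_le_sum fun j hj => ?_) hq0.le
          refine integral_mono_of_nonneg (.of_forall fun x => ?_)
            (hXint2 j (Finset.mem_range.1 hj)) (.of_forall fun x => ?_)
          · have := hX0 j x
            simp only [Pi.zero_apply]; positivity
          · have h1 := hdiff N le_rfl j (Finset.mem_range.1 hj).le x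
            have := hX0 j x
            simp only
            gcongr
            nlinarith [norm_nonneg (E N x - E j x)]
      _ = ∫ x, 4 * q * ((∑ j ∈ Finset.range N, X j x) * M x ^ 2) ∂ν := by
          rw [← integral_finsetSum _ fun j hj => hXint2 j (Finset.mem_range.1 hj),
            ← integral_const_mul]
          refine integral_congr_ae (.of_forall fun x => ?_)
          simp only [← Finset.sum_mul]; ring
      _ ≤ _ := by
          refine integral_mono_of_nonneg (.of_forall fun x => ?_) ?_ (.of_forall fun x => ?_)
          · have : 0 ≤ ∑ j ∈ Finset.range N, X j x := Finset.sum_nonneg fun j _ => hX0 j x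
            simp only [Pi.zero_apply]; positivity
          · refine (hAint.add ?_).div_const 2
            have : ∀ x, (8 * q * M x ^ 2) ^ q = (8 * q) ^ q * M x ^ (2 * q) := fun x => by
              rw [Real.mul_rpow (by positivity) (by have := hM0 x; positivity),
                Real.rpow_mul (hM0 x)]
              norm_num
            simp only [this]
            exact hMint.const_mul _
          · have h1 : ∑ j ∈ Finset.range N, X j x = Y N x := by
              have := Finset.sum_range_sub (fun j => Y j x) N
              simp only [hX]
              have h3 : ∀ j, sqSum E (j + 1) x ^ (q - 1) = Y (j + 1) x := fun j => by simp [hY]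
              simp only [h3, this]
              simp [hY]
            have h2 : ∑ j ∈ Finset.range N, X j x ≤ sqSum E N x ^ (q - 1) := by
              have := sqSum_nonneg (E := E) N x
              rw [h1]; simp only [hY]; split_ifs
              · positivity
              · exact le_rfl
            simp only
            refine le_trans ?_ (mul_rpow_sub_one_le hq (sqSum_nonneg N x) (by positivity))
            gcongr
  have e3 : ∀ x, (sqSum E N x ^ q + (8 * q * M x ^ 2) ^ q) / 2 =
      (1 / 2) * sqSum E N x ^ q + ((8 * q) ^ q / 2) * M x ^ (2 * q) := fun x => by
    rw [Real.mul_rpow (by positivity) (by have := hM0 x; positivity),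
                Real.rpow_mul (hM0 x)]
    norm_num; ring
  simp only [e3] at hmain
  rw [integral_add (hAint.const_mul _) (hMint.const_mul _), integral_const_mul,
    integral_const_mul] at hmain
  linarith

end

/-! ### Doob's maximal inequality and the passage to infinite sums -/

section
variable {Ω : Type*} {mΩ : MeasurableSpace Ω} {ν : Measure Ω} {ℱ : Filtration ℕ mΩ}
  {E : ℕ → Ω → ℂ}

/-- The maximal function of a process. -/
noncomputable def procMax (E : ℕ → Ω → ℂ) (x : Ω) : ℝ≥0∞ := ⨆ k, ‖E k x‖ₑ

theorem ofReal_runMax_le (k : ℕ) (x : Ω) : ENNReal.ofReal (runMax E k x) ≤ procMax E x := by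
  induction k with
  | zero =>
    have : runMax E 0 x = ‖E 0 x‖ := by simp [runMax]
    rw [this, ofReal_norm]
    exact le_iSup (fun k => ‖E k x‖ₑ) 0
  | succ k ih =>
    rw [runMax_succ, ENNReal.ofReal_max, ofReal_norm]
    exact max_le ih (le_iSup (fun k => ‖E k x‖ₑ) (k + 1))

theorem measurable_procMax (hE : ∀ k, Measurable (E k)) : Measurable (procMax E) :=
  .iSup fun k => (hE k).enorm

theorem setLIntegral_enorm_condExp_le {m : MeasurableSpace Ω}
    {f : Ω → ℂ} (hf : Integrable f ν) {s : Set Ω} (hs : MeasurableSet[m] s) :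
    ∫⁻ x in s, ‖(ν[f|m]) x‖ₑ ∂ν ≤ ∫⁻ x in s, ‖f x‖ₑ ∂ν := by
  rw [← ofReal_integral_norm_eq_lintegral_enorm integrable_condExp.integrableOn,
    ← ofReal_integral_norm_eq_lintegral_enorm hf.integrableOn]
  exact ENNReal.ofReal_le_ofReal (setIntegral_norm_condExp_le hs f)

/-- Doob's weak type maximal inequality. -/
theorem procMax_condExp_weak_type [IsFiniteMeasure ν] {f : Ω → ℂ} (hf : Integrable f ν) (a : ℝ) :
    ENNReal.ofReal a * ν {x | ENNReal.ofReal a < procMax (fun k => ν[f|ℱ k]) x} ≤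
      ∫⁻ x, ‖f x‖ₑ ∂ν := by
  set B : ℕ → Set Ω := fun k => {x | ENNReal.ofReal a < ‖(ν[f|ℱ k]) x‖ₑ} with hB
  have hBm : ∀ i k, i ≤ k → MeasurableSet[ℱ k] (B i) := by
    intro i k hik
    refine ℱ.mono hik _ ?_
    exact measurableSet_lt measurable_const (stronglyMeasurable_condExp.enorm)
  -- The event that the level is exceeded for the first time at time k. It is known at time k, so on
  -- it the conditional expectation integrates to no more than f does.
  set S : ℕ → Set Ω := fun k => B k \ ⋃ i ∈ Finset.range k, B i with hS
  have hSm : ∀ k, MeasurableSet[ℱ k] (S k) := fun k =>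
    (hBm k k le_rfl).diff (Finset.measurableSet_biUnion _ fun i hi =>
      hBm i k (Finset.mem_range.1 hi).le)
  have hdisj : Pairwise (Function.onFun Disjoint S) := by
    have key : ∀ i j, i < j → Disjoint (S i) (S j) := fun i j hij =>
      Set.disjoint_left.2 fun x hi hj => hj.2 (Set.mem_biUnion (by simpa using hij) hi.1)
    intro i j hij
    rcases lt_or_gt_of_ne hij with h | h
    · exact key i j h
    · exact (key j i h).symm
  have hcov : {x | ENNReal.ofReal a < procMax (fun k => ν[f|ℱ k]) x} ⊆ ⋃ k, S k := by
    intro x hx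
    have hex : ∃ k, x ∈ B k := lt_iSup_iff.1
      (show ENNReal.ofReal a < ⨆ k, ‖(ν[f|ℱ k]) x‖ₑ from hx)
    classical
    refine Set.mem_iUnion.2 ⟨Nat.find hex, Nat.find_spec hex, ?_⟩
    simp only [Set.mem_iUnion, not_exists, Finset.mem_range]
    exact fun i hi => Nat.find_min hex hi
  calc _ ≤ ENNReal.ofReal a * ∑' k, ν (S k) :=
        mul_le_mul_right ((measure_mono hcov).trans (measure_iUnion_le S)) _
    _ = ∑' k, ENNReal.ofReal a * ν (S k) := ENNReal.tsum_mul_left.symm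
    _ ≤ ∑' k, ∫⁻ x in S k, ‖f x‖ₑ ∂ν := by
        refine ENNReal.tsum_le_tsum fun k => ?_
        refine le_trans ?_ (setLIntegral_enorm_condExp_le hf (hSm k))
        rw [← setLIntegral_const]
        exact setLIntegral_mono' (ℱ.le k _ (hSm k)) fun x hx => hx.1.le
    _ = ∫⁻ x in ⋃ k, S k, ‖f x‖ₑ ∂ν :=
        (lintegral_iUnion (fun k => ℱ.le k _ (hSm k)) hdisj _).symm
    _ ≤ _ := setLIntegral_le_lintegral _ _

/-- Doob's maximal inequality in `L^s`. -/
theorem procMax_condExp_strong_type [IsFiniteMeasure ν] {f : Ω → ℂ} (hfm : Measurable f)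
    (hf : Integrable f ν) {s : ℝ} (hs : 1 < s) :
    ∫⁻ x, procMax (fun k => ν[f|ℱ k]) x ^ s ∂ν ≤
      2 * ENNReal.ofReal (s / (s - 1) * (2⁻¹)⁻¹ ^ (s - 1)) * ∫⁻ x, ‖f x‖ₑ ^ s ∂ν := by
  refine lintegral_rpow_le_of_weak_type (measurable_procMax fun k =>
    (stronglyMeasurable_condExp.mono (ℱ.le k)).measurable) hfm.enorm (by norm_num) hs ?_
  intro a ha
  set S := {x | ENNReal.ofReal (2⁻¹ * a) < ‖f x‖ₑ} with hS
  have hSm : MeasurableSet S := measurableSet_lt measurable_const hfm.enorm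
  have hsum : f = S.indicator f + Sᶜ.indicator f := (Set.indicator_self_add_compl S f).symm
  -- Cutting f at height a/2: conditional expectation preserves this bound, so the part of f above
  -- a/2 must account for the other half of the level.
  have hsmall : ∀ k, ∀ᵐ x ∂ν, ‖(ν[Sᶜ.indicator f|ℱ k]) x‖ ≤ a / 2 := by
    intro k
    refine ae_bdd_norm_condExp_of_ae_bdd_norm (.of_forall fun x => ?_)
    by_cases hx : x ∈ S
    · simp [hx]; positivity
    · rw [Set.indicator_of_mem (by simpa using hx)]
      have : ‖f x‖ₑ ≤ ENNReal.ofReal (2⁻¹ * a) := not_lt.1 hx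
      rw [← ofReal_norm, ENNReal.ofReal_le_ofReal_iff (by positivity)] at this
      linarith
  have hadd : ∀ k, ν[f|ℱ k] =ᵐ[ν] ν[S.indicator f|ℱ k] + ν[Sᶜ.indicator f|ℱ k] := by
    intro k
    conv_lhs => rw [hsum]
    exact condExp_add (hf.indicator hSm) (hf.indicator hSm.compl) _
  have hae : ∀ᵐ x ∂ν, x ∈ {x | ENNReal.ofReal a < procMax (fun k => ν[f|ℱ k]) x} →
      x ∈ {x | ENNReal.ofReal (a / 2) < procMax (fun k => ν[S.indicator f|ℱ k]) x} := by
    filter_upwards [ae_all_iff.2 hsmall, ae_all_iff.2 hadd] with x h1 h2 hx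
    by_contra hcon
    have hcon : procMax (fun k => ν[S.indicator f|ℱ k]) x ≤ ENNReal.ofReal (a / 2) := not_lt.1 hcon
    refine absurd hx (not_lt.2 (iSup_le fun k => ?_))
    have h2k := h2 k
    simp only [h2k]
    calc _ ≤ ‖(ν[S.indicator f|ℱ k]) x‖ₑ + ‖(ν[Sᶜ.indicator f|ℱ k]) x‖ₑ := enorm_add_le _ _
      _ ≤ ENNReal.ofReal (a / 2) + ENNReal.ofReal (a / 2) := by
          refine add_le_add ((le_iSup (fun k => ‖(ν[S.indicator f|ℱ k]) x‖ₑ) k).trans hcon) ?_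
          rw [← ofReal_norm]
          exact ENNReal.ofReal_le_ofReal (h1 k)
      _ = ENNReal.ofReal a := by
          rw [← ENNReal.ofReal_add (by positivity) (by positivity), add_halves]
  calc _ ≤ 2 * (ENNReal.ofReal (a / 2) *
          ν {x | ENNReal.ofReal (a / 2) < procMax (fun k => ν[S.indicator f|ℱ k]) x}) := by
        rw [← mul_assoc]
        have : (2 : ℝ≥0∞) * ENNReal.ofReal (a / 2) = ENNReal.ofReal a := by
          rw [← ENNReal.ofReal_ofNat 2, ← ENNReal.ofReal_mul (by norm_num)]
          congr 1; ring
        rw [this]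
        exact mul_le_mul_right (measure_mono_ae hae) _
    _ ≤ 2 * ∫⁻ x, ‖S.indicator f x‖ₑ ∂ν :=
        mul_le_mul_right (procMax_condExp_weak_type (hf.indicator hSm) _) _
    _ = _ := by
        simp only [enorm_indicator_eq_indicator_enorm]
        rw [lintegral_indicator hSm]

/-- Replacing the running maximum by the full one goes the right way on both sides: it decreases the
weight on the left, because p ≤ 2, and increases the right. Then N tends to infinity. -/
theorem lintegral_tsum_div_le [IsFiniteMeasure ν] (hE : Martingale E ℱ ν) {p ε : ℝ}
    (hp1 : 1 < p) (hp2 : p ≤ 2) (hε : 0 < ε) (hEp : ∀ k, MemLp (E k) (ENNReal.ofReal p) ν) :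
    ∫⁻ x, (∑' k, ‖E (k + 1) x - E k x‖ₑ ^ 2) / (ENNReal.ofReal ε + procMax E x) ^ (2 - p) ∂ν ≤
      6 * ∫⁻ x, (ENNReal.ofReal ε + procMax E x) ^ p ∂ν := by
  have hEm : ∀ k, Measurable (E k) := fun k => ((hE.1 k).mono (ℱ.le k)).measurable
  have hPm := measurable_procMax hEm
  have hp0 : 0 < p := by linarith
  have hMpos : ∀ k x, 0 < ε + runMax E k x := fun k x => by
    have := runMax_nonneg (E := E) k x
    linarith
  have hMle : ∀ k x, ENNReal.ofReal (ε + runMax E k x) ≤ ENNReal.ofReal ε + procMax E x :=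
    fun k x => by
      rw [ENNReal.ofReal_add hε.le (runMax_nonneg k x)]
      exact add_le_add le_rfl (ofReal_runMax_le k x)
  have hN : ∀ N : ℕ, ∫⁻ x, ∑ k ∈ Finset.range N,
      ‖E (k + 1) x - E k x‖ₑ ^ 2 / (ENNReal.ofReal ε + procMax E x) ^ (2 - p) ∂ν ≤
      6 * ∫⁻ x, (ENNReal.ofReal ε + procMax E x) ^ p ∂ν := by
    intro N
    obtain ⟨h1, h2⟩ := Martingale.integral_sq_weight_le hE hp1 hp2 hε hEp N
    have hMint : Integrable (fun x => (ε + runMax E N x) ^ p) ν := by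
      refine integrable_of_le_rpow hp0 (M := fun x => ε + runMax E N x)
        ((memLp_const ε).add (memLp_runMax hEp N)) (fun x => (hMpos _ x).le) ?_ 1 fun x => ?_
      · have := (Martingale.stronglyMeasurable_runMax hE N).mono (ℱ.le N)
        exact ((this.measurable.const_add ε).pow_const p).aestronglyMeasurable
      · have := hMpos N x
        rw [Real.norm_of_nonneg (by positivity), one_mul]
    calc _ ≤ ∫⁻ x, ENNReal.ofReal (∑ k ∈ Finset.range N,
          ‖E (k + 1) x - E k x‖ ^ 2 * (ε + runMax E N x) ^ (p - 2)) ∂ν := by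
          refine lintegral_mono fun x => ?_
          have hpos := hMpos N x
          rw [ENNReal.ofReal_sum_of_nonneg fun k _ => by positivity]
          refine Finset.sum_le_sum fun k _ => ?_
          rw [ENNReal.ofReal_mul (by positivity), ENNReal.ofReal_pow (norm_nonneg _), ofReal_norm,
            div_eq_mul_inv]
          refine mul_le_mul_right ?_ _
          rw [show p - 2 = -(2 - p) by ring, Real.rpow_neg hpos.le,
            ENNReal.ofReal_inv_of_pos (by positivity), ENNReal.inv_le_inv,
            ← ENNReal.ofReal_rpow_of_pos hpos]
          exact ENNReal.rpow_le_rpow (hMle N x) (by linarith)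
      _ = ENNReal.ofReal (∫ x, ∑ k ∈ Finset.range N,
          ‖E (k + 1) x - E k x‖ ^ 2 * (ε + runMax E N x) ^ (p - 2) ∂ν) := by
          rw [ofReal_integral_eq_lintegral_ofReal h1 (.of_forall fun x => ?_)]
          have hpos := hMpos N x
          simp only [Pi.zero_apply]
          positivity
      _ ≤ ENNReal.ofReal (6 * ∫ x, (ε + runMax E N x) ^ p ∂ν) := ENNReal.ofReal_le_ofReal h2
      _ = 6 * ∫⁻ x, ENNReal.ofReal ((ε + runMax E N x) ^ p) ∂ν := by
          rw [ENNReal.ofReal_mul (by norm_num), ofReal_integral_eq_lintegral_ofReal hMint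
            (.of_forall fun x => by have := hMpos N x; simp only [Pi.zero_apply]; positivity)]
          simp
      _ ≤ _ := by
          refine mul_le_mul_right (lintegral_mono fun x => ?_) _
          rw [← ENNReal.ofReal_rpow_of_pos (hMpos N x)]
          exact ENNReal.rpow_le_rpow (hMle N x) hp0.le
  simp only [ENNReal.div_eq_inv_mul, ← ENNReal.tsum_mul_left]
  simp only [ENNReal.div_eq_inv_mul] at hN
  have hmk : ∀ k, Measurable fun x => ((ENNReal.ofReal ε + procMax E x) ^ (2 - p))⁻¹ *
      ‖E (k + 1) x - E k x‖ₑ ^ 2 := fun k => by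
    have h1 := hEm k
    have h2 := hEm (k + 1)
    fun_prop
  rw [lintegral_tsum fun k => (hmk k).aemeasurable, ENNReal.tsum_eq_iSup_nat]
  refine iSup_le fun N => ?_
  rw [← lintegral_finsetSum _ fun k _ => hmk k]
  exact hN N

theorem lintegral_tsum_rpow_le [IsFiniteMeasure ν] (hE : Martingale E ℱ ν) {q : ℝ} (hq : 1 ≤ q)
    (hEp : ∀ k, MemLp (E k) (ENNReal.ofReal (2 * q)) ν) :
    ∫⁻ x, (∑' k, ‖E (k + 1) x - E k x‖ₑ ^ 2) ^ q ∂ν ≤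
      ENNReal.ofReal ((8 * q) ^ q) * ∫⁻ x, procMax E x ^ (2 * q) ∂ν := by
  have hEm : ∀ k, Measurable (E k) := fun k => ((hE.1 k).mono (ℱ.le k)).measurable
  have hq0 : 0 < q := by linarith
  have hN : ∀ N : ℕ, ∫⁻ x, (∑ k ∈ Finset.range N, ‖E (k + 1) x - E k x‖ₑ ^ 2) ^ q ∂ν ≤
      ENNReal.ofReal ((8 * q) ^ q) * ∫⁻ x, procMax E x ^ (2 * q) ∂ν := by
    intro N
    obtain ⟨h1, h2⟩ := Martingale.integral_sqSum_rpow_le hE hq hEp N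
    have hMint : Integrable (fun x => runMax E N x ^ (2 * q)) ν := by
      refine integrable_of_le_rpow (by linarith) (memLp_runMax hEp N) (runMax_nonneg N) ?_ 1
        fun x => ?_
      · have := (Martingale.stronglyMeasurable_runMax hE N).mono (ℱ.le N)
        exact (this.measurable.pow_const _).aestronglyMeasurable
      · have := runMax_nonneg (E := E) N x
        rw [Real.norm_of_nonneg (by positivity), one_mul]
    calc _ = ∫⁻ x, ENNReal.ofReal (sqSum E N x ^ q) ∂ν := by
          refine lintegral_congr fun x => ?_
          rw [← ENNReal.ofReal_rpow_of_nonneg (sqSum_nonneg N x) hq0.le, sqSum,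
            ENNReal.ofReal_sum_of_nonneg fun k _ => by positivity]
          simp only [ENNReal.ofReal_pow (norm_nonneg _), ofReal_norm]
      _ = ENNReal.ofReal (∫ x, sqSum E N x ^ q ∂ν) := by
          rw [ofReal_integral_eq_lintegral_ofReal h1 (.of_forall fun x => ?_)]
          have := sqSum_nonneg (E := E) N x
          simp only [Pi.zero_apply]
          positivity
      _ ≤ _ := ENNReal.ofReal_le_ofReal h2
      _ = ENNReal.ofReal ((8 * q) ^ q) * ∫⁻ x, ENNReal.ofReal (runMax E N x ^ (2 * q)) ∂ν := by
          rw [ENNReal.ofReal_mul (by positivity), ofReal_integral_eq_lintegral_ofReal hMint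
            (.of_forall fun x => by
              have := runMax_nonneg (E := E) N x; simp only [Pi.zero_apply]; positivity)]
      _ ≤ _ := by
          refine mul_le_mul_right (lintegral_mono fun x => ?_) _
          rw [← ENNReal.ofReal_rpow_of_nonneg (runMax_nonneg N x) (by linarith)]
          exact ENNReal.rpow_le_rpow (ofReal_runMax_le N x) (by linarith)
  refine le_of_tendsto' (lintegral_tendsto_of_tendsto_of_monotone (f := fun N : ℕ => fun x =>
    (∑ k ∈ Finset.range N, ‖E (k + 1) x - E k x‖ₑ ^ 2) ^ q) (fun N => ?_) ?_ ?_) hN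
  · exact ((Finset.measurable_fun_sum _ fun k _ =>
      (((hEm (k + 1)).sub (hEm k)).enorm.pow_const 2)).pow_const q).aemeasurable
  · refine .of_forall fun x N M hNM => ?_
    dsimp only
    gcongr
  · refine .of_forall fun x => ?_
    exact (ENNReal.tendsto_nat_tsum _).ennrpow_const q

end

/-! ### The vector-valued square function -/

/-- Geometric decay in the distance of two scales. -/
noncomputable def geomWeight (r : ℝ≥0∞) (j k : ℕ) : ℝ≥0∞ := r ^ ((j - k) + (k - j))

theorem geomWeight_comm (r : ℝ≥0∞) (j k : ℕ) : geomWeight r j k = geomWeight r k j := by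
  unfold geomWeight; rw [add_comm]

theorem tsum_geomWeight_le (r : ℝ≥0∞) (k : ℕ) : ∑' j, geomWeight r j k ≤ 2 * (1 - r)⁻¹ := by
  rw [← ENNReal.summable.sum_add_tsum_nat_add' (k := k), two_mul, ← ENNReal.tsum_geometric]
  refine add_le_add ?_ (ENNReal.tsum_le_tsum fun i => ?_)
  · rw [← Finset.sum_range_reflect]
    refine le_trans (Finset.sum_le_sum (g := fun i => r ^ (i + 1)) fun j hj => ?_) ?_
    · have := Finset.mem_range.1 hj
      unfold geomWeight
      rw [show k - 1 - j - k + (k - (k - 1 - j)) = j + 1 by omega]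
    · refine (ENNReal.sum_le_tsum _).trans ?_
      exact ENNReal.tsum_comp_le_tsum_of_injective (add_left_injective 1) (fun i => r ^ i)
  · unfold geomWeight
    rw [show i + k - k + (k - (i + k)) = i by omega]

/-- The square function built from the averages `sqAvg` of a sequence of functions `D k`. -/
noncomputable def sqFn {n : ℕ} (m b : ℝ) (μ : Measure (RSpace n)) (r : ℝ≥0∞) (t : ℕ → ℝ)
    (D : ℕ → RSpace n → ℝ≥0∞) (x : RSpace n) : ℝ≥0∞ :=
  ∑' j, ∑' k, geomWeight r j k * (sqAvg m b μ (t j) (D k) x + D k x ^ 2)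

section
variable {n : ℕ} {m b A : ℝ} {μ : Measure (RSpace n)} {r : ℝ≥0∞} {t : ℕ → ℝ}
  {D : ℕ → RSpace n → ℝ≥0∞}

theorem measurable_sqFn [SFinite μ] (hD : ∀ k, Measurable (D k)) :
    Measurable (sqFn m b μ r t D) :=
  .tsum fun _ => .tsum fun k =>
    ((measurable_sqAvg (hD k)).add ((hD k).pow_const 2)).const_mul _

/-- The weighted bounds do not depend on j on their right side, so the double sum collapses by
Schur: summing the geometric weight over j gives 2/(1 - r), and the two terms of `sqFn` give the
other factor 2. -/
theorem lintegral_sqFn_mul_le [SFinite μ] (hD : ∀ k, Measurable (D k)) {g g' : RSpace n → ℝ≥0∞}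
    (hg : Measurable g) (hg' : Measurable g')
    (h : ∀ j k, ∫⁻ x, sqAvg m b μ (t j) (D k) x * g x ∂μ ≤ ∫⁻ x, D k x ^ 2 * g' x ∂μ)
    (h' : ∀ k, ∫⁻ x, D k x ^ 2 * g x ∂μ ≤ ∫⁻ x, D k x ^ 2 * g' x ∂μ) :
    ∫⁻ x, sqFn m b μ r t D x * g x ∂μ ≤
      4 * (1 - r)⁻¹ * ∫⁻ x, (∑' k, D k x ^ 2) * g' x ∂μ := by
  have hmeas : ∀ j k, Measurable fun x => geomWeight r j k *
      (sqAvg m b μ (t j) (D k) x + D k x ^ 2) * g x := fun j k =>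
    (((measurable_sqAvg (hD k)).add ((hD k).pow_const 2)).const_mul _).mul hg
  have h1 : ∀ j k, ∫⁻ x, geomWeight r j k * (sqAvg m b μ (t j) (D k) x + D k x ^ 2) * g x ∂μ ≤
      geomWeight r j k * (2 * ∫⁻ x, D k x ^ 2 * g' x ∂μ) := by
    intro j k
    simp only [mul_assoc, add_mul]
    have hm := measurable_sqAvg (m := m) (b := b) (μ := μ) (t := t j) (hD k)
    have m1 : Measurable fun x => sqAvg m b μ (t j) (D k) x * g x := hm.mul hg
    have m2 : Measurable fun x => D k x ^ 2 * g x := ((hD k).pow_const 2).mul hg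
    have m12 : Measurable fun x => sqAvg m b μ (t j) (D k) x * g x + D k x ^ 2 * g x := m1.add m2
    rw [lintegral_const_mul _ m12, lintegral_add_left m1, two_mul]
    exact mul_le_mul_right (add_le_add (h j k) (h' k)) _
  calc ∫⁻ x, sqFn m b μ r t D x * g x ∂μ
      = ∑' j, ∑' k, ∫⁻ x,
          geomWeight r j k * (sqAvg m b μ (t j) (D k) x + D k x ^ 2) * g x ∂μ := by
        simp only [sqFn, ← ENNReal.tsum_mul_right]
        rw [lintegral_tsum fun j => (Measurable.tsum fun k => hmeas j k).aemeasurable]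
        exact tsum_congr fun j => lintegral_tsum fun k => (hmeas j k).aemeasurable
    _ ≤ ∑' j, ∑' k, geomWeight r j k * (2 * ∫⁻ x, D k x ^ 2 * g' x ∂μ) :=
        ENNReal.tsum_le_tsum fun j => ENNReal.tsum_le_tsum fun k => h1 j k
    _ = ∑' k, (∑' j, geomWeight r j k) * (2 * ∫⁻ x, D k x ^ 2 * g' x ∂μ) := by
        rw [ENNReal.tsum_comm]
        exact tsum_congr fun k => ENNReal.tsum_mul_right
    _ ≤ ∑' k, (2 * (1 - r)⁻¹) * (2 * ∫⁻ x, D k x ^ 2 * g' x ∂μ) :=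
        ENNReal.tsum_le_tsum fun k => mul_le_mul_left (tsum_geomWeight_le r k) _
    _ = 4 * (1 - r)⁻¹ * ∑' k, ∫⁻ x, D k x ^ 2 * g' x ∂μ := by
        rw [ENNReal.tsum_mul_left, ENNReal.tsum_mul_left]; ring
    _ = _ := by
        simp only [← ENNReal.tsum_mul_right]
        have hk : ∀ k, Measurable fun x => D k x ^ 2 * g' x :=
          fun k => ((hD k).pow_const 2).mul hg'
        rw [lintegral_tsum fun k => (hk k).aemeasurable]

/-- The square function bound for exponents `2 ρ ≥ 2`. -/
theorem sqFn_bound_of_two_le (hm : 0 < m) (hb : 0 < b) (hA : 0 < A) {ρ : ℝ} (hρ : 1 ≤ ρ) {r : ℝ≥0∞}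
    (hr : r < 1) :
    ∃ C : ℝ≥0, ∀ μ : Measure (RSpace n), IsPowerBounded m A μ → ∀ Q : Set (RSpace n),
      MeasurableSet Q → μ Q ≠ ⊤ → ∀ t : ℕ → ℝ, (∀ j, 0 < t j) → ∀ D : ℕ → RSpace n → ℝ≥0∞,
      (∀ k, Measurable (D k)) → ∫⁻ x in Q, (∑' k, D k x ^ 2) ^ ρ ∂μ ≠ ⊤ →
      (∀ k, ∀ x ∉ Q, D k x = 0) →
      ∫⁻ x in Q, sqFn m b μ r t D x ^ ρ ∂μ ≤ C * ∫⁻ x in Q, (∑' k, D k x ^ 2) ^ ρ ∂μ := by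
  have hr' : (1 - r)⁻¹ ≠ ⊤ := ENNReal.inv_ne_top.2 (tsub_pos_of_lt hr).ne'
  set c₁ : ℝ≥0 := poissonConst m b ^ 3 * A.toNNReal with hc₁
  set c₂ : ℝ≥0 := 4 * ((1 - r)⁻¹).toNNReal with hc₂
  have hc₂' : (c₂ : ℝ≥0∞) = 4 * (1 - r)⁻¹ := by
    rw [hc₂]; push_cast; rw [ENNReal.coe_toNNReal hr']
  -- the weighted bound
  have hweight : ∀ μ : Measure (RSpace n), IsPowerBounded m A μ → ∀ Q : Set (RSpace n),
      MeasurableSet Q → ∀ t : ℕ → ℝ, (∀ j, 0 < t j) → ∀ D : ℕ → RSpace n → ℝ≥0∞,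
      (∀ k, Measurable (D k)) → (∀ k, ∀ x ∉ Q, D k x = 0) → ∀ g : RSpace n → ℝ≥0∞, Measurable g →
      ∫⁻ x in Q, sqFn m b μ r t D x * g x ∂μ ≤ c₂ * ∫⁻ x in Q, (∑' k, D k x ^ 2) *
        (c₁ * maxFn m μ (maxFn m μ (Q.indicator g)) x + Q.indicator g x) ∂μ := by
    intro μ hμ Q hQ t ht D hD hDQ g hg
    have := hμ.isLocallyFiniteMeasure
    have hgQ : Measurable (Q.indicator g) := hg.indicator hQ
    have hMM : Measurable (maxFn m μ (maxFn m μ (Q.indicator g))) :=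
      measurable_maxFn (measurable_maxFn hgQ)
    have h1 := lintegral_sqFn_mul_le (m := m) (b := b) (r := r) (t := t) (μ := μ) hD hgQ
      (g' := fun x => c₁ * maxFn m μ (maxFn m μ (Q.indicator g)) x + Q.indicator g x)
      ((hMM.const_mul _).add hgQ) (fun j k => ?_) (fun k => ?_)
    · rw [← hc₂'] at h1
      have e1 : ∫⁻ x, sqFn m b μ r t D x * Q.indicator g x ∂μ =
          ∫⁻ x in Q, sqFn m b μ r t D x * g x ∂μ := by
        rw [← lintegral_indicator hQ]
        refine lintegral_congr fun x => ?_
        by_cases hx : x ∈ Q <;> simp [hx]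
      rw [e1] at h1
      refine h1.trans (le_of_eq ?_)
      congr 1
      rw [← lintegral_indicator hQ]
      refine lintegral_congr fun x => ?_
      by_cases hx : x ∈ Q
      · simp [hx]
      · simp [hx, hDQ _ x hx]
    · refine (lintegral_sqAvg_mul_le hm hb (ht j) hμ (hD k) hgQ).trans ?_
      rw [← lintegral_const_mul' _ _ ENNReal.coe_ne_top]
      refine lintegral_mono fun x => ?_
      rw [mul_left_comm]
      exact mul_le_mul_right le_self_add _
    · refine lintegral_mono fun x => mul_le_mul_right le_add_self _
  -- For ρ = 1 the test function 1 suffices and its maximal functions are bounded; for ρ > 1 use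
  -- duality and the L^{ρ'} bound of the iterated maximal function.
  rcases hρ.eq_or_lt with rfl | hρ1
  · refine ⟨c₂ * (c₁ * (A.toNNReal * A.toNNReal) + 1), fun μ hμ Q hQ hQfin t ht D hD _ hDQ => ?_⟩
    have := hμ.isLocallyFiniteMeasure
    have h1 := hweight μ hμ Q hQ t ht D hD hDQ (fun _ => 1) measurable_const
    simp only [mul_one] at h1
    simp only [ENNReal.rpow_one]
    refine h1.trans ?_
    push_cast
    rw [mul_assoc]
    refine mul_le_mul_right ?_ _
    rw [← lintegral_const_mul _ (Measurable.tsum fun k => (hD k).pow_const 2)]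
    refine lintegral_mono fun x => ?_
    rw [mul_comm]
    refine mul_le_mul_left ?_ _
    have h2 : ∀ y, Q.indicator (fun _ => (1 : ℝ≥0∞)) y ≤ 1 := fun y =>
      Set.indicator_le_self' (fun _ _ => zero_le) y
    refine add_le_add (mul_le_mul_right ?_ _) (h2 x)
    refine maxFn_le_of_le hμ (fun y => ?_) x
    exact (maxFn_le_of_le hμ h2 y).trans (by rw [mul_one]; rfl)
  · have hconj := Real.HolderConjugate.conjExponent hρ1
    set ρ' := ρ.conjExponent
    have hρ' : 1 < ρ' := hconj.symm.lt
    obtain ⟨C₁, hC₁⟩ := maxFn_strong_type (n := n) hm hA hρ'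
    -- the `L^{ρ'}` constant of the weight
    set c₃ : ℝ≥0 := 2 ^ (ρ' - 1) * (c₁ ^ ρ' * (C₁ * C₁) + 1) with hc₃
    refine ⟨(c₂ * c₃ ^ (1 / ρ')) ^ ρ, fun μ hμ Q hQ hQfin t ht D hD hDfin hDQ => ?_⟩
    have := hμ.isLocallyFiniteMeasure
    have hfinQ : IsFiniteMeasure (μ.restrict Q) := ⟨by simpa using hQfin.lt_top⟩
    have hρ0 : 0 < ρ := by linarith
    have hρ'0 : 0 < ρ' := by linarith
    set I := ∫⁻ x in Q, (∑' k, D k x ^ 2) ^ ρ ∂μ with hI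
    have hdual := lintegral_rpow_le_of_dual (ν := μ.restrict Q) hρ1
      (measurable_sqFn (m := m) (b := b) (r := r) (t := t) (μ := μ) hD)
      (B := c₂ * c₃ ^ (1 / ρ') * (I ^ (1 / ρ)).toNNReal) ?_
    · refine hdual.trans (le_of_eq ?_)
      have hIr : I ^ (1 / ρ) ≠ ⊤ := by finiteness
      rw [ENNReal.coe_toNNReal hIr, ENNReal.mul_rpow_of_nonneg _ _ hρ0.le, ← ENNReal.rpow_mul I,
        one_div_mul_cancel hρ0.ne', ENNReal.rpow_one, ENNReal.coe_rpow_of_nonneg _ hρ0.le]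
      push_cast
      rw [ENNReal.coe_rpow_of_nonneg _ (by positivity : 0 ≤ 1 / ρ')]
    · intro g hg
      have hgQ : Measurable (Q.indicator g) := hg.indicator hQ
      have hMM : Measurable (maxFn m μ (maxFn m μ (Q.indicator g))) :=
        measurable_maxFn (measurable_maxFn hgQ)
      set G : RSpace n → ℝ≥0∞ :=
        fun x => c₁ * maxFn m μ (maxFn m μ (Q.indicator g)) x + Q.indicator g x with hG
      have hGm : Measurable G := (hMM.const_mul _).add hgQ
      have hgint : ∫⁻ x, Q.indicator g x ^ ρ' ∂μ = ∫⁻ x in Q, g x ^ ρ' ∂μ := by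
        rw [← lintegral_indicator hQ]
        refine lintegral_congr fun x => ?_
        by_cases hx : x ∈ Q
        · simp [hx]
        · simp [hx, hρ'0]
      have hGint : ∫⁻ x in Q, G x ^ ρ' ∂μ ≤ c₃ * ∫⁻ x in Q, g x ^ ρ' ∂μ := by
        have h2 : ∀ x, G x ^ ρ' ≤ 2 ^ (ρ' - 1) * (c₁ ^ ρ' *
            maxFn m μ (maxFn m μ (Q.indicator g)) x ^ ρ' + Q.indicator g x ^ ρ') := fun x => by
          refine (ENNReal.rpow_add_le_mul_rpow_add_rpow _ _ hρ'.le).trans ?_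
          rw [ENNReal.mul_rpow_of_nonneg _ _ hρ'0.le]
        have hc1 : (2 : ℝ≥0∞) ^ (ρ' - 1) ≠ ⊤ :=
          ENNReal.rpow_ne_top_of_nonneg (by linarith) (by simp)
        have hc2 : (c₁ : ℝ≥0∞) ^ ρ' ≠ ⊤ := by finiteness
        calc _ ≤ ∫⁻ x, G x ^ ρ' ∂μ := setLIntegral_le_lintegral _ _
          _ ≤ ∫⁻ x, 2 ^ (ρ' - 1) * (c₁ ^ ρ' *
              maxFn m μ (maxFn m μ (Q.indicator g)) x ^ ρ' + Q.indicator g x ^ ρ') ∂μ :=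
              lintegral_mono h2
          _ = 2 ^ (ρ' - 1) * (c₁ ^ ρ' *
              ∫⁻ x, maxFn m μ (maxFn m μ (Q.indicator g)) x ^ ρ' ∂μ +
              ∫⁻ x, Q.indicator g x ^ ρ' ∂μ) := by
              rw [lintegral_const_mul' _ _ hc1, lintegral_add_right _ (hgQ.pow_const _),
                lintegral_const_mul' _ _ hc2]
          _ ≤ 2 ^ (ρ' - 1) * (c₁ ^ ρ' * (C₁ * (C₁ * ∫⁻ x, Q.indicator g x ^ ρ' ∂μ)) +
              ∫⁻ x, Q.indicator g x ^ ρ' ∂μ) := by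
              refine mul_le_mul_right (add_le_add (mul_le_mul_right ?_ _) le_rfl) _
              exact (hC₁ μ hμ _ (measurable_maxFn hgQ)).trans
                (mul_le_mul_right (hC₁ μ hμ _ hgQ) _)
          _ = _ := by
              rw [hgint, hc₃]
              push_cast
              rw [ENNReal.coe_rpow_of_nonneg _ hρ'0.le, ENNReal.coe_rpow_of_nonneg _ (by linarith)]
              push_cast
              ring
      calc _ ≤ c₂ * ∫⁻ x in Q, (∑' k, D k x ^ 2) * G x ∂μ := hweight μ hμ Q hQ t ht D hD hDQ g hg
        _ ≤ c₂ * (I ^ (1 / ρ) * (c₃ * ∫⁻ x in Q, g x ^ ρ' ∂μ) ^ (1 / ρ')) := by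
            refine mul_le_mul_right ?_ _
            refine (ENNReal.lintegral_mul_le_Lp_mul_Lq (μ.restrict Q) hconj
              (f := fun x => ∑' k, D k x ^ 2)
              (Measurable.tsum fun k => (hD k).pow_const 2).aemeasurable hGm.aemeasurable).trans ?_
            gcongr
        _ = _ := by
            have hIr : I ^ (1 / ρ) ≠ ⊤ := by finiteness
            have hρi : 0 ≤ 1 / ρ' := by positivity
            rw [ENNReal.coe_toNNReal hIr, ENNReal.mul_rpow_of_nonneg _ _ hρi]
            ring

/-- The square function bound for exponents `1 < q < 2`, in terms of a majorant `F` of the `D k`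
with respect to which the weighted `ℓ²` sum is under control. -/
theorem sqFn_bound_of_lt_two (hm : 0 < m) (hb : 0 < b) (hA : 0 < A) {q : ℝ} (hq1 : 1 < q)
    (hq2 : q < 2) {r : ℝ≥0∞} (hr : r < 1) :
    ∃ C : ℝ≥0, ∀ μ : Measure (RSpace n), IsPowerBounded m A μ → ∀ Q : Set (RSpace n),
      MeasurableSet Q → ∀ t : ℕ → ℝ, (∀ j, 0 < t j) → ∀ D : ℕ → RSpace n → ℝ≥0∞,
      (∀ k, Measurable (D k)) → (∀ k, ∀ x ∉ Q, D k x = 0) → ∀ F : RSpace n → ℝ≥0∞,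
      Measurable F → (∀ x ∈ Q, F x ≠ 0) → ∫⁻ x in Q, F x ^ q ∂μ ≠ ⊤ →
      ∫⁻ x in Q, (∑' k, D k x ^ 2) / F x ^ (2 - q) ∂μ ≤ 6 * ∫⁻ x in Q, F x ^ q ∂μ →
      ∫⁻ x in Q, sqFn m b μ r t D x ^ (q / 2) ∂μ ≤ C * ∫⁻ x in Q, F x ^ q ∂μ := by
  have hr' : (1 - r)⁻¹ ≠ ⊤ := ENNReal.inv_ne_top.2 (tsub_pos_of_lt hr).ne'
  have h2q : 0 < 2 - q := by linarith
  have hq0 : 0 < q := by linarith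
  have hs : 1 < q / (2 - q) := by rw [lt_div_iff₀ h2q]; linarith
  obtain ⟨B, hB⟩ := exists_weight_maxFn_le (n := n) hm hA hs
  set c₁ : ℝ≥0 := poissonConst m b ^ 3 * A.toNNReal ^ 2 * B with hc₁
  set c₂ : ℝ≥0 := 4 * ((1 - r)⁻¹).toNNReal with hc₂
  have hc₂' : (c₂ : ℝ≥0∞) = 4 * (1 - r)⁻¹ := by
    rw [hc₂]; push_cast; rw [ENNReal.coe_toNNReal hr']
  refine ⟨(c₂ * (c₁ + 1) * 6) ^ (q / 2) * (2 ^ (q / (2 - q))) ^ ((2 - q) / 2),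
    fun μ hμ Q hQ t ht D hD hDQ F hF hF0 hFint hDF => ?_⟩
  have := hμ.isLocallyFiniteMeasure
  set I := ∫⁻ x in Q, F x ^ q ∂μ with hI
  -- The Rubio de Francia majorant of F^(2-q), taken in L^{q/(2-q)}. This is the exponent for which
  -- the norm of F^(2-q) is governed by the integral of F^q, and it exceeds 1 because q > 1.
  obtain ⟨v, hvm, hgv, hMv, hvint⟩ := hB μ hμ (Q.indicator fun x => F x ^ (2 - q))
    ((hF.pow_const _).indicator hQ)
  have hgI : ∫⁻ x, (Q.indicator (fun x => F x ^ (2 - q)) x) ^ (q / (2 - q)) ∂μ = I := by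
    rw [hI, ← lintegral_indicator hQ]
    refine lintegral_congr fun x => ?_
    by_cases hx : x ∈ Q
    · simp only [hx, Set.indicator_of_mem, ← ENNReal.rpow_mul]
      congr 1; field_simp
    · have : 0 < q / (2 - q) := by positivity
      simp [hx, this]
  rw [hgI] at hvint
  have hvt : ∀ᵐ x ∂μ, v x ≠ ⊤ := by
    have h1 : ∫⁻ x, v x ^ (q / (2 - q)) ∂μ ≠ ⊤ := by
      refine ne_top_of_le_ne_top ?_ hvint
      finiteness
    filter_upwards [ae_lt_top (hvm.pow_const _) h1] with x hx hcon
    rw [hcon, ENNReal.top_rpow_of_pos (by positivity)] at hx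
    exact lt_irrefl _ hx
  have hv0 : ∀ x ∈ Q, v x ≠ 0 := fun x hx hcon => by
    have := hgv x
    rw [hcon, Set.indicator_of_mem hx] at this
    have h2 := le_antisymm this zero_le
    rw [ENNReal.rpow_eq_zero_iff_of_pos h2q] at h2
    exact hF0 x hx h2
  have hw := lintegral_sqFn_mul_le (m := m) (b := b) (r := r) (t := t) (μ := μ) hD
    (g := fun x => (v x)⁻¹) (g' := fun x => (c₁ + 1) * (v x)⁻¹) hvm.inv (hvm.inv.const_mul _)
    (fun j k => ?_) (fun k => ?_)
  rotate_left
  · have h1 := lintegral_sqAvg_div_le hm hb (ht j) hμ (hD k) hvm hvt (fun x hx => ?_) hMv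
    · simp only [div_eq_mul_inv] at h1
      refine h1.trans ?_
      rw [← lintegral_const_mul' _ _ ENNReal.coe_ne_top]
      refine lintegral_mono fun x => ?_
      rw [mul_left_comm]
      exact mul_le_mul_right (mul_le_mul_left le_self_add _) _
    · exact hDQ k x fun hxQ => hv0 x hxQ hx
  · refine lintegral_mono fun x => mul_le_mul_right ?_ _
    conv_lhs => rw [← one_mul (v x)⁻¹]
    exact mul_le_mul_left le_add_self _
  have hw2 : ∫⁻ x in Q, sqFn m b μ r t D x * (v x)⁻¹ ∂μ ≤ (c₂ * (c₁ + 1) * 6 : ℝ≥0) * I := by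
    refine (setLIntegral_le_lintegral _ _).trans (hw.trans ?_)
    rw [← hc₂']
    push_cast
    rw [mul_assoc, mul_assoc]
    refine mul_le_mul_right ?_ _
    simp only [mul_left_comm _ ((c₁ : ℝ≥0∞) + 1)]
    have hc : ((c₁ : ℝ≥0∞) + 1) ≠ ⊤ := by finiteness
    rw [lintegral_const_mul' _ _ hc]
    refine mul_le_mul_right (le_trans ?_ hDF) _
    rw [← lintegral_indicator hQ]
    refine lintegral_mono fun x => ?_
    by_cases hx : x ∈ Q
    · rw [Set.indicator_of_mem hx, div_eq_mul_inv]
      refine mul_le_mul_right (ENNReal.inv_le_inv.2 ?_) _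
      simpa [hx] using hgv x
    · simp [hDQ _ x hx]
  have hconj : Real.HolderConjugate (2 / q) (2 / (2 - q)) := by
    rw [Real.holderConjugate_iff]
    refine ⟨by rw [lt_div_iff₀ hq0]; linarith, ?_⟩
    rw [inv_div, inv_div]; field_simp; ring
  have hS := measurable_sqFn (m := m) (b := b) (r := r) (t := t) (μ := μ) hD
  -- Hölder with exponents 2/q and 2/(2-q) for S^(q/2) = (S/v)^(q/2) v^(q/2), where S is the square
  -- function.
  calc ∫⁻ x in Q, sqFn m b μ r t D x ^ (q / 2) ∂μ
      = ∫⁻ x in Q, (sqFn m b μ r t D x * (v x)⁻¹) ^ (q / 2) * v x ^ (q / 2) ∂μ := by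
        refine setLIntegral_congr_fun_ae hQ ?_
        filter_upwards [hvt] with x hx hxQ
        rw [← ENNReal.mul_rpow_of_nonneg _ _ (by positivity), mul_assoc,
          ENNReal.inv_mul_cancel (hv0 x hxQ) hx, mul_one]
    _ ≤ (∫⁻ x in Q, sqFn m b μ r t D x * (v x)⁻¹ ∂μ) ^ (q / 2) *
          (∫⁻ x in Q, v x ^ (q / (2 - q)) ∂μ) ^ ((2 - q) / 2) := by
        have key := ENNReal.lintegral_mul_le_Lp_mul_Lq (μ.restrict Q) hconj
          (f := fun x => (sqFn m b μ r t D x * (v x)⁻¹) ^ (q / 2)) (g := fun x => v x ^ (q / 2))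
          ((hS.mul hvm.inv).pow_const _).aemeasurable (hvm.pow_const _).aemeasurable
        simp only [← ENNReal.rpow_mul, one_div_div] at key
        rw [show q / 2 * (2 / q) = 1 by field_simp,
          show q / 2 * (2 / (2 - q)) = q / (2 - q) by field_simp] at key
        simpa only [ENNReal.rpow_one, Pi.mul_apply] using key
    _ ≤ ((c₂ * (c₁ + 1) * 6 : ℝ≥0) * I) ^ (q / 2) * (2 ^ (q / (2 - q)) * I) ^ ((2 - q) / 2) := by
        gcongr
        exact (setLIntegral_le_lintegral _ _).trans hvint
    _ = _ := by
        have h1 : 0 ≤ q / 2 := by positivity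
        have h2 : 0 ≤ (2 - q) / 2 := by positivity
        have h3 : 0 ≤ q / (2 - q) := by positivity
        rw [ENNReal.mul_rpow_of_nonneg _ _ h1, ENNReal.mul_rpow_of_nonneg _ _ h2,
          mul_mul_mul_comm, ← ENNReal.rpow_add_of_nonneg _ _ h1 h2,
          show q / 2 + (2 - q) / 2 = 1 by ring, ENNReal.rpow_one]
        congr 1
        rw [ENNReal.coe_mul (_ ^ (q / 2)), ENNReal.coe_rpow_of_nonneg _ h1,
          ENNReal.coe_rpow_of_nonneg _ h2, ENNReal.coe_rpow_of_nonneg _ h3]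
        rfl

end

/-- The absolute values of the increments of the martingale generated by `f`, restricted to `Q`. -/
noncomputable def increment {Ω : Type*} {mΩ : MeasurableSpace Ω} (μ : Measure Ω) (Q : Set Ω)
    (ℱ : Filtration ℕ mΩ) (f : Ω → ℂ) (k : ℕ) : Ω → ℝ≥0∞ :=
  Q.indicator fun x => ‖((μ.restrict Q)[f|ℱ (k + 1)]) x - ((μ.restrict Q)[f|ℱ k]) x‖ₑ

theorem measurable_condExp_filtration {Ω : Type*} {mΩ : MeasurableSpace Ω} (ν : Measure Ω)
    (ℱ : Filtration ℕ mΩ) (f : Ω → ℂ) (k : ℕ) : Measurable (ν[f|ℱ k]) :=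
  (stronglyMeasurable_condExp.mono (ℱ.le k)).measurable

theorem measurable_increment {Ω : Type*} {mΩ : MeasurableSpace Ω} (μ : Measure Ω) {Q : Set Ω}
    (hQ : MeasurableSet Q) (ℱ : Filtration ℕ mΩ) (f : Ω → ℂ) (k : ℕ) :
    Measurable (increment μ Q ℱ f k) :=
  ((measurable_condExp_filtration _ ℱ f (k + 1)).sub
    (measurable_condExp_filtration _ ℱ f k)).enorm.indicator hQ

theorem increment_of_mem {Ω : Type*} {mΩ : MeasurableSpace Ω} {μ : Measure Ω} {Q : Set Ω}
    {ℱ : Filtration ℕ mΩ} {f : Ω → ℂ} {k : ℕ} {x : Ω} (hx : x ∈ Q) :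
    increment μ Q ℱ f k x =
      ‖((μ.restrict Q)[f|ℱ (k + 1)]) x - ((μ.restrict Q)[f|ℱ k]) x‖ₑ :=
  Set.indicator_of_mem hx _

theorem increment_of_notMem {Ω : Type*} {mΩ : MeasurableSpace Ω} {μ : Measure Ω} {Q : Set Ω}
    {ℱ : Filtration ℕ mΩ} {f : Ω → ℂ} {k : ℕ} {x : Ω} (hx : x ∉ Q) :
    increment μ Q ℱ f k x = 0 :=
  Set.indicator_of_notMem hx _

/-- `L^q` bound for the square function of a martingale. -/
theorem sqFn_increment_bound {n : ℕ} {m b A q : ℝ} {r : ℝ≥0∞} (hm : 0 < m) (hb : 0 < b)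
    (hA : 0 < A) (hq : 1 < q) (hr : r < 1) :
    ∃ C : ℝ≥0, ∀ μ : Measure (RSpace n), IsPowerBounded m A μ → ∀ Q : Set (RSpace n),
      MeasurableSet Q → μ Q ≠ ⊤ → ∀ t : ℕ → ℝ, (∀ j, 0 < t j) →
      ∀ (ℱ : Filtration ℕ (inferInstance : MeasurableSpace (RSpace n))) (f : RSpace n → ℂ),
      Measurable f → MemLp f (ENNReal.ofReal q) (μ.restrict Q) →
      ∫⁻ x in Q, sqFn m b μ r t (increment μ Q ℱ f) x ^ (q / 2) ∂μ ≤
        C * ∫⁻ x in Q, ‖f x‖ₑ ^ q ∂μ := by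
  have hq0 : 0 < q := by linarith
  set c₀ : ℝ≥0 := (2 * ENNReal.ofReal (q / (q - 1) * (2⁻¹)⁻¹ ^ (q - 1))).toNNReal with hc₀
  have hc₀' : (c₀ : ℝ≥0∞) = 2 * ENNReal.ofReal (q / (q - 1) * (2⁻¹)⁻¹ ^ (q - 1)) :=
    ENNReal.coe_toNNReal (by finiteness)
  have hone : (1 : ℝ≥0∞) ≤ ENNReal.ofReal q := by
    rw [← ENNReal.ofReal_one]; exact ENNReal.ofReal_le_ofReal hq.le
  have hfin : ∀ {μ : Measure (RSpace n)} {Q : Set (RSpace n)} {f : RSpace n → ℂ},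
      MemLp f (ENNReal.ofReal q) (μ.restrict Q) → ∫⁻ x in Q, ‖f x‖ₑ ^ q ∂μ ≠ ⊤ := by
    intro μ Q f hf
    have := lintegral_rpow_enorm_lt_top_of_eLpNorm_lt_top (by simpa using hq0)
      ENNReal.ofReal_ne_top hf.2
    rw [ENNReal.toReal_ofReal hq0.le] at this
    exact this.ne
  have hsum : ∀ {μ : Measure (RSpace n)} {Q : Set (RSpace n)} (ℱ : Filtration ℕ _)
      (f : RSpace n → ℂ) (x : RSpace n), x ∈ Q → ∑' k, increment μ Q ℱ f k x ^ 2 =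
      ∑' k, ‖((μ.restrict Q)[f|ℱ (k + 1)]) x - ((μ.restrict Q)[f|ℱ k]) x‖ₑ ^ 2 := by
    intro μ Q ℱ f x hx
    simp only [increment_of_mem hx]
  rcases le_or_gt 2 q with hq2 | hq2
  · have hρ : 1 ≤ q / 2 := by linarith
    obtain ⟨C, hC⟩ := sqFn_bound_of_two_le (n := n) hm hb hA hρ hr
    refine ⟨C * (((8 * (q / 2)) ^ (q / 2)).toNNReal * c₀), fun μ hμ Q hQ hQf t ht ℱ f hfm hf => ?_⟩
    have : IsFiniteMeasure (μ.restrict Q) := ⟨by simpa using hQf.lt_top⟩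
    have hint : Integrable f (μ.restrict Q) := hf.integrable hone
    have h1 : ∫⁻ x in Q, (∑' k, increment μ Q ℱ f k x ^ 2) ^ (q / 2) ∂μ ≤
        (((8 * (q / 2)) ^ (q / 2)).toNNReal * c₀ : ℝ≥0) * ∫⁻ x in Q, ‖f x‖ₑ ^ q ∂μ := by
      rw [setLIntegral_congr_fun hQ fun x hx => by rw [hsum ℱ f x hx]]
      refine (lintegral_tsum_rpow_le (martingale_condExp f ℱ (μ.restrict Q)) hρ fun k => ?_).trans ?_
      · rw [show 2 * (q / 2) = q by ring]
        exact hf.condExp hone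
      · push_cast
        rw [show 2 * (q / 2) = q by ring, mul_assoc, hc₀']
        exact mul_le_mul_right (procMax_condExp_strong_type hfm hint hq) _
    refine (hC μ hμ Q hQ hQf t ht _ (measurable_increment μ hQ ℱ f) ?_
      fun k x hx => increment_of_notMem hx).trans ?_
    · exact ne_top_of_le_ne_top (ENNReal.mul_ne_top ENNReal.coe_ne_top (hfin hf)) h1
    · rw [ENNReal.coe_mul, mul_assoc]
      exact mul_le_mul_right h1 _
  -- For q < 2 the majorant is F = ε + (Doob's maximal function), positive everywhere as the weight
  -- requires. The constants do not depend on ε, which tends to 0 at the end; here μ(Q) < ∞ is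
  -- needed.
  · obtain ⟨C, hC⟩ := sqFn_bound_of_lt_two (n := n) hm hb hA hq hq2 hr
    refine ⟨C * (2 ^ (q - 1) * c₀), fun μ hμ Q hQ hQf t ht ℱ f hfm hf => ?_⟩
    have : IsFiniteMeasure (μ.restrict Q) := ⟨by simpa using hQf.lt_top⟩
    have hint : Integrable f (μ.restrict Q) := hf.integrable hone
    set P := procMax fun k => (μ.restrict Q)[f|ℱ k] with hP
    have hPm : Measurable P := measurable_procMax (measurable_condExp_filtration _ ℱ f)
    have hPint : ∫⁻ x in Q, P x ^ q ∂μ ≤ c₀ * ∫⁻ x in Q, ‖f x‖ₑ ^ q ∂μ := by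
      rw [hc₀']; exact procMax_condExp_strong_type hfm hint hq
    have h2 : (2 : ℝ≥0∞) ^ (q - 1) ≠ ⊤ := ENNReal.rpow_ne_top_of_nonneg (by linarith) (by simp)
    have hFint : ∀ ε : ℝ, ∫⁻ x in Q, (ENNReal.ofReal ε + P x) ^ q ∂μ ≤
        2 ^ (q - 1) * (ENNReal.ofReal ε ^ q * μ Q + c₀ * ∫⁻ x in Q, ‖f x‖ₑ ^ q ∂μ) := by
      intro ε
      calc _ ≤ ∫⁻ x in Q, 2 ^ (q - 1) * (ENNReal.ofReal ε ^ q + P x ^ q) ∂μ :=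
            lintegral_mono fun x => ENNReal.rpow_add_le_mul_rpow_add_rpow _ _ hq.le
        _ = 2 ^ (q - 1) * (ENNReal.ofReal ε ^ q * μ Q + ∫⁻ x in Q, P x ^ q ∂μ) := by
            rw [lintegral_const_mul' _ _ h2, lintegral_add_left measurable_const]
            simp
        _ ≤ _ := by gcongr
    have hbound : ∀ ε : ℝ, 0 < ε →
        ∫⁻ x in Q, sqFn m b μ r t (increment μ Q ℱ f) x ^ (q / 2) ∂μ ≤
        C * (2 ^ (q - 1) * (ENNReal.ofReal ε ^ q * μ Q + c₀ * ∫⁻ x in Q, ‖f x‖ₑ ^ q ∂μ)) := by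
      intro ε hε
      refine (hC μ hμ Q hQ t ht _ (measurable_increment μ hQ ℱ f)
        (fun k x hx => increment_of_notMem hx) (fun x => ENNReal.ofReal ε + P x)
        (hPm.const_add _) (fun x _ => ?_) ?_ ?_).trans (mul_le_mul_right (hFint ε) _)
      · have : 0 < ENNReal.ofReal ε := by simpa using hε
        exact (this.trans_le le_self_add).ne'
      · refine ne_top_of_le_ne_top ?_ (hFint ε)
        have := hfin hf
        finiteness
      · rw [setLIntegral_congr_fun hQ fun x hx => by rw [hsum ℱ f x hx]]
        exact lintegral_tsum_div_le (martingale_condExp f ℱ (μ.restrict Q)) hq hq2.le hε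
          fun k => hf.condExp hone
    have hlim : Filter.Tendsto (fun ε : ℝ => (C : ℝ≥0∞) * (2 ^ (q - 1) *
        (ENNReal.ofReal ε ^ q * μ Q + c₀ * ∫⁻ x in Q, ‖f x‖ₑ ^ q ∂μ))) (nhdsWithin 0 (Set.Ioi 0))
        (nhds (C * (2 ^ (q - 1) * (ENNReal.ofReal 0 ^ q * μ Q +
          c₀ * ∫⁻ x in Q, ‖f x‖ₑ ^ q ∂μ)))) := by
      refine Filter.Tendsto.mono_left ?_ nhdsWithin_le_nhds
      refine ENNReal.Tendsto.const_mul (ENNReal.Tendsto.const_mul (Filter.Tendsto.add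
        (ENNReal.Tendsto.mul_const ?_ (Or.inr hQf)) tendsto_const_nhds) (Or.inr h2))
        (Or.inr ENNReal.coe_ne_top)
      exact ((ENNReal.continuous_rpow_const).comp ENNReal.continuous_ofReal).tendsto 0
    have := ge_of_tendsto hlim (eventually_nhdsWithin_of_forall fun ε hε => hbound ε hε)
    refine this.trans (le_of_eq ?_)
    rw [ENNReal.ofReal_zero, ENNReal.zero_rpow_of_pos hq0, zero_mul, zero_add]
    push_cast
    rw [ENNReal.coe_rpow_of_nonneg _ (by linarith)]
    push_cast
    ring

/-! ### Selecting scales at random -/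

/-- The discarded part of the sum has mean at most a quarter of the sum, so by Markov it is less
than half of the sum with probability at least 1/2; on that event at least half of the sum is kept.
The argument works for every ρ > 0, also below 1, and needs no relation between the events for
different j. -/
theorem rpow_tsum_le_lintegral {Ω : Type*} {mΩ : MeasurableSpace Ω} (P : Measure Ω)
    [IsProbabilityMeasure P] {S : ℕ → Set Ω} (hS : ∀ j, MeasurableSet (S j))
    (hP : ∀ j, P (S j)ᶜ ≤ 1 / 4) {ρ : ℝ} (hρ : 0 < ρ) (a : ℕ → ℝ≥0∞) :
    (∑' j, a j) ^ ρ ≤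
      2 ^ (ρ + 1) * ∫⁻ ω, (∑' j, (S j).indicator (fun _ => a j) ω) ^ ρ ∂P := by
  rw [← ENNReal.le_rpow_inv_iff hρ]
  refine le_of_forall_lt_imp_le_of_dense fun c hc => ?_
  rw [ENNReal.le_rpow_inv_iff hρ]
  rcases eq_or_ne c 0 with rfl | hc0
  · rw [ENNReal.zero_rpow_of_pos hρ]; exact zero_le
  have hct : c ≠ ⊤ := hc.ne_top
  obtain ⟨J, hJ⟩ : ∃ J : Finset ℕ, c < ∑ j ∈ J, a j := by
    rw [ENNReal.tsum_eq_iSup_sum] at hc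
    exact lt_iSup_iff.1 hc
  -- Cutting the terms at c makes the finite sum finite, as Markov requires, and still leaves it at
  -- least c: either one term reaches c, or nothing is cut.
  set Y := ∑ j ∈ J, min (a j) c with hY
  have hYt : Y ≠ ⊤ := ENNReal.sum_ne_top.2 fun j _ => ne_top_of_le_ne_top hct (min_le_right _ _)
  have hcY : c ≤ Y := by
    by_cases h : ∃ j ∈ J, c ≤ a j
    · obtain ⟨j, hj, hcj⟩ := h
      calc c = min (a j) c := (min_eq_right hcj).symm
        _ ≤ Y := Finset.single_le_sum (f := fun j => min (a j) c) (fun _ _ => zero_le) hj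
    · push Not at h
      refine hJ.le.trans (Finset.sum_le_sum fun j hj => ?_)
      rw [min_eq_left (h j hj).le]
  have hY0 : Y ≠ 0 := fun h => hc0 (le_antisymm (h ▸ hcY) zero_le)
  set B : Ω → ℝ≥0∞ := fun ω => ∑ j ∈ J, (S j)ᶜ.indicator (fun _ => min (a j) c) ω with hB
  have hBm : Measurable B :=
    Finset.measurable_fun_sum _ fun j _ => measurable_const.indicator (hS j).compl
  have hBint : ∫⁻ ω, B ω ∂P ≤ Y / 4 := by
    rw [hB, lintegral_finsetSum _ fun j _ => measurable_const.indicator (hS j).compl, hY,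
      div_eq_mul_inv, Finset.sum_mul]
    refine Finset.sum_le_sum fun j _ => ?_
    rw [lintegral_indicator_const (hS j).compl]
    refine mul_le_mul_right ((hP j).trans (by simp)) _
  have hmark : P {ω | Y / 2 ≤ B ω} ≤ 1 / 2 := by
    refine (meas_ge_le_lintegral_div hBm.aemeasurable (by simp [hY0])
      (ENNReal.div_ne_top hYt (by simp))).trans ?_
    refine ENNReal.div_le_of_le_mul (hBint.trans (le_of_eq ?_))
    rw [one_div, mul_comm, ← div_eq_mul_inv, div_eq_mul_inv, div_eq_mul_inv, div_eq_mul_inv,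
      mul_assoc, ← ENNReal.mul_inv (by simp) (by simp)]
    norm_num
  have hpos : 1 / 2 ≤ P {ω | B ω < Y / 2} := by
    have h1 : {ω | B ω < Y / 2} = {ω | Y / 2 ≤ B ω}ᶜ := by ext ω; simp
    rw [h1, prob_compl_eq_one_sub (measurableSet_le measurable_const hBm)]
    refine le_trans (le_of_eq ?_) (tsub_le_tsub_left hmark 1)
    norm_num
  have hX : ∀ ω, B ω < Y / 2 → c / 2 ≤ ∑' j, (S j).indicator (fun _ => a j) ω := by
    intro ω hω
    have h1 : Y ≤ ∑ j ∈ J, (S j).indicator (fun _ => a j) ω + B ω := by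
      rw [hB, hY, ← Finset.sum_add_distrib]
      refine Finset.sum_le_sum fun j _ => ?_
      by_cases h : ω ∈ S j <;> simp [h]
    have h2 : Y / 2 ≤ ∑ j ∈ J, (S j).indicator (fun _ => a j) ω := by
      by_contra hcon
      push Not at hcon
      have := ENNReal.add_lt_add hcon hω
      rw [ENNReal.add_halves] at this
      exact absurd h1 this.not_ge
    exact (ENNReal.div_le_div_right hcY 2).trans (h2.trans (ENNReal.sum_le_tsum _))
  have hfin : (1 / 2) * (c / 2) ^ ρ ≤
      ∫⁻ ω, (∑' j, (S j).indicator (fun _ => a j) ω) ^ ρ ∂P := by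
    calc (1 / 2) * (c / 2) ^ ρ ≤ (c / 2) ^ ρ * P {ω | B ω < Y / 2} := by
          rw [mul_comm]; exact mul_le_mul_right hpos _
      _ = ∫⁻ _ in {ω | B ω < Y / 2}, (c / 2) ^ ρ ∂P := by rw [setLIntegral_const]
      _ ≤ ∫⁻ ω in {ω | B ω < Y / 2}, (∑' j, (S j).indicator (fun _ => a j) ω) ^ ρ ∂P :=
          setLIntegral_mono' (measurableSet_lt hBm measurable_const) fun ω hω =>
            ENNReal.rpow_le_rpow (hX ω hω) hρ.le
      _ ≤ _ := setLIntegral_le_lintegral _ _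
  refine le_trans (le_of_eq ?_) (mul_le_mul_right hfin _)
  rw [ENNReal.rpow_add _ _ (by simp) (by simp), ENNReal.rpow_one, ENNReal.div_rpow_of_nonneg _ _ hρ.le,
    mul_assoc, ← mul_assoc 2, one_div, ENNReal.mul_inv_cancel (by simp) (by simp), one_mul,
    ENNReal.mul_div_cancel (by simp) (by finiteness)]

/-! ### Randomly shifted dyadic grids -/

section
variable {n : ℕ}

/-- Coordinates with respect to a grid whose first generation has side length `2 ℓ`. -/
noncomputable def gridCoord (a : Fin n → ℝ) (ℓ ω : ℝ) (x : RSpace n) (i : Fin n) : ℝ :=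
  (x i - a i) / (2 * ℓ) + ω / 2

/-- The label of the cell of generation `k` which contains `x`. -/
noncomputable def gridCode (a : Fin n → ℝ) (ℓ ω : ℝ) (k : ℕ) (x : RSpace n) : Fin n → ℤ :=
  fun i => ⌊2 ^ k * gridCoord a ℓ ω x i⌋

theorem measurable_gridCode (a : Fin n → ℝ) (ℓ ω : ℝ) (k : ℕ) :
    Measurable (gridCode a ℓ ω k) := by
  refine measurable_pi_lambda _ fun i => Int.measurable_floor.comp ?_
  unfold gridCoord
  fun_prop

/-- The label of the parent is the integer half of the label of the child. The cells are therefore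
nested and the σ-algebras increase. -/
theorem gridCode_eq_div (a : Fin n → ℝ) (ℓ ω : ℝ) (k : ℕ) (x : RSpace n) :
    gridCode a ℓ ω k x = fun i => gridCode a ℓ ω (k + 1) x i / 2 := by
  funext i
  have := Int.floor_div_natCast (2 ^ (k + 1) * gridCoord a ℓ ω x i) 2
  simp only [gridCode]
  rw [show (2 : ℤ) = ((2 : ℕ) : ℤ) by norm_num, ← this]
  congr 1
  push_cast
  ring

/-- The filtration generated by the cells of the grid. -/
noncomputable def gridFiltration (a : Fin n → ℝ) (ℓ ω : ℝ) :
    Filtration ℕ (inferInstance : MeasurableSpace (RSpace n)) where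
  seq k := MeasurableSpace.comap (gridCode a ℓ ω k) inferInstance
  mono' := by
    refine monotone_nat_of_le_succ fun k => ?_
    have h : gridCode a ℓ ω k =
        (fun c : Fin n → ℤ => fun i => c i / 2) ∘ gridCode a ℓ ω (k + 1) := by
      funext x; exact gridCode_eq_div a ℓ ω k x
    rw [h, ← MeasurableSpace.comap_comp]
    exact MeasurableSpace.comap_mono (measurable_of_countable _).comap_le
  le' k := (measurable_gridCode a ℓ ω k).comap_le

theorem measurable_gridCode_filtration (a : Fin n → ℝ) (ℓ ω : ℝ) (k : ℕ) :
    Measurable[gridFiltration a ℓ ω k] (gridCode a ℓ ω k) :=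
  comap_measurable _

theorem eq_of_gridCode_eq {a : Fin n → ℝ} {ℓ ω : ℝ} {k : ℕ} {g : RSpace n → ℂ}
    (hg : Measurable[gridFiltration a ℓ ω k] g) {x z : RSpace n}
    (h : gridCode a ℓ ω k x = gridCode a ℓ ω k z) : g x = g z := by
  obtain ⟨s, -, hs⟩ := hg (measurableSet_singleton (g x))
  have h1 : x ∈ g ⁻¹' {g x} := rfl
  rw [← hs, Set.mem_preimage, h, ← Set.mem_preimage, hs] at h1
  exact h1.symm

/-- Generation 0 has side 2ℓ and the shift is less than half of that, so the whole cube fits into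
one cell. Hence E_0 f is constant on Q for every shift. -/
theorem gridCode_zero {a : Fin n → ℝ} {ℓ ω : ℝ} (hℓ : 0 < ℓ) (hω : ω ∈ Set.Ico (0 : ℝ) 1)
    {x : RSpace n} (hx : ∀ i, x i ∈ Set.Icc (a i) (a i + ℓ)) : gridCode a ℓ ω 0 x = 0 := by
  funext i
  simp only [gridCode, gridCoord, Pi.zero_apply, pow_zero, one_mul]
  rw [Int.floor_eq_zero_iff]
  have h1 : 0 ≤ (x i - a i) / (2 * ℓ) := div_nonneg (by linarith [(hx i).1]) (by linarith)
  have h2 : (x i - a i) / (2 * ℓ) ≤ 1 / 2 := by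
    rw [div_le_iff₀ (by linarith)]; linarith [(hx i).2]
  exact ⟨by linarith [hω.1], by linarith [hω.2]⟩

/-- The centre of the cell of generation `k` with label `c`. -/
noncomputable def gridCenter (a : Fin n → ℝ) (ℓ ω : ℝ) (k : ℕ) (c : Fin n → ℤ) : RSpace n :=
  WithLp.toLp 2 fun i => a i + 2 * ℓ * (((c i : ℝ) + 1 / 2) / 2 ^ k - ω / 2)

theorem norm_sub_gridCenter_le {a : Fin n → ℝ} {ℓ ω : ℝ} (hℓ : 0 < ℓ) (k : ℕ) (x : RSpace n) :
    ‖x - gridCenter a ℓ ω k (gridCode a ℓ ω k x)‖ ≤ √n * (ℓ / 2 ^ k) := by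
  have h0 : 0 ≤ ℓ / 2 ^ k := by positivity
  have h1 : ∀ i, |x i - gridCenter a ℓ ω k (gridCode a ℓ ω k x) i| ≤ ℓ / 2 ^ k := by
    intro i
    set u := gridCoord a ℓ ω x i with hu
    have hx : x i = a i + 2 * ℓ * (u - ω / 2) := by
      rw [hu, gridCoord]; field_simp; ring
    have h2 : x i - gridCenter a ℓ ω k (gridCode a ℓ ω k x) i =
        2 * (ℓ / 2 ^ k) * (2 ^ k * u - ⌊2 ^ k * u⌋ - 1 / 2) := by
      simp only [gridCenter, gridCode]
      rw [hx, ← hu]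
      field_simp
      ring
    rw [h2, abs_mul, abs_of_nonneg (by positivity : 0 ≤ 2 * (ℓ / 2 ^ k))]
    have h3 : |2 ^ k * u - ⌊2 ^ k * u⌋ - 1 / 2| ≤ 1 / 2 := by
      rw [abs_le]
      constructor
      · linarith [Int.floor_le (2 ^ k * u)]
      · linarith [Int.lt_floor_add_one (2 ^ k * u)]
    nlinarith
  rw [EuclideanSpace.norm_eq]
  refine Real.sqrt_le_iff.2 ⟨by positivity, ?_⟩
  rw [mul_pow, Real.sq_sqrt (by positivity)]
  refine (Finset.sum_le_sum fun i _ => pow_le_pow_left₀ (norm_nonneg _) (h1 i) 2).trans ?_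
  simp

/-- The constant in the definition of good points. -/
noncomputable def gridGap (n : ℕ) : ℝ := 1 / (200 * (n + 1))

theorem gridGap_pos (n : ℕ) : 0 < gridGap n := by unfold gridGap; positivity

/-- `x` is far from the boundaries of the cells of generations at most `j`. -/
def IsGridGood (a : Fin n → ℝ) (ℓ ω : ℝ) (j : ℕ) (x : RSpace n) : Prop :=
  ∀ k ≤ j, ∀ i, ∀ z : ℤ, gridGap n * (3 / 4) ^ (j - k) ≤ |2 ^ k * gridCoord a ℓ ω x i - z|

theorem measurableSet_isGridGood (a : Fin n → ℝ) (ℓ : ℝ) (j : ℕ) :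
    MeasurableSet {w : RSpace n × ℝ | IsGridGood a ℓ w.2 j w.1} := by
  unfold IsGridGood
  simp only [gridCoord]
  simp only [Set.ofPred_forall]
  refine .iInter fun k => .iInter fun _ => .iInter fun i => .iInter fun z => ?_
  exact measurableSet_le measurable_const (by fun_prop)

/-- In a coordinate where the labels differ an integer separates the scaled coordinates of x and z,
and x stays away from all integers. -/
theorem IsGridGood.le_norm_sub {a : Fin n → ℝ} {ℓ ω : ℝ} (hℓ : 0 < ℓ) {j : ℕ} {x : RSpace n}
    (hx : IsGridGood a ℓ ω j x) {k : ℕ} (hk : k ≤ j) {z : RSpace n}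
    (hne : gridCode a ℓ ω k z ≠ gridCode a ℓ ω k x) :
    2 * ℓ * (gridGap n * (3 / 4) ^ (j - k) / 2 ^ k) ≤ ‖x - z‖ := by
  obtain ⟨i, hi⟩ := Function.ne_iff.1 hne
  have h1 : gridGap n * (3 / 4) ^ (j - k) ≤
      |2 ^ k * gridCoord a ℓ ω x i - 2 ^ k * gridCoord a ℓ ω z i| := by
    simp only [gridCode] at hi
    set u := 2 ^ k * gridCoord a ℓ ω x i with hu
    set v := 2 ^ k * gridCoord a ℓ ω z i with hv
    have hg := gridGap_pos n
    have hpos : 0 < gridGap n * (3 / 4) ^ (j - k) := by positivity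
    rcases lt_or_gt_of_ne hi with h | h
    · have h2 := hx k hk i ⌊u⌋
      have h3 : v < ⌊u⌋ := Int.floor_lt.1 h
      rw [← hu, abs_of_nonneg (by linarith [Int.floor_le u])] at h2
      rw [abs_of_nonneg (by linarith [Int.floor_le u])]
      linarith
    · have h2 := hx k hk i ⌊v⌋
      have h3 : u < ⌊v⌋ := Int.floor_lt.1 h
      rw [← hu, abs_of_nonpos (by linarith)] at h2
      rw [abs_of_nonpos (by linarith [Int.floor_le v])]
      linarith [Int.floor_le v]
  have h2 : |x i - z i| ≤ ‖x - z‖ := by simpa using PiLp.norm_apply_le (x - z) i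
  refine le_trans ?_ h2
  have h3 : 2 ^ k * gridCoord a ℓ ω x i - 2 ^ k * gridCoord a ℓ ω z i =
      2 ^ k / (2 * ℓ) * (x i - z i) := by
    simp only [gridCoord]; ring
  rw [h3, abs_mul, abs_of_pos (by positivity)] at h1
  calc 2 * ℓ * (gridGap n * (3 / 4) ^ (j - k) / 2 ^ k)
      = (2 * ℓ / 2 ^ k) * (gridGap n * (3 / 4) ^ (j - k)) := by ring
    _ ≤ (2 * ℓ / 2 ^ k) * (2 ^ k / (2 * ℓ) * |x i - z i|) := by gcongr
    _ = |x i - z i| := by field_simp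

/-- Only the 2^k + 2 integers from the floor of 2^k v on can be approached, each for an interval of
shifts of length 4δ/2^k, and (2^k + 2)/2^k ≤ 3. The bound does not depend on k. -/
theorem volume_near_int_le (k : ℕ) (v : ℝ) {δ : ℝ} (hδ : δ ≤ 1 / 2) :
    volume.restrict (Set.Ico (0 : ℝ) 1) {ω | ∃ z : ℤ, |2 ^ k * (v + ω / 2) - z| < δ} ≤
      ENNReal.ofReal (12 * δ) := by
  set N := ⌊2 ^ k * v⌋ with hN
  have hsub : {ω | ∃ z : ℤ, |2 ^ k * (v + ω / 2) - z| < δ} ∩ Set.Ico (0 : ℝ) 1 ⊆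
      ⋃ l ∈ Finset.range (2 ^ k + 2), Set.Ioo (2 * ((N + l - δ) / 2 ^ k - v))
        (2 * ((N + l + δ) / 2 ^ k - v)) := by
    rintro ω ⟨⟨z, hz⟩, h0, h1⟩
    have hk : (0 : ℝ) < 2 ^ k := by positivity
    rw [abs_lt] at hz
    have hN1 := Int.floor_le (2 ^ k * v)
    have hN2 := Int.lt_floor_add_one (2 ^ k * v)
    rw [← hN] at hN1 hN2
    have hzN : N ≤ z := by
      have : (N : ℝ) < z + 1 := by nlinarith
      exact_mod_cast Int.lt_add_one_iff.1 (by exact_mod_cast this)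
    obtain ⟨l, hl⟩ := Int.eq_ofNat_of_zero_le (sub_nonneg.2 hzN)
    have hlz : (z : ℝ) = N + l := by
      have : z = N + l := by omega
      rw [this]; push_cast; rfl
    have hlt : (l : ℝ) < 2 ^ k + 2 := by nlinarith
    simp only [Set.mem_iUnion, Finset.mem_range]
    refine ⟨l, by exact_mod_cast hlt, ?_, ?_⟩
    · have : (N + l - δ) / 2 ^ k < v + ω / 2 := by
        rw [div_lt_iff₀ hk]; linarith
      linarith
    · have : v + ω / 2 < (N + l + δ) / 2 ^ k := by
        rw [lt_div_iff₀ hk]; linarith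
      linarith
  rw [Measure.restrict_apply' measurableSet_Ico]
  refine (measure_mono hsub).trans ((measure_biUnion_finset_le _ _).trans ?_)
  simp only [Real.volume_Ioo]
  have h1 : ∀ l : ℕ, 2 * ((N + l + δ) / 2 ^ k - v) - 2 * ((N + l - δ) / 2 ^ k - v) =
      4 * δ / 2 ^ k := fun l => by ring
  simp only [h1, Finset.sum_const, Finset.card_range, nsmul_eq_mul]
  have hk1 : (1 : ℝ) ≤ 2 ^ k := one_le_pow₀ (by norm_num)
  rw [← ENNReal.ofReal_natCast, ← ENNReal.ofReal_mul (by positivity)]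
  rcases le_or_gt 0 δ with h | h
  · refine ENNReal.ofReal_le_ofReal ?_
    push_cast
    rw [← mul_div_assoc, div_le_iff₀ (by positivity)]
    nlinarith
  · rw [ENNReal.ofReal_of_nonpos]
    · exact zero_le
    · exact mul_nonpos_of_nonneg_of_nonpos (by positivity)
        (div_nonpos_of_nonpos_of_nonneg (by linarith) (by positivity))

/-- A union bound over generations and coordinates. The tolerance decays like (3/4)^(j-k), so the
sum over k is at most 4 uniformly in j, and the normalisation of `gridGap` makes 12 · 4 · n ·
`gridGap n` at most 48/200. -/
theorem volume_not_isGridGood_le (a : Fin n → ℝ) (ℓ : ℝ) (j : ℕ) (x : RSpace n) :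
    volume.restrict (Set.Ico (0 : ℝ) 1) {ω | ¬ IsGridGood a ℓ ω j x} ≤ 1 / 4 := by
  have hg := gridGap_pos n
  have hg1 : gridGap n ≤ 1 / 2 := by
    unfold gridGap
    rw [div_le_div_iff₀ (by positivity) (by norm_num)]
    have : (0 : ℝ) ≤ n := by positivity
    linarith
  have hsub : {ω | ¬ IsGridGood a ℓ ω j x} ⊆ ⋃ k ∈ Finset.range (j + 1), ⋃ i ∈ Finset.univ,
      {ω | ∃ z : ℤ, |2 ^ k * ((x i - a i) / (2 * ℓ) + ω / 2) - z| <
        gridGap n * (3 / 4) ^ (j - k)} := by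
    intro ω hω
    simp only [IsGridGood, Set.mem_ofPred_eq] at hω
    push Not at hω
    obtain ⟨k, hk, i, z, hz⟩ := hω
    simp only [Set.mem_iUnion, Finset.mem_range]
    exact ⟨k, by omega, i, Finset.mem_univ _, z, hz⟩
  calc _ ≤ _ := measure_mono hsub
    _ ≤ ∑ k ∈ Finset.range (j + 1), ∑ i : Fin n,
        ENNReal.ofReal (12 * (gridGap n * (3 / 4) ^ (j - k))) := by
        refine (measure_biUnion_finset_le _ _).trans (Finset.sum_le_sum fun k _ => ?_)
        refine (measure_biUnion_finset_le _ _).trans (Finset.sum_le_sum fun i _ => ?_)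
        refine volume_near_int_le k _ ?_
        have : (3 / 4 : ℝ) ^ (j - k) ≤ 1 := pow_le_one₀ (by norm_num) (by norm_num)
        nlinarith
    _ = ENNReal.ofReal (∑ k ∈ Finset.range (j + 1),
          n * (12 * (gridGap n * (3 / 4) ^ (j - k)))) := by
        rw [ENNReal.ofReal_sum_of_nonneg fun k _ => by positivity]
        refine Finset.sum_congr rfl fun k _ => ?_
        rw [Finset.sum_const, Finset.card_univ, Fintype.card_fin, nsmul_eq_mul,
          ← ENNReal.ofReal_natCast, ← ENNReal.ofReal_mul (by positivity)]
    _ ≤ ENNReal.ofReal (1 / 4) := by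
        refine ENNReal.ofReal_le_ofReal ?_
        have h1 : ∑ k ∈ Finset.range (j + 1), (3 / 4 : ℝ) ^ (j - k) ≤ 4 := by
          have := Finset.sum_range_reflect (fun k => (3 / 4 : ℝ) ^ k) (j + 1)
          simp only [Nat.add_sub_cancel] at this
          rw [this, geom_sum_eq (by norm_num)]
          have : (0 : ℝ) ≤ (3 / 4) ^ (j + 1) := by positivity
          rw [div_le_iff_of_neg (by norm_num)]
          linarith
        have h2 : n * gridGap n ≤ 1 / 200 := by
          unfold gridGap
          rw [mul_one_div, div_le_div_iff₀ (by positivity) (by norm_num)]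
          linarith
        have h3 : 0 ≤ n * gridGap n := by positivity
        calc _ = 12 * (n * gridGap n) * ∑ k ∈ Finset.range (j + 1), (3 / 4 : ℝ) ^ (j - k) := by
              rw [Finset.mul_sum]; exact Finset.sum_congr rfl fun k _ => by ring
          _ ≤ 12 * (1 / 200) * 4 := by gcongr
          _ ≤ 1 / 4 := by norm_num
    _ = 1 / 4 := by
        rw [ENNReal.ofReal_div_of_pos (by norm_num)]; norm_num

end

/-! ### Kernel estimates -/

theorem lintegral_pi_prod {X : Type*} [MeasurableSpace X] (μ : Measure X) [SigmaFinite μ] {κ : ℕ}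
    (g : Fin κ → X → ℝ≥0∞) (hg : ∀ i, Measurable (g i)) :
    ∫⁻ z, ∏ i, g i (z i) ∂(Measure.pi fun _ => μ) = ∏ i, ∫⁻ x, g i x ∂μ := by
  induction κ with
  | zero => simp
  | succ κ ih =>
    have hm : Measurable fun z : Fin (κ + 1) → X => ∏ i, g i (z i) :=
      Finset.measurable_fun_prod _ fun i _ => (hg i).comp (measurable_pi_apply i)
    rw [← ((measurePreserving_piFinSuccAbove (fun _ : Fin (κ + 1) => μ) 0).symm).lintegral_comp hm]
    simp only [MeasurableEquiv.piFinSuccAbove_symm_apply, Fin.insertNthEquiv_apply,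
      Fin.prod_univ_succ, Fin.insertNth_zero', Fin.cons_zero, Fin.cons_succ]
    rw [← ih (fun i => g i.succ) fun i => hg _]
    exact lintegral_prod_mul (hg 0).aemeasurable
      (Finset.measurable_fun_prod _ fun i _ => (hg _).comp (measurable_pi_apply i)).aemeasurable

section
variable {n κ : ℕ} {m α K t : ℝ} {μ : Measure (RSpace n)}
  {s : ℝ → RSpace n → (Fin κ → RSpace n) → ℂ}

theorem IsLPSKernel.mono (hs : IsLPSKernel m α K s) {K' : ℝ} (hK : K ≤ K') :
    IsLPSKernel m α K' s where
  measurable := hs.measurable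
  size t ht x y := (hs.size t ht x y).trans (by gcongr)
  holder_fst t ht x x' y h := (hs.holder_fst t ht x x' y h).trans (by gcongr)
  holder_snd t ht x y j y' h := (hs.holder_snd t ht x y j y' h).trans (by gcongr)

theorem prod_poissonKer (ht : 0 < t) (y : RSpace n) (z : Fin κ → RSpace n) :
    ∏ l, poissonKer m α t ‖y - z l‖ =
      t ^ ((κ : ℝ) * α) / ∏ l, (t + ‖y - z l‖) ^ (m + α) := by
  simp only [poissonKer, Finset.prod_div_distrib, Finset.prod_const, Finset.card_univ,
    Fintype.card_fin]
  rw [mul_comm, Real.rpow_mul_natCast ht.le]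

theorem IsLPSKernel.enorm_le (hs : IsLPSKernel m α K s) (hK : 0 ≤ K) (ht : 0 < t) (y : RSpace n)
    (z : Fin κ → RSpace n) :
    ‖s t y z‖ₑ ≤ ENNReal.ofReal K * ∏ l, ENNReal.ofReal (poissonKer m α t ‖y - z l‖) := by
  rw [← ENNReal.ofReal_prod_of_nonneg fun l _ => poissonKer_nonneg ht.le (norm_nonneg _),
    ← ENNReal.ofReal_mul hK, ← ofReal_norm, prod_poissonKer ht]
  exact ENNReal.ofReal_le_ofReal (hs.size t ht y z)

theorem IsLPSKernel.enorm_sub_le (hs : IsLPSKernel m α K s) (hK : 0 ≤ K) (ht : 0 < t)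
    (hα : 0 ≤ α) (y : RSpace n) (z : Fin κ → RSpace n) (i : Fin κ) {w : RSpace n} {d : ℝ}
    (hw : ‖z i - w‖ ≤ d) (hd : d < t / 2) :
    ‖s t y z - s t y (Function.update z i w)‖ₑ ≤
      ENNReal.ofReal (K * (d / t) ^ α) * ∏ l, ENNReal.ofReal (poissonKer m α t ‖y - z l‖) := by
  have hd0 : 0 ≤ d := (norm_nonneg _).trans hw
  rw [← ENNReal.ofReal_prod_of_nonneg fun l _ => poissonKer_nonneg ht.le (norm_nonneg _),
    ← ENNReal.ofReal_mul (by positivity), ← ofReal_norm, prod_poissonKer ht]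
  refine ENNReal.ofReal_le_ofReal
    ((hs.holder_snd t ht y z i w (hw.trans_lt hd)).trans ?_)
  have h1 : t ^ (((κ : ℝ) - 1) * α) = t ^ ((κ : ℝ) * α) / t ^ α := by
    rw [← Real.rpow_sub ht]; congr 1; ring
  rw [h1, Real.div_rpow hd0 ht.le, mul_assoc]
  refine mul_le_mul_of_nonneg_left ?_ hK
  have h2 : ‖z i - w‖ ^ α ≤ d ^ α := Real.rpow_le_rpow (norm_nonneg _) hw hα
  calc _ ≤ t ^ ((κ : ℝ) * α) / t ^ α * d ^ α / ∏ l, (t + ‖y - z l‖) ^ (m + α) := by gcongr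
    _ = _ := by ring

theorem IsLPSKernel.measurable_apply (hs : IsLPSKernel m α K s) (t : ℝ) (y : RSpace n) :
    Measurable (s t y) :=
  hs.measurable.comp (measurable_const.prodMk (measurable_const.prodMk measurable_id))

theorem poissonAvg_le_lintegral (hm : 0 ≤ m) (hα : 0 ≤ α) (ht : 0 < t) (h : RSpace n → ℝ≥0∞)
    (y : RSpace n) :
    poissonAvg m α μ t h y ≤ ENNReal.ofReal (t ^ (-m)) * ∫⁻ z, h z ∂μ := by
  rw [← lintegral_const_mul' _ _ (by simp)]
  refine lintegral_mono fun z => mul_le_mul_left (ENNReal.ofReal_le_ofReal ?_) _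
  unfold poissonKer
  rw [div_le_iff₀ (by positivity), Real.rpow_add (by positivity)]
  calc t ^ α = t ^ (-m) * (t ^ m * t ^ α) := by
        rw [Real.rpow_neg ht.le, ← mul_assoc, inv_mul_cancel₀ (by positivity), one_mul]
    _ ≤ _ := by
        have : t ≤ t + ‖y - z‖ := by linarith [norm_nonneg (y - z)]
        gcongr

theorem poissonAvg_enorm_ne_top (hm : 0 ≤ m) (hα : 0 ≤ α) (ht : 0 < t) {f : RSpace n → ℂ}
    (hf : Integrable f μ) (y : RSpace n) :
    poissonAvg m α μ t (fun z => ‖f z‖ₑ) y ≠ ⊤ :=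
  ne_top_of_le_ne_top (ENNReal.mul_ne_top (by simp) hf.2.ne) (poissonAvg_le_lintegral hm hα ht _ y)

theorem lintegral_enorm_mul_prod_le [SigmaFinite μ] {S : (Fin κ → RSpace n) → ℂ} {C : ℝ≥0∞}
    (hC : C ≠ ⊤) {y : RSpace n}
    (hS : ∀ z, ‖S z‖ₑ ≤ C * ∏ l, ENNReal.ofReal (poissonKer m α t ‖y - z l‖))
    {f : Fin κ → RSpace n → ℂ} (hf : ∀ l, Measurable (f l)) :
    ∫⁻ z, ‖S z * ∏ l, f l (z l)‖ₑ ∂(Measure.pi fun _ => μ) ≤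
      C * ∏ l, poissonAvg m α μ t (fun w => ‖f l w‖ₑ) y := by
  unfold poissonAvg
  rw [← lintegral_pi_prod μ (fun l w => ENNReal.ofReal (poissonKer m α t ‖y - w‖) * ‖f l w‖ₑ)
    fun l => (measurable_poissonKer y).mul (hf l).enorm, ← lintegral_const_mul' _ _ hC]
  refine lintegral_mono fun z => ?_
  rw [enorm_mul, Finset.prod_mul_distrib, ← mul_assoc]
  refine mul_le_mul' (hS z) (le_of_eq ?_)
  simp only [enorm_eq_nnnorm, nnnorm_prod]
  push_cast
  rfl

theorem enorm_Theta_le [SigmaFinite μ] (hs : IsLPSKernel m α K s) (hK : 0 ≤ K) (ht : 0 < t)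
    {f : Fin κ → RSpace n → ℂ} (hf : ∀ l, Measurable (f l)) (y : RSpace n) :
    ‖Theta μ s f t y‖ₑ ≤
      ENNReal.ofReal K * ∏ l, poissonAvg m α μ t (fun w => ‖f l w‖ₑ) y :=
  (enorm_integral_le_lintegral_enorm _).trans
    (lintegral_enorm_mul_prod_le (by simp) (hs.enorm_le hK ht y) hf)

theorem integrable_mul_prod [SigmaFinite μ] (hm : 0 ≤ m) (hα : 0 ≤ α) (ht : 0 < t)
    {S : (Fin κ → RSpace n) → ℂ} (hSm : Measurable S) {C : ℝ≥0∞} (hC : C ≠ ⊤) {y : RSpace n}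
    (hS : ∀ z, ‖S z‖ₑ ≤ C * ∏ l, ENNReal.ofReal (poissonKer m α t ‖y - z l‖))
    {f : Fin κ → RSpace n → ℂ} (hf : ∀ l, Measurable (f l)) (hfi : ∀ l, Integrable (f l) μ) :
    Integrable (fun z => S z * ∏ l, f l (z l)) (Measure.pi fun _ => μ) := by
  refine ⟨(hSm.mul (Finset.measurable_fun_prod _ fun l _ =>
    (hf l).comp (measurable_pi_apply l))).aestronglyMeasurable, ?_⟩
  refine (lintegral_enorm_mul_prod_le hC hS hf).trans_lt (ENNReal.mul_ne_top hC ?_).lt_top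
  exact ENNReal.prod_ne_top fun l _ => poissonAvg_enorm_ne_top hm hα ht (hfi l) y

theorem IsLPSKernel.integrable [SigmaFinite μ] (hs : IsLPSKernel m α K s) (hK : 0 ≤ K)
    (hm : 0 ≤ m) (hα : 0 ≤ α) (ht : 0 < t) {f : Fin κ → RSpace n → ℂ}
    (hf : ∀ l, Measurable (f l)) (hfi : ∀ l, Integrable (f l) μ) (y : RSpace n) :
    Integrable (fun z => s t y z * ∏ l, f l (z l)) (Measure.pi fun _ => μ) :=
  integrable_mul_prod hm hα ht (hs.measurable_apply t y) (by simp) (hs.enorm_le hK ht y) hf hfi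

/-! ### Multilinearity -/

theorem prod_update_apply (φ : Fin κ → RSpace n → ℂ) (i : Fin κ) (h : RSpace n → ℂ)
    (z : Fin κ → RSpace n) :
    ∏ l, Function.update φ i h l (z l) = h (z i) * ∏ l ∈ Finset.univ.erase i, φ l (z l) := by
  rw [← Finset.mul_prod_erase Finset.univ _ (Finset.mem_univ i), Function.update_self]
  congr 1
  refine Finset.prod_congr rfl fun l hl => ?_
  rw [Function.update_of_ne (Finset.ne_of_mem_erase hl)]

theorem prod_poissonAvg_update (φ : Fin κ → RSpace n → ℂ) (i : Fin κ) (h : RSpace n → ℂ)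
    (y : RSpace n) :
    ∏ l, poissonAvg m α μ t (fun w => ‖Function.update φ i h l w‖ₑ) y =
      poissonAvg m α μ t (fun w => ‖h w‖ₑ) y *
        ∏ l ∈ Finset.univ.erase i, poissonAvg m α μ t (fun w => ‖φ l w‖ₑ) y := by
  rw [← Finset.mul_prod_erase Finset.univ _ (Finset.mem_univ i), Function.update_self]
  congr 1
  refine Finset.prod_congr rfl fun l hl => ?_
  rw [Function.update_of_ne (Finset.ne_of_mem_erase hl)]

theorem measurable_update_apply {φ : Fin κ → RSpace n → ℂ} (hφ : ∀ l, Measurable (φ l)) {i : Fin κ}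
    {h : RSpace n → ℂ} (hh : Measurable h) (l : Fin κ) : Measurable (Function.update φ i h l) := by
  rcases eq_or_ne l i with rfl | hl
  · rwa [Function.update_self]
  · rw [Function.update_of_ne hl]; exact hφ l

theorem integrable_update_apply {φ : Fin κ → RSpace n → ℂ} (hφ : ∀ l, Integrable (φ l) μ) {i : Fin κ}
    {h : RSpace n → ℂ} (hh : Integrable h μ) (l : Fin κ) :
    Integrable (Function.update φ i h l) μ := by
  rcases eq_or_ne l i with rfl | hl
  · rwa [Function.update_self]
  · rw [Function.update_of_ne hl]; exact hφ l

theorem Theta_update_sum [SigmaFinite μ] (hs : IsLPSKernel m α K s) (hK : 0 ≤ K) (hm : 0 ≤ m)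
    (hα : 0 ≤ α) (ht : 0 < t) {φ : Fin κ → RSpace n → ℂ} (hφ : ∀ l, Measurable (φ l))
    (hφi : ∀ l, Integrable (φ l) μ) (i : Fin κ) {ι : Type*} (I : Finset ι)
    {h : ι → RSpace n → ℂ} (hh : ∀ a ∈ I, Measurable (h a)) (hhi : ∀ a ∈ I, Integrable (h a) μ)
    (y : RSpace n) :
    Theta μ s (Function.update φ i fun w => ∑ a ∈ I, h a w) t y =
      ∑ a ∈ I, Theta μ s (Function.update φ i (h a)) t y := by
  unfold Theta
  rw [← integral_finsetSum I fun a ha => hs.integrable hK hm hα ht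
    (measurable_update_apply hφ (hh a ha)) (integrable_update_apply hφi (hhi a ha)) y]
  refine integral_congr_ae (Filter.Eventually.of_forall fun z => ?_)
  simp only [prod_update_apply, Finset.sum_mul, Finset.mul_sum]

theorem Theta_update_sub [SigmaFinite μ] (hs : IsLPSKernel m α K s) (hK : 0 ≤ K) (hm : 0 ≤ m)
    (hα : 0 ≤ α) (ht : 0 < t) {φ : Fin κ → RSpace n → ℂ} (hφ : ∀ l, Measurable (φ l))
    (hφi : ∀ l, Integrable (φ l) μ) (i : Fin κ) {h h' : RSpace n → ℂ} (hh : Measurable h)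
    (hh' : Measurable h') (hhi : Integrable h μ) (hhi' : Integrable h' μ) (y : RSpace n) :
    Theta μ s (Function.update φ i fun w => h w - h' w) t y =
      Theta μ s (Function.update φ i h) t y - Theta μ s (Function.update φ i h') t y := by
  unfold Theta
  rw [← integral_sub (hs.integrable hK hm hα ht (measurable_update_apply hφ hh)
    (integrable_update_apply hφi hhi) y) (hs.integrable hK hm hα ht (measurable_update_apply hφ hh')
    (integrable_update_apply hφi hhi') y)]
  refine integral_congr_ae (Filter.Eventually.of_forall fun z => ?_)
  simp only [prod_update_apply]
  ring

theorem Theta_const_mul (c : Fin κ → ℂ) (f : Fin κ → RSpace n → ℂ) (y : RSpace n) :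
    Theta μ s (fun l w => c l * f l w) t y = (∏ l, c l) * Theta μ s f t y := by
  unfold Theta
  rw [← integral_const_mul]
  refine integral_congr_ae (Filter.Eventually.of_forall fun z => ?_)
  simp only [Finset.prod_mul_distrib]
  ring

/-- The first `k` functions are taken from `g`, the others from `f`. -/
def hybrid {E : Type*} (f g : Fin κ → E) (k : ℕ) (l : Fin κ) : E := if (l : ℕ) < k then g l else f l

/-- A telescoping sum in which the functions are exchanged one slot at a time: in the i-th
difference the slots before i already hold g and those after i still hold f. -/
theorem Theta_eq_add_sum [SigmaFinite μ] (hs : IsLPSKernel m α K s) (hK : 0 ≤ K) (hm : 0 ≤ m)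
    (hα : 0 ≤ α) (ht : 0 < t) {f g : Fin κ → RSpace n → ℂ} (hf : ∀ l, Measurable (f l))
    (hfi : ∀ l, Integrable (f l) μ) (hg : ∀ l, Measurable (g l)) (hgi : ∀ l, Integrable (g l) μ)
    (y : RSpace n) :
    Theta μ s f t y = Theta μ s g t y +
      ∑ i : Fin κ, Theta μ s (Function.update (hybrid f g i) i fun w => f i w - g i w) t y := by
  have hm' : ∀ k l, Measurable (hybrid f g k l) := fun k l => by
    unfold hybrid; split_ifs; exacts [hg l, hf l]
  have hi' : ∀ k l, Integrable (hybrid f g k l) μ := fun k l => by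
    unfold hybrid; split_ifs; exacts [hgi l, hfi l]
  have h0 : hybrid f g 0 = f := by funext l; simp [hybrid]
  have h1 : hybrid f g κ = g := by funext l; simp [hybrid]
  have h2 := Finset.sum_range_sub' (fun k => Theta μ s (hybrid f g k) t y) κ
  rw [h0, h1, Finset.sum_range] at h2
  rw [← sub_eq_iff_eq_add', ← h2]
  refine Finset.sum_congr rfl fun i _ => ?_
  rw [Theta_update_sub hs hK hm hα ht (hm' i) (hi' i) i (hf i) (hg i) (hfi i) (hgi i)]
  have e1 : Function.update (hybrid f g i) i (f i) = hybrid f g i := by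
    rw [Function.update_eq_self_iff]; simp [hybrid]
  have e2 : Function.update (hybrid f g i) i (g i) = hybrid f g (i + 1) := by
    funext l
    rcases eq_or_ne l i with rfl | hl
    · simp [hybrid]
    · rw [Function.update_of_ne hl]
      have : (l : ℕ) < i ↔ (l : ℕ) < i + 1 := by
        have := Fin.val_ne_of_ne hl
        omega
      simp only [hybrid, this]
  rw [e1, e2]

/-! ### Cancellation -/

/-- A function of the label is measurable for generation k, so it can be pulled out of the
conditional expectation. A non-integrable product has integral 0 by convention, so g need not be
bounded. -/
theorem integral_mul_eq_zero_of_condExp {Q : Set (RSpace n)} (hQ : μ Q ≠ ⊤)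
    {a : Fin n → ℝ} {ℓ ω : ℝ} {k : ℕ} {h : RSpace n → ℂ} (hh : Integrable h μ)
    (hhQ : ∀ x ∉ Q, h x = 0)
    (hc : (μ.restrict Q)[h|gridFiltration a ℓ ω k] =ᵐ[μ.restrict Q] 0) (g : (Fin n → ℤ) → ℂ) :
    ∫ w, g (gridCode a ℓ ω k w) * h w ∂μ = 0 := by
  have : IsFiniteMeasure (μ.restrict Q) := ⟨by simpa using hQ.lt_top⟩
  rw [← setIntegral_eq_integral_of_forall_compl_eq_zero (s := Q) fun x hx => by rw [hhQ x hx, mul_zero]]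
  by_cases hi : Integrable (fun w => g (gridCode a ℓ ω k w) * h w) (μ.restrict Q)
  · have hg : StronglyMeasurable[gridFiltration a ℓ ω k] fun w => g (gridCode a ℓ ω k w) :=
      ((measurable_of_countable g).comp (measurable_gridCode_filtration a ℓ ω k)).stronglyMeasurable
    have h1 := condExp_bilin_of_stronglyMeasurable_left (μ := μ.restrict Q)
      (ContinuousLinearMap.mul ℝ ℂ) hg hi hh.restrict
    simp only [ContinuousLinearMap.mul_apply'] at h1
    rw [← integral_condExp ((gridFiltration a ℓ ω).le k)]
    refine integral_eq_zero_of_ae ?_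
    filter_upwards [h1, hc] with x hx hx'
    rw [hx, hx']; simp
  · exact integral_undef hi

/-- Once the i-th variable is frozen at the centre of its cell, the kernel sees only the label of
that variable. By Fubini integrate this variable first. -/
theorem integral_update_gridCenter_eq_zero [SigmaFinite μ] {Q : Set (RSpace n)} (hQ : μ Q ≠ ⊤)
    {a : Fin n → ℝ} {ℓ ω : ℝ} {k : ℕ} {h : RSpace n → ℂ} (hh : Integrable h μ)
    (hhQ : ∀ x ∉ Q, h x = 0)
    (hc : (μ.restrict Q)[h|gridFiltration a ℓ ω k] =ᵐ[μ.restrict Q] 0)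
    (S : (Fin κ → RSpace n) → ℂ) (φ : Fin κ → RSpace n → ℂ) (i : Fin κ) :
    ∫ z, S (Function.update z i (gridCenter a ℓ ω k (gridCode a ℓ ω k (z i)))) *
      ∏ l, Function.update φ i h l (z l) ∂(Measure.pi fun _ => μ) = 0 := by
  cases κ with
  | zero => exact i.elim0
  | succ κ =>
    rw [← ((measurePreserving_piFinSuccAbove (fun _ : Fin (κ + 1) => μ) i).symm).integral_comp']
    set F := fun p : RSpace n × (Fin κ → RSpace n) =>
      S (Function.update ((MeasurableEquiv.piFinSuccAbove (fun _ => RSpace n) i).symm p) i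
        (gridCenter a ℓ ω k (gridCode a ℓ ω k
          ((MeasurableEquiv.piFinSuccAbove (fun _ => RSpace n) i).symm p i)))) *
      ∏ l, Function.update φ i h l ((MeasurableEquiv.piFinSuccAbove (fun _ => RSpace n) i).symm p l)
      with hF
    by_cases hi : Integrable F (μ.prod (Measure.pi fun _ => μ))
    · refine (integral_prod_symm F hi).trans ?_
      refine integral_eq_zero_of_ae (Filter.Eventually.of_forall fun z => ?_)
      have h1 := integral_mul_eq_zero_of_condExp hQ hh hhQ hc
        fun c => S (i.insertNth (gridCenter a ℓ ω k c) z)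
      have h2 : ∀ w, F (w, z) = (S (i.insertNth (gridCenter a ℓ ω k (gridCode a ℓ ω k w)) z) * h w) *
          ∏ l, φ (i.succAbove l) (z l) := by
        intro w
        simp only [hF, MeasurableEquiv.piFinSuccAbove_symm_apply, Fin.insertNthEquiv_apply,
          Fin.prod_univ_succAbove _ i, Fin.insertNth_apply_same, Fin.insertNth_apply_succAbove,
          Function.update_self]
        rw [mul_assoc]
        congr 2
        · funext l
          refine Fin.succAboveCases i ?_ (fun l => ?_) l
          · simp
          · simp
        · refine Finset.prod_congr rfl fun (l : Fin κ) _ => ?_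
          rw [Function.update_of_ne (Fin.succAbove_ne i l)]
      simp only [h2, Pi.zero_apply]
      rw [integral_mul_const, h1, zero_mul]
    · exact integral_undef hi

/-- Subtracting the kernel frozen at the cell centre changes nothing, because h has mean zero on
cells, and Hölder continuity bounds the difference. If the cells are too large compared with t for
that, the factor 2 makes the base of the power at least 1, and the size condition is enough. -/
theorem enorm_Theta_update_le_of_condExp [SigmaFinite μ] (hs : IsLPSKernel m α K s) (hK : 0 ≤ K)
    (hm : 0 ≤ m) (hα : 0 < α) (ht : 0 < t) {Q : Set (RSpace n)} (hQ : μ Q ≠ ⊤)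
    {a : Fin n → ℝ} {ℓ ω : ℝ} (hℓ : 0 < ℓ) {k : ℕ} {φ : Fin κ → RSpace n → ℂ}
    (hφ : ∀ l, Measurable (φ l)) (hφi : ∀ l, Integrable (φ l) μ) (i : Fin κ) {h : RSpace n → ℂ}
    (hh : Measurable h) (hhi : Integrable h μ) (hhQ : ∀ x ∉ Q, h x = 0)
    (hc : (μ.restrict Q)[h|gridFiltration a ℓ ω k] =ᵐ[μ.restrict Q] 0) (y : RSpace n) :
    ‖Theta μ s (Function.update φ i h) t y‖ₑ ≤
      ENNReal.ofReal (K * (2 * (√n * (ℓ / 2 ^ k)) / t) ^ α) *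
        (poissonAvg m α μ t (fun w => ‖h w‖ₑ) y *
          ∏ l ∈ Finset.univ.erase i, poissonAvg m α μ t (fun w => ‖φ l w‖ₑ) y) := by
  have hd0 : 0 ≤ √n * (ℓ / 2 ^ k) := by positivity
  rw [← prod_poissonAvg_update]
  have hψ := measurable_update_apply (i := i) hφ hh
  have hψi := integrable_update_apply (i := i) hφi hhi
  rcases lt_or_ge (√n * (ℓ / 2 ^ k)) (t / 2) with hd | hd
  · set T : (Fin κ → RSpace n) → ℂ := fun z => s t y (Function.update z i
      (gridCenter a ℓ ω k (gridCode a ℓ ω k (z i)))) with hT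
    have hTm : Measurable T := by
      refine (hs.measurable_apply t y).comp (measurable_pi_lambda _ fun l => ?_)
      rcases eq_or_ne l i with rfl | hl
      · simp only [Function.update_self]
        exact (measurable_of_countable (gridCenter a ℓ ω k)).comp
          ((measurable_gridCode a ℓ ω k).comp (measurable_pi_apply l))
      · simp only [Function.update_of_ne hl]
        exact measurable_pi_apply l
    have hST : ∀ z, ‖s t y z - T z‖ₑ ≤ ENNReal.ofReal (K * (√n * (ℓ / 2 ^ k) / t) ^ α) *
        ∏ l, ENNReal.ofReal (poissonKer m α t ‖y - z l‖) := fun z =>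
      hs.enorm_sub_le hK ht hα.le y z i (norm_sub_gridCenter_le hℓ k (z i)) hd
    have hi1 := hs.integrable hK hm hα.le ht hψ hψi y
    have hi2 := integrable_mul_prod hm hα.le ht ((hs.measurable_apply t y).sub hTm) (by simp) hST
      hψ hψi
    have e : Theta μ s (Function.update φ i h) t y = ∫ z, (s t y z - T z) *
        ∏ l, Function.update φ i h l (z l) ∂(Measure.pi fun _ => μ) := by
      have h0 : ∫ z, T z * ∏ l, Function.update φ i h l (z l) ∂(Measure.pi fun _ => μ) = 0 :=
        integral_update_gridCenter_eq_zero hQ hhi hhQ hc (s t y) φ i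
      have hi3 : Integrable (fun z => T z * ∏ l, Function.update φ i h l (z l))
          (Measure.pi fun _ => μ) := by
        refine (hi1.sub hi2).congr (Filter.Eventually.of_forall fun z => ?_)
        simp only [Pi.sub_apply]
        ring
      simp only [sub_mul]
      rw [integral_sub hi1 hi3, h0, sub_zero, Theta]
    rw [e]
    refine (enorm_integral_le_lintegral_enorm _).trans
      ((lintegral_enorm_mul_prod_le (by simp) hST hψ).trans ?_)
    refine mul_le_mul_left (ENNReal.ofReal_le_ofReal ?_) _
    exact mul_le_mul_of_nonneg_left (Real.rpow_le_rpow (by positivity)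
      (div_le_div_of_nonneg_right (by linarith) ht.le) hα.le) hK
  · refine (enorm_Theta_le hs hK ht hψ y).trans ?_
    refine mul_le_mul_left (ENNReal.ofReal_le_ofReal ?_) _
    refine le_mul_of_one_le_right hK (Real.one_le_rpow ?_ hα.le)
    rw [le_div_iff₀ ht]
    linarith

end

/-! ### One cancellative slot, seen from a good point -/

section
variable {n κ : ℕ} {m α b ε K A t ℓ ω : ℝ} {μ : Measure (RSpace n)}
  {s : ℝ → RSpace n → (Fin κ → RSpace n) → ℂ} {Q : Set (RSpace n)} {a : Fin n → ℝ}

/-- Telescope from generation 0, where both values agree. Whenever a generation puts x and z into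
the same cell the accumulated difference is 0, so only increments across a separation have to be
counted. -/
theorem enorm_condExp_sub_le_sum (hℓ : 0 < ℓ) (hω : ω ∈ Set.Ico (0 : ℝ) 1)
    (hQa : ∀ x ∈ Q, ∀ i, x i ∈ Set.Icc (a i) (a i + ℓ)) (f : RSpace n → ℂ) {x z : RSpace n}
    (hx : x ∈ Q) (hz : z ∈ Q) (j : ℕ) :
    ‖((μ.restrict Q)[f|gridFiltration a ℓ ω j]) z - ((μ.restrict Q)[f|gridFiltration a ℓ ω j]) x‖ₑ ≤
      ∑ k ∈ Finset.range j, if gridCode a ℓ ω (k + 1) z = gridCode a ℓ ω (k + 1) x then 0 else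
        (increment μ Q (gridFiltration a ℓ ω) f k z +
          increment μ Q (gridFiltration a ℓ ω) f k x) := by
  have hE : ∀ k, gridCode a ℓ ω k z = gridCode a ℓ ω k x →
      ((μ.restrict Q)[f|gridFiltration a ℓ ω k]) z =
        ((μ.restrict Q)[f|gridFiltration a ℓ ω k]) x := fun k h =>
    eq_of_gridCode_eq stronglyMeasurable_condExp.measurable h
  induction j with
  | zero =>
    rw [hE 0 (by rw [gridCode_zero hℓ hω (hQa z hz), gridCode_zero hℓ hω (hQa x hx)])]
    simp
  | succ j ih =>
    by_cases h : gridCode a ℓ ω (j + 1) z = gridCode a ℓ ω (j + 1) x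
    · rw [hE _ h]; simp
    · rw [Finset.sum_range_succ, if_neg h, increment_of_mem hz, increment_of_mem hx]
      set E := fun k => (μ.restrict Q)[f|gridFiltration a ℓ ω k]
      have e : E (j + 1) z - E (j + 1) x =
          (E j z - E j x) + ((E (j + 1) z - E j z) - (E (j + 1) x - E j x)) := by ring
      refine (congrArg enorm e).le.trans ((enorm_add_le _ _).trans (add_le_add ih ?_))
      exact enorm_sub_le

/-- Growth of order ε is paid for by lowering the decay from α to b. -/
theorem poissonKer_mul_rpow_le (ht : 0 < t) (hb : b + ε ≤ α) {r : ℝ} (hr : 0 ≤ r) :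
    poissonKer m α t r * (1 + r / t) ^ ε ≤ poissonKer m b t r := by
  have h0 : 0 < t + r := by positivity
  have e1 : 1 + r / t = (t + r) / t := by field_simp
  unfold poissonKer
  rw [e1, Real.rpow_add h0, Real.rpow_add h0, Real.div_rpow h0.le ht.le]
  have h1 : t ^ α / t ^ ε ≤ (t + r) ^ α / (t + r) ^ ε * (t ^ b / (t + r) ^ b) := by
    rw [← Real.rpow_sub ht, ← Real.rpow_sub h0, ← Real.div_rpow ht.le h0.le]
    have h2 : t ^ (α - ε) = (t + r) ^ (α - ε) * (t / (t + r)) ^ (α - ε) := by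
      rw [← Real.mul_rpow h0.le (by positivity), mul_div_cancel₀ _ h0.ne']
    rw [h2]
    refine mul_le_mul_of_nonneg_left ?_ (by positivity)
    refine Real.rpow_le_rpow_of_exponent_ge (by positivity) ?_ (by linarith)
    rw [div_le_one h0]; linarith
  calc t ^ α / ((t + r) ^ m * (t + r) ^ α) * ((t + r) ^ ε / t ^ ε)
      = (t ^ α / t ^ ε) * ((t + r) ^ ε / ((t + r) ^ m * (t + r) ^ α)) := by ring
    _ ≤ (t + r) ^ α / (t + r) ^ ε * (t ^ b / (t + r) ^ b) *
          ((t + r) ^ ε / ((t + r) ^ m * (t + r) ^ α)) := by gcongr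
    _ = _ := by field_simp

theorem poissonKer_le_of_le (ht : 0 < t) (hb : b ≤ α) {r : ℝ} (hr : 0 ≤ r) :
    poissonKer m α t r ≤ poissonKer m b t r := by
  simpa using poissonKer_mul_rpow_le (m := m) (ε := 0) ht (by linarith) hr

theorem poissonAvg_le_of_le (ht : 0 < t) (hb : b ≤ α) (h : RSpace n → ℝ≥0∞) (y : RSpace n) :
    poissonAvg m α μ t h y ≤ poissonAvg m b μ t h y :=
  lintegral_mono fun _ => mul_le_mul_left
    (ENNReal.ofReal_le_ofReal (poissonKer_le_of_le ht hb (norm_nonneg _))) _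

/-- The rate of decay in the distance of two generations. -/
noncomputable def gridRate (ε : ℝ) : ℝ≥0∞ := ENNReal.ofReal ((2 / 3) ^ ε)

theorem gridRate_lt_one (hε : 0 < ε) : gridRate ε < 1 := by
  unfold gridRate
  rw [ENNReal.ofReal_lt_one]
  exact Real.rpow_lt_one (by norm_num) (by norm_num) hε

/-- With i = j - k - 1, goodness puts z at distance at least a multiple of (3/4)^i ℓ 2^(-(k+1)),
while t is at most 2 ℓ 2^(-j). The ratio grows like (3/2)^i, which is why the tolerance shrinks by
3/4 and not by 1/2 or less, and the triangle inequality bounds it by (1 + |x - y|/t)(1 + |y - z|/t).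
The factor 3/2 in the constant makes up for the step from j - k to i. -/
theorem one_le_of_isGridGood (hℓ : 0 < ℓ) {j : ℕ} (ht : 0 < t) (htj : t ≤ 2 * (ℓ / 2 ^ j))
    (hε : 0 ≤ ε) {x y z : RSpace n} (hx : IsGridGood a ℓ ω j x) {k : ℕ} (hk : k < j)
    (hne : gridCode a ℓ ω (k + 1) z ≠ gridCode a ℓ ω (k + 1) x) :
    1 ≤ (3 / (2 * gridGap n)) ^ ε * ((2 / 3) ^ ε) ^ (j - k) * (1 + ‖x - y‖ / t) ^ ε *
      (1 + ‖y - z‖ / t) ^ ε := by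
  have hg := gridGap_pos n
  obtain ⟨i, rfl⟩ : ∃ i, j = k + 1 + i := ⟨j - (k + 1), by omega⟩
  have h1 := hx.le_norm_sub hℓ (by omega) hne
  rw [show k + 1 + i - (k + 1) = i by omega] at h1
  rw [show k + 1 + i - k = i + 1 by omega, ← Real.rpow_mul_natCast (by norm_num), mul_comm ε,
    Real.rpow_mul (by norm_num), Real.rpow_natCast, ← Real.mul_rpow (by positivity) (by positivity),
    ← Real.mul_rpow (by positivity) (by positivity), ← Real.mul_rpow (by positivity) (by positivity)]
  refine Real.one_le_rpow ?_ hε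
  set U := ‖x - y‖ / t with hU
  set V := ‖y - z‖ / t with hV
  have hU0 : 0 ≤ U := by positivity
  have hV0 : 0 ≤ V := by positivity
  have h2 : ‖x - z‖ ≤ t * ((1 + U) * (1 + V)) := by
    have h3 : ‖x - z‖ ≤ ‖x - y‖ + ‖y - z‖ := norm_sub_le_norm_sub_add_norm_sub x y z
    have h4 : ‖x - y‖ = t * U := by rw [hU]; field_simp
    have h5 : ‖y - z‖ = t * V := by rw [hV]; field_simp
    rw [h4, h5] at h3
    refine h3.trans ?_
    have : 0 ≤ t * (1 + U * V) := by positivity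
    nlinarith
  have h6 : 2 * ℓ * (gridGap n * (3 / 4) ^ i / 2 ^ (k + 1)) ≤
      2 * (ℓ / 2 ^ (k + 1 + i)) * ((1 + U) * (1 + V)) :=
    h1.trans (h2.trans (by gcongr))
  have h7 : (3 / 4 : ℝ) ^ i * 2 ^ i = (3 / 2) ^ i := by rw [← mul_pow]; norm_num
  have h8 : gridGap n * (3 / 2) ^ i ≤ (1 + U) * (1 + V) := by
    have h9 : 0 < 2 ^ (k + 1 + i) / (2 * ℓ) := by positivity
    have := mul_le_mul_of_nonneg_left h6 h9.le
    refine le_trans (le_of_eq ?_) (this.trans (le_of_eq ?_))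
    · rw [← h7]; field_simp; ring
    · field_simp
  have h9 : (3 / (2 * gridGap n)) * (2 / 3) ^ (i + 1) * (gridGap n * (3 / 2) ^ i) = 1 := by
    have : (2 / 3 : ℝ) ^ i * (3 / 2) ^ i = 1 := by rw [← mul_pow]; norm_num
    calc _ = ((2 / 3 : ℝ) ^ i * (3 / 2) ^ i) * (gridGap n / gridGap n) := by ring
      _ = 1 := by rw [this, div_self hg.ne', one_mul]
  calc (1 : ℝ) = (3 / (2 * gridGap n)) * (2 / 3) ^ (i + 1) * (gridGap n * (3 / 2) ^ i) := h9.symm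
    _ ≤ (3 / (2 * gridGap n)) * (2 / 3) ^ (i + 1) * ((1 + U) * (1 + V)) := by gcongr
    _ = _ := by ring

/-- The sum over the scales which controls a cancellative slot. -/
noncomputable def scaleSum (m b ε : ℝ) (μ : Measure (RSpace n)) (t : ℝ)
    (D : ℕ → RSpace n → ℝ≥0∞) (j : ℕ) (x y : RSpace n) : ℝ≥0∞ :=
  ∑' k, geomWeight (gridRate ε) j k * (poissonAvg m b μ t (D k) y + D k x)

/-- Each separating generation is multiplied by the quantity of `one_le_of_isGridGood`. Its power of
1 + |y - z|/t is absorbed by the kernel, the geometric factor becomes the weight, and the power of 1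
+ |x - y|/t stays for the outer weight. -/
theorem poissonAvg_condExp_sub_le [SFinite μ] (hm : 0 < m) (hb0 : 0 < b) (hμ : IsPowerBounded m A μ)
    (hℓ : 0 < ℓ) (hω : ω ∈ Set.Ico (0 : ℝ) 1) (hQ : MeasurableSet Q)
    (hQa : ∀ x ∈ Q, ∀ i, x i ∈ Set.Icc (a i) (a i + ℓ)) {j : ℕ} (ht : 0 < t)
    (htj : t ≤ 2 * (ℓ / 2 ^ j)) (hε : 0 ≤ ε) (hb : b + ε ≤ α) (f : RSpace n → ℂ) {x : RSpace n}
    (hxQ : x ∈ Q) (hx : IsGridGood a ℓ ω j x) (y : RSpace n) :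
    poissonAvg m α μ t (fun z => ‖Q.indicator (fun z =>
      ((μ.restrict Q)[f|gridFiltration a ℓ ω j]) z -
        ((μ.restrict Q)[f|gridFiltration a ℓ ω j]) x) z‖ₑ) y ≤
      ENNReal.ofReal ((3 / (2 * gridGap n)) ^ ε) * (1 + poissonConst m b * ENNReal.ofReal A) *
        ENNReal.ofReal ((1 + ‖x - y‖ / t) ^ ε) *
        scaleSum m b ε μ t (increment μ Q (gridFiltration a ℓ ω) f) j x y := by
  have hg := gridGap_pos n
  set D := increment μ Q (gridFiltration a ℓ ω) f with hD
  have hDm : ∀ k, Measurable (D k) := measurable_increment μ hQ _ f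
  set c := ENNReal.ofReal ((3 / (2 * gridGap n)) ^ ε) with hc
  set U := ENNReal.ofReal ((1 + ‖x - y‖ / t) ^ ε) with hU
  have h1 : ∀ z, ENNReal.ofReal (poissonKer m α t ‖y - z‖) * ‖Q.indicator (fun z =>
      ((μ.restrict Q)[f|gridFiltration a ℓ ω j]) z -
        ((μ.restrict Q)[f|gridFiltration a ℓ ω j]) x) z‖ₑ ≤
      ∑ k ∈ Finset.range j, (c * U * geomWeight (gridRate ε) j k) *
        (ENNReal.ofReal (poissonKer m b t ‖y - z‖) * (D k z + D k x * 1)) := by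
    intro z
    by_cases hz : z ∈ Q
    · rw [Set.indicator_of_mem hz]
      refine (mul_le_mul_right (enorm_condExp_sub_le_sum hℓ hω hQa f hxQ hz j) _).trans ?_
      rw [Finset.mul_sum]
      refine Finset.sum_le_sum fun k hk => ?_
      have hkj := Finset.mem_range.1 hk
      split_ifs with h
      · simp
      · rw [mul_one, ← mul_assoc]
        refine mul_le_mul_left ?_ _
        have h2 := one_le_of_isGridGood (y := y) hℓ ht htj hε hx hkj h
        have hgw : geomWeight (gridRate ε) j k = ENNReal.ofReal (((2 / 3) ^ ε) ^ (j - k)) := by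
          unfold geomWeight gridRate
          rw [show j - k + (k - j) = j - k by omega, ENNReal.ofReal_pow (by positivity)]
        rw [hgw, hc, hU, ← ENNReal.ofReal_mul (by positivity), ← ENNReal.ofReal_mul (by positivity),
          ← ENNReal.ofReal_mul (by positivity)]
        refine ENNReal.ofReal_le_ofReal ?_
        have h3 := poissonKer_mul_rpow_le (m := m) ht hb (norm_nonneg (y - z))
        have h4 : 0 ≤ poissonKer m α t ‖y - z‖ := poissonKer_nonneg ht.le (norm_nonneg _)
        calc poissonKer m α t ‖y - z‖ ≤ poissonKer m α t ‖y - z‖ * _ := le_mul_of_one_le_right h4 h2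
          _ = (3 / (2 * gridGap n)) ^ ε * (1 + ‖x - y‖ / t) ^ ε * ((2 / 3) ^ ε) ^ (j - k) *
              (poissonKer m α t ‖y - z‖ * (1 + ‖y - z‖ / t) ^ ε) := by ring
          _ ≤ _ := by gcongr
    · simp [hz]
  have hcU : ∀ k, c * U * geomWeight (gridRate ε) j k ≠ ⊤ := fun k => by
    rw [hc, hU, geomWeight, gridRate]; finiteness
  have hDx : ∀ k, D k x ≠ ⊤ := fun k => by rw [hD, increment_of_mem hxQ]; simp
  calc _ ≤ ∫⁻ z, ∑ k ∈ Finset.range j, (c * U * geomWeight (gridRate ε) j k) *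
        (ENNReal.ofReal (poissonKer m b t ‖y - z‖) * (D k z + D k x * 1)) ∂μ := lintegral_mono h1
    _ = ∑ k ∈ Finset.range j, (c * U * geomWeight (gridRate ε) j k) *
        (poissonAvg m b μ t (D k) y + D k x * poissonAvg m b μ t (fun _ => 1) y) := by
        have hmeas : ∀ k, Measurable fun z => (c * U * geomWeight (gridRate ε) j k) *
            (ENNReal.ofReal (poissonKer m b t ‖y - z‖) * (D k z + D k x * 1)) := fun k =>
          ((measurable_poissonKer y).mul ((hDm k).add_const _)).const_mul _
        rw [lintegral_finsetSum _ fun k _ => hmeas k]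
        refine Finset.sum_congr rfl fun k _ => ?_
        rw [lintegral_const_mul' _ _ (hcU k), ← poissonAvg_const_mul (hDx k),
          ← poissonAvg_add (hDm k)]
        rfl
    _ ≤ ∑ k ∈ Finset.range j, (c * U * geomWeight (gridRate ε) j k) *
        ((1 + poissonConst m b * ENNReal.ofReal A) * (poissonAvg m b μ t (D k) y + D k x)) := by
        refine Finset.sum_le_sum fun k _ => mul_le_mul_right ?_ _
        rw [add_mul, one_mul, mul_add, add_assoc]
        refine add_le_add le_rfl ?_
        rw [mul_comm (D k x)]
        refine (mul_le_mul_left (poissonAvg_one_le hm hb0 ht hμ y) _).trans ?_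
        exact le_add_self.trans le_add_self
    _ = c * (1 + poissonConst m b * ENNReal.ofReal A) * U * ∑ k ∈ Finset.range j,
        geomWeight (gridRate ε) j k * (poissonAvg m b μ t (D k) y + D k x) := by
        rw [Finset.mul_sum]
        exact Finset.sum_congr rfl fun k _ => by ring
    _ ≤ _ := mul_le_mul_right (ENNReal.sum_le_tsum _) _

theorem condExp_indicator_sub_eq_zero [IsFiniteMeasure (μ.restrict Q)] (hQ : MeasurableSet Q)
    {f : RSpace n → ℂ} {k : ℕ} {g : RSpace n → ℂ}
    (hg : (μ.restrict Q)[g|gridFiltration a ℓ ω k] =ᵐ[μ.restrict Q]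
      (μ.restrict Q)[f|gridFiltration a ℓ ω k]) (hgi : Integrable g (μ.restrict Q)) :
    (μ.restrict Q)[(Q.indicator fun z => g z - ((μ.restrict Q)[f|gridFiltration a ℓ ω k]) z) |
      gridFiltration a ℓ ω k] =ᵐ[μ.restrict Q] 0 := by
  have h1 : (Q.indicator fun z => g z - ((μ.restrict Q)[f|gridFiltration a ℓ ω k]) z)
      =ᵐ[μ.restrict Q] g - (μ.restrict Q)[f|gridFiltration a ℓ ω k] := by
    filter_upwards [ae_restrict_mem hQ] with z hz
    rw [Set.indicator_of_mem hz]; rfl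
  refine (condExp_congr_ae h1).trans ((condExp_sub hgi integrable_condExp _).trans ?_)
  have h2 : (μ.restrict Q)[(μ.restrict Q)[f|gridFiltration a ℓ ω k]|gridFiltration a ℓ ω k] =
      (μ.restrict Q)[f|gridFiltration a ℓ ω k] :=
    condExp_of_stronglyMeasurable ((gridFiltration a ℓ ω).le k) stronglyMeasurable_condExp
      integrable_condExp
  filter_upwards [hg] with z hz
  simp only [Pi.sub_apply, h2, hz, sub_self, Pi.zero_apply]

theorem Theta_update_add [SigmaFinite μ] (hs : IsLPSKernel m α K s) (hK : 0 ≤ K) (hm : 0 ≤ m)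
    (hα : 0 ≤ α) (ht : 0 < t) {φ : Fin κ → RSpace n → ℂ} (hφ : ∀ l, Measurable (φ l))
    (hφi : ∀ l, Integrable (φ l) μ) (i : Fin κ) {h h' : RSpace n → ℂ} (hh : Measurable h)
    (hh' : Measurable h') (hhi : Integrable h μ) (hhi' : Integrable h' μ) (y : RSpace n) :
    Theta μ s (Function.update φ i fun w => h w + h' w) t y =
      Theta μ s (Function.update φ i h) t y + Theta μ s (Function.update φ i h') t y := by
  have := Theta_update_sub hs hK hm hα ht hφ hφi i (h := fun w => h w + h' w) (hh.add hh') hh'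
    (hhi.add hhi') hhi' y
  simp only [add_sub_cancel_right] at this
  rw [this, sub_add_cancel]

/-- The constant in the bound for a cancellative slot. -/
noncomputable def slotConst (n : ℕ) (m α b ε A K : ℝ) : ℝ≥0∞ :=
  ENNReal.ofReal K * (ENNReal.ofReal ((3 / (2 * gridGap n)) ^ ε) *
    (1 + poissonConst m b * ENNReal.ofReal A)) + ENNReal.ofReal (K * (2 * √n) ^ α)

theorem slotConst_ne_top : slotConst n m α b ε A K ≠ ⊤ := by
  unfold slotConst; finiteness

/-- The three pieces of a cancellative slot: coarse oscillation around x, fine increments, and a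
tail that is removed in the limit. -/
theorem indicator_sub_eq_sum {E : ℕ → RSpace n → ℂ} {f : RSpace n → ℂ} (hf : ∀ x ∉ Q, f x = 0)
    (c : ℂ) {j N : ℕ} (hjN : j ≤ N) (w : RSpace n) :
    f w - c * Q.indicator 1 w = Q.indicator (fun z => E j z - c) w +
      (∑ k ∈ Finset.Ico j N, Q.indicator (fun z => E (k + 1) z - E k z) w +
        Q.indicator (fun z => f z - E N z) w) := by
  by_cases hw : w ∈ Q
  · simp only [Set.indicator_of_mem hw, Pi.one_apply]
    rw [Finset.sum_Ico_sub (fun k => E k w) hjN]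
    ring
  · simp [hw, hf w hw]

/-- The gain 2^(-α) per generation is at least as good as the rate (2/3)^ε imposed by the coarse
generations, so one geometric weight serves both. -/
theorem cancel_factor_le (hK : 0 ≤ K) (hα : 0 < α) (hε : ε ≤ α) (hℓ : 0 < ℓ)
    {j : ℕ} (htj : ℓ / 2 ^ j ≤ t) {k : ℕ} (hk : j ≤ k) :
    ENNReal.ofReal (K * (2 * (√n * (ℓ / 2 ^ k)) / t) ^ α) ≤
      ENNReal.ofReal (K * (2 * √n) ^ α) * geomWeight (gridRate ε) j k := by
  obtain ⟨i, rfl⟩ := Nat.exists_eq_add_of_le hk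
  have ht : 0 < t := lt_of_lt_of_le (by positivity) htj
  unfold geomWeight gridRate
  rw [show j - (j + i) + (j + i - j) = i by omega, ← ENNReal.ofReal_pow (by positivity),
    ← ENNReal.ofReal_mul (by positivity), mul_assoc]
  refine ENNReal.ofReal_le_ofReal (mul_le_mul_of_nonneg_left ?_ hK)
  calc (2 * (√n * (ℓ / 2 ^ (j + i))) / t) ^ α ≤ (2 * √n * (1 / 2) ^ i) ^ α := by
        refine Real.rpow_le_rpow (by positivity) ?_ hα.le
        rw [div_le_iff₀ ht]
        calc 2 * (√n * (ℓ / 2 ^ (j + i))) = 2 * √n * (1 / 2) ^ i * (ℓ / 2 ^ j) := by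
              rw [pow_add, one_div, inv_pow]; field_simp
          _ ≤ _ := by gcongr
    _ = (2 * √n) ^ α * ((1 / 2) ^ α) ^ i := by
        rw [Real.mul_rpow (by positivity) (by positivity), ← Real.rpow_mul_natCast (by norm_num),
          mul_comm α, Real.rpow_mul (by norm_num), Real.rpow_natCast]
    _ ≤ (2 * √n) ^ α * ((2 / 3) ^ ε) ^ i := by
        gcongr
        calc (1 / 2 : ℝ) ^ α ≤ (2 / 3) ^ α := Real.rpow_le_rpow (by norm_num) (by norm_num) hα.le
          _ ≤ (2 / 3) ^ ε := Real.rpow_le_rpow_of_exponent_ge (by norm_num) (by norm_num) hε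

/-- The bound for a cancellative slot. -/
theorem enorm_Theta_slot_le [SigmaFinite μ] (hs : IsLPSKernel m α K s) (hK : 0 ≤ K)
    (hm : 0 < m) (hb0 : 0 < b) (hε : 0 < ε) (hb : b + ε ≤ α) (hμ : IsPowerBounded m A μ)
    (hℓ : 0 < ℓ) (hω : ω ∈ Set.Ico (0 : ℝ) 1) (hQ : MeasurableSet Q) (hQt : μ Q ≠ ⊤)
    (hQa : ∀ x ∈ Q, ∀ i, x i ∈ Set.Icc (a i) (a i + ℓ)) {j : ℕ} (htj' : ℓ / 2 ^ j ≤ t)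
    (htj : t ≤ 2 * (ℓ / 2 ^ j)) {φ : Fin κ → RSpace n → ℂ}
    (hφ : ∀ l, Measurable (φ l)) (hφi : ∀ l, Integrable (φ l) μ) (i : Fin κ)
    {f : RSpace n → ℂ} (hf : Measurable f) (hfi : Integrable f μ) (hfQ : ∀ x ∉ Q, f x = 0)
    {x : RSpace n} (hxQ : x ∈ Q) (hx : IsGridGood a ℓ ω j x) (y : RSpace n) :
    ‖Theta μ s (Function.update φ i fun w =>
      f w - ((μ.restrict Q)[f|gridFiltration a ℓ ω j]) x * Q.indicator 1 w) t y‖ₑ ≤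
      slotConst n m α b ε A K * ENNReal.ofReal ((1 + ‖x - y‖ / t) ^ ε) *
        scaleSum m b ε μ t (increment μ Q (gridFiltration a ℓ ω) f) j x y *
        ∏ l ∈ Finset.univ.erase i, poissonAvg m α μ t (fun w => ‖φ l w‖ₑ) y := by
  have hα : 0 < α := by linarith
  have ht : 0 < t := lt_of_lt_of_le (by positivity) htj'
  have : IsFiniteMeasure (μ.restrict Q) := ⟨by simpa using hQt.lt_top⟩
  set ℱ := gridFiltration a ℓ ω with hℱ
  set ν := μ.restrict Q with hν
  set E : ℕ → RSpace n → ℂ := fun k => ν[f|ℱ k] with hE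
  have hEm : ∀ k, Measurable (E k) := measurable_condExp_filtration ν ℱ f
  have hEi : ∀ k, Integrable (E k) ν := fun k => integrable_condExp
  set D := increment μ Q ℱ f with hD
  set W := ∏ l ∈ Finset.univ.erase i, poissonAvg m α μ t (fun w => ‖φ l w‖ₑ) y with hW
  have hWt : W ≠ ⊤ := ENNReal.prod_ne_top fun l _ => poissonAvg_enorm_ne_top hm.le hα.le ht (hφi l) y
  set U := ENNReal.ofReal ((1 + ‖x - y‖ / t) ^ ε) with hU
  have hU1 : 1 ≤ U := by
    rw [hU, ← ENNReal.ofReal_one]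
    refine ENNReal.ofReal_le_ofReal (Real.one_le_rpow ?_ hε.le)
    have : 0 ≤ ‖x - y‖ / t := by positivity
    linarith
  set S := scaleSum m b ε μ t D j x y with hS
  have hind : ∀ {g : RSpace n → ℂ}, Integrable g ν → Integrable (Q.indicator g) μ := fun hg =>
    IntegrableOn.integrable_indicator hg hQ
  have hoff : ∀ {g : RSpace n → ℂ}, ∀ z ∉ Q, Q.indicator g z = 0 := fun z hz =>
    Set.indicator_of_notMem hz _
  set h₁ : RSpace n → ℂ := Q.indicator fun z => E j z - E j x with hh₁
  set hΔ : ℕ → RSpace n → ℂ := fun k => Q.indicator fun z => E (k + 1) z - E k z with hhΔ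
  set hN : ℕ → RSpace n → ℂ := fun N => Q.indicator fun z => f z - E N z with hhN
  have m1 : Measurable h₁ := ((hEm j).sub_const _).indicator hQ
  have i1 : Integrable h₁ μ := hind ((hEi j).sub (integrable_const _))
  have mΔ : ∀ k, Measurable (hΔ k) := fun k => ((hEm (k + 1)).sub (hEm k)).indicator hQ
  have iΔ : ∀ k, Integrable (hΔ k) μ := fun k => hind ((hEi (k + 1)).sub (hEi k))
  have mN : ∀ k, Measurable (hN k) := fun k => (hf.sub (hEm k)).indicator hQ
  have iN : ∀ k, Integrable (hN k) μ := fun k => hind (hfi.restrict.sub (hEi k))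
  -- the three bounds
  have b1 : ‖Theta μ s (Function.update φ i h₁) t y‖ₑ ≤
      ENNReal.ofReal K * (ENNReal.ofReal ((3 / (2 * gridGap n)) ^ ε) *
        (1 + poissonConst m b * ENNReal.ofReal A)) * U * S * W := by
    refine (enorm_Theta_le hs hK ht (measurable_update_apply hφ m1) y).trans ?_
    rw [prod_poissonAvg_update, ← mul_assoc]
    refine mul_le_mul_left ?_ _
    rw [mul_assoc, mul_assoc]
    refine mul_le_mul_right ?_ _
    rw [← mul_assoc]
    exact poissonAvg_condExp_sub_le hm hb0 hμ hℓ hω hQ hQa ht htj hε.le hb f hxQ hx y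
  have b2 : ∀ k, j ≤ k → ‖Theta μ s (Function.update φ i (hΔ k)) t y‖ₑ ≤
      ENNReal.ofReal (K * (2 * √n) ^ α) * W *
        (geomWeight (gridRate ε) j k * (poissonAvg m b μ t (D k) y + D k x)) := by
    intro k hk
    have hc : ν[hΔ k|ℱ k] =ᵐ[ν] 0 := condExp_indicator_sub_eq_zero hQ
      (condExp_condExp_of_le (ℱ.mono (Nat.le_succ k)) (ℱ.le _)) (hEi (k + 1))
    refine (enorm_Theta_update_le_of_condExp hs hK hm.le hα ht hQt hℓ hφ hφi i (mΔ k) (iΔ k)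
      hoff hc y).trans ?_
    have e : (fun w => ‖hΔ k w‖ₑ) = D k := by
      funext w
      by_cases hw : w ∈ Q
      · simp only [hhΔ, hD, increment, Set.indicator_of_mem hw]; rfl
      · simp [hhΔ, hD, increment, hw]
    rw [e]
    calc _ ≤ (ENNReal.ofReal (K * (2 * √n) ^ α) * geomWeight (gridRate ε) j k) *
          ((poissonAvg m b μ t (D k) y + D k x) * W) := by
          refine mul_le_mul' (cancel_factor_le hK hα (by linarith) hℓ htj' hk) ?_
          refine mul_le_mul_left ?_ _
          exact (poissonAvg_le_of_le ht (by linarith) _ y).trans le_self_add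
      _ = _ := by ring
  -- Convergence of E_N f to f is not needed. The tail has mean zero on cells of generation N, which
  -- gives a factor tending to 0 in front of a crude finite L¹ bound.
  have b3 : ∀ N, j ≤ N → ‖Theta μ s (Function.update φ i (hN N)) t y‖ₑ ≤
      (ENNReal.ofReal (K * (2 * √n) ^ α) *
        (ENNReal.ofReal (t ^ (-m)) * (2 * ∫⁻ z, ‖f z‖ₑ ∂ν)) * W) * gridRate ε ^ (N - j) := by
    intro N hN'
    have hc : ν[hN N|ℱ N] =ᵐ[ν] 0 :=
      condExp_indicator_sub_eq_zero hQ (ae_eq_refl _) hfi.restrict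
    refine (enorm_Theta_update_le_of_condExp hs hK hm.le hα ht hQt hℓ hφ hφi i (mN N) (iN N)
      hoff hc y).trans ?_
    have e : geomWeight (gridRate ε) j N = gridRate ε ^ (N - j) := by
      unfold geomWeight; congr 1; omega
    have h1 : poissonAvg m α μ t (fun w => ‖hN N w‖ₑ) y ≤
        ENNReal.ofReal (t ^ (-m)) * (2 * ∫⁻ z, ‖f z‖ₑ ∂ν) := by
      refine (poissonAvg_le_lintegral hm.le hα.le ht _ y).trans (mul_le_mul_right ?_ _)
      have h2 : ∫⁻ z, ‖hN N z‖ₑ ∂μ = ∫⁻ z, ‖f z - E N z‖ₑ ∂ν := by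
        rw [hν, ← lintegral_indicator hQ]
        refine lintegral_congr fun z => ?_
        by_cases hz : z ∈ Q <;> simp [hhN, hz]
      rw [h2]
      calc _ ≤ ∫⁻ z, ‖f z‖ₑ + ‖E N z‖ₑ ∂ν := lintegral_mono fun z => enorm_sub_le
        _ = ∫⁻ z, ‖f z‖ₑ ∂ν + ∫⁻ z, ‖E N z‖ₑ ∂ν := lintegral_add_left hf.enorm _
        _ ≤ _ := by
          rw [two_mul]
          refine add_le_add le_rfl ?_
          have := setLIntegral_enorm_condExp_le (m := ℱ N) (ν := ν) hfi.restrict (s := Set.univ) .univ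
          simpa using this
    calc _ ≤ (ENNReal.ofReal (K * (2 * √n) ^ α) * gridRate ε ^ (N - j)) *
          ((ENNReal.ofReal (t ^ (-m)) * (2 * ∫⁻ z, ‖f z‖ₑ ∂ν)) * W) := by
          refine mul_le_mul' (e ▸ cancel_factor_le hK hα (by linarith) hℓ htj' hN') ?_
          exact mul_le_mul_left h1 _
      _ = _ := by ring
  set R := ENNReal.ofReal (K * (2 * √n) ^ α) *
        (ENNReal.ofReal (t ^ (-m)) * (2 * ∫⁻ z, ‖f z‖ₑ ∂ν)) * W with hR
  have hRt : R ≠ ⊤ := by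
    have : ∫⁻ z, ‖f z‖ₑ ∂ν ≠ ⊤ := hfi.restrict.2.ne
    finiteness
  have hmain : ∀ N, j ≤ N → ‖Theta μ s (Function.update φ i fun w =>
      f w - E j x * Q.indicator 1 w) t y‖ₑ ≤
      slotConst n m α b ε A K * U * S * W + R * gridRate ε ^ (N - j) := by
    intro N hjN
    have e : (fun w => f w - E j x * Q.indicator 1 w) = fun w =>
        h₁ w + ((fun w => ∑ k ∈ Finset.Ico j N, hΔ k w) w + hN N w) := by
      funext w
      exact indicator_sub_eq_sum hfQ (E j x) hjN w
    have mS : Measurable fun w => ∑ k ∈ Finset.Ico j N, hΔ k w :=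
      Finset.measurable_fun_sum _ fun k _ => mΔ k
    have iS : Integrable (fun w => ∑ k ∈ Finset.Ico j N, hΔ k w) μ :=
      integrable_finsetSum _ fun k _ => iΔ k
    rw [e, Theta_update_add hs hK hm.le hα.le ht hφ hφi i m1
      (h' := fun w => (fun w => ∑ k ∈ Finset.Ico j N, hΔ k w) w + hN N w)
      (mS.add (mN N)) i1 (iS.add (iN N)),
      Theta_update_add hs hK hm.le hα.le ht hφ hφi i mS (mN N) iS (iN N),
      Theta_update_sum hs hK hm.le hα.le ht hφ hφi i _ (fun k _ => mΔ k) (fun k _ => iΔ k)]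
    refine (enorm_add_le _ _).trans ?_
    refine (add_le_add b1 ((enorm_add_le _ _).trans
      (add_le_add ((enorm_sum_le _ _).trans (Finset.sum_le_sum fun k hk =>
        b2 k (Finset.mem_Ico.1 hk).1)) (b3 N hjN)))).trans ?_
    rw [← add_assoc]
    refine add_le_add ?_ le_rfl
    rw [← Finset.mul_sum, slotConst, add_mul, add_mul, add_mul]
    refine add_le_add le_rfl ?_
    calc _ ≤ ENNReal.ofReal (K * (2 * √n) ^ α) * W * S :=
          mul_le_mul_right (ENNReal.sum_le_tsum _) _
      _ = ENNReal.ofReal (K * (2 * √n) ^ α) * 1 * S * W := by ring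
      _ ≤ _ := by gcongr
  have hlim : Filter.Tendsto (fun i : ℕ => slotConst n m α b ε A K * U * S * W +
      R * gridRate ε ^ i) Filter.atTop (nhds (slotConst n m α b ε A K * U * S * W + R * 0)) :=
    tendsto_const_nhds.add (ENNReal.Tendsto.const_mul
      (ENNReal.tendsto_pow_atTop_nhds_zero_of_lt_one (gridRate_lt_one hε)) (Or.inr hRt))
  rw [mul_zero, add_zero] at hlim
  refine ge_of_tendsto' hlim fun i => ?_
  have := hmain (j + i) (Nat.le_add_right j i)
  rwa [Nat.add_sub_cancel_left] at this

end

/-! ### The local part of the square function at good points -/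

theorem ENNReal.add_sq_le (a b : ℝ≥0∞) : (a + b) ^ 2 ≤ 2 * (a ^ 2 + b ^ 2) := by
  have := ENNReal.rpow_add_le_mul_rpow_add_rpow a b one_le_two
  norm_num at this
  exact this

theorem ENNReal.sum_sq_le {ι : Type*} [Fintype ι] (b : ι → ℝ≥0∞) :
    (∑ i, b i) ^ 2 ≤ Fintype.card ι * ∑ i, b i ^ 2 := by
  have := ENNReal.tsum_mul_rpow_le (fun _ : ι => (1 : ℝ≥0∞)) b _root_.one_lt_two
  norm_num [tsum_fintype] at this
  exact this

/-- The weight in the definition of the square function. -/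
noncomputable def starWeight {n : ℕ} (m lam t : ℝ) (x y : RSpace n) : ℝ≥0∞ :=
  ENNReal.ofReal ((t / (t + ‖x - y‖)) ^ (m * lam) / t ^ (m + 1))

/-- The part of the square of `gStarLocal` which comes from the scales between `ℓ / 2 ^ (j + 1)`
and `ℓ / 2 ^ j`. -/
noncomputable def scalePart {n κ : ℕ} (ℓ m lam : ℝ) (μ : Measure (RSpace n))
    (s : ℝ → RSpace n → (Fin κ → RSpace n) → ℂ) (f : Fin κ → RSpace n → ℂ) (j : ℕ)
    (x : RSpace n) : ℝ≥0∞ :=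
  ∫⁻ t in Set.Ico (ℓ / 2 ^ (j + 1)) (ℓ / 2 ^ j),
    ∫⁻ y, starWeight m lam t x y * ‖Theta μ s f t y‖ₑ ^ 2 ∂μ

/-- A common majorant of the averages of `f` over balls and over the cells of the grid. -/
noncomputable def slotMax {n : ℕ} (m : ℝ) (μ : Measure (RSpace n)) (Q : Set (RSpace n))
    (ℱ : Filtration ℕ (inferInstance : MeasurableSpace (RSpace n))) (f : RSpace n → ℂ)
    (x : RSpace n) : ℝ≥0∞ :=
  maxFn m μ (fun z => ‖f z‖ₑ) x + procMax (fun k => (μ.restrict Q)[f|ℱ k]) x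

section
variable {n κ : ℕ} {m lam α b ε K A t ℓ ω : ℝ} {μ : Measure (RSpace n)}
  {s : ℝ → RSpace n → (Fin κ → RSpace n) → ℂ} {Q : Set (RSpace n)} {a : Fin n → ℝ}

theorem measurable_Theta [SigmaFinite μ] (hs : IsLPSKernel m α K s) {f : Fin κ → RSpace n → ℂ}
    (hf : ∀ l, Measurable (f l)) :
    Measurable fun q : ℝ × RSpace n => Theta μ s f q.1 q.2 := by
  have h1 : Measurable fun p : (ℝ × RSpace n) × (Fin κ → RSpace n) =>
      s p.1.1 p.1.2 p.2 * ∏ l, f l (p.2 l) := by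
    refine Measurable.mul ?_ (Finset.measurable_fun_prod _ fun l _ => (hf l).comp (by fun_prop))
    exact hs.measurable.comp (f := fun p : (ℝ × RSpace n) × (Fin κ → RSpace n) =>
      (p.1.1, p.1.2, p.2)) (by fun_prop)
  exact (h1.stronglyMeasurable.integral_prod_right'
    (ν := Measure.pi fun _ : Fin κ => μ)).measurable

theorem measurable_starWeight :
    Measurable fun q : (RSpace n × ℝ) × RSpace n => starWeight m lam q.1.2 q.1.1 q.2 := by
  unfold starWeight; fun_prop

theorem measurable_lintegral_starWeight [SigmaFinite μ] (hs : IsLPSKernel m α K s)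
    {f : Fin κ → RSpace n → ℂ} (hf : ∀ l, Measurable (f l)) :
    Measurable fun q : RSpace n × ℝ =>
      ∫⁻ y, starWeight m lam q.2 q.1 y * ‖Theta μ s f q.2 y‖ₑ ^ 2 ∂μ := by
  have h1 : Measurable fun q : (RSpace n × ℝ) × RSpace n => Theta μ s f q.1.2 q.2 :=
    (measurable_Theta hs hf).comp (f := fun q : (RSpace n × ℝ) × RSpace n => (q.1.2, q.2))
      (by fun_prop)
  exact (measurable_starWeight.mul (h1.enorm.pow_const 2)).lintegral_prod_right'

theorem measurable_scalePart [SigmaFinite μ] (hs : IsLPSKernel m α K s)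
    {f : Fin κ → RSpace n → ℂ} (hf : ∀ l, Measurable (f l)) (j : ℕ) :
    Measurable (scalePart ℓ m lam μ s f j) :=
  (measurable_lintegral_starWeight hs hf).lintegral_prod_right'

theorem measurable_gStarOn [SigmaFinite μ] (hs : IsLPSKernel m α K s) (T : Set ℝ)
    {f : Fin κ → RSpace n → ℂ} (hf : ∀ l, Measurable (f l)) :
    Measurable (gStarOn T m lam μ s f) :=
  (measurable_lintegral_starWeight (lam := lam) hs hf).lintegral_prod_right'.pow_const _

theorem iUnion_dyadic_Ico (hℓ : 0 < ℓ) :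
    ⋃ j : ℕ, Set.Ico (ℓ / 2 ^ (j + 1)) (ℓ / 2 ^ j) = Set.Ioo 0 ℓ := by
  ext t
  simp only [Set.mem_iUnion, Set.mem_Ico, Set.mem_Ioo]
  constructor
  · rintro ⟨j, h1, h2⟩
    exact ⟨lt_of_lt_of_le (by positivity) h1,
      h2.trans_le (div_le_self hℓ.le (one_le_pow₀ one_le_two))⟩
  · rintro ⟨h0, h1⟩
    have h2 : 1 < ℓ / t := by rwa [lt_div_iff₀ h0, one_mul]
    have hex : ∃ j : ℕ, ℓ / t ≤ 2 ^ (j + 1) := by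
      obtain ⟨j, hj⟩ := pow_unbounded_of_one_lt (ℓ / t) one_lt_two
      exact ⟨j, hj.le.trans (pow_le_pow_right₀ one_le_two (Nat.le_succ j))⟩
    classical
    refine ⟨Nat.find hex, ?_, ?_⟩
    · have := Nat.find_spec hex
      rw [div_le_iff₀ h0] at this
      rw [div_le_iff₀ (by positivity)]
      linarith
    · rw [lt_div_iff₀ (by positivity)]
      rcases Nat.eq_zero_or_pos (Nat.find hex) with h | h
      · rw [h]; linarith
      · have := Nat.find_min hex (Nat.sub_one_lt h.ne')
        rw [Nat.sub_add_cancel h, not_le, lt_div_iff₀ h0] at this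
        linarith

theorem gStarLocal_sq (hℓ : 0 < ℓ) (f : Fin κ → RSpace n → ℂ) (x : RSpace n) :
    gStarLocal ℓ m lam μ s f x ^ 2 = ∑' j, scalePart ℓ m lam μ s f j x := by
  have hdisj : Pairwise (Function.onFun Disjoint
      fun j : ℕ => Set.Ico (ℓ / 2 ^ (j + 1)) (ℓ / 2 ^ j)) := by
    have key : ∀ i j : ℕ, i < j → Disjoint (Set.Ico (ℓ / 2 ^ (i + 1)) (ℓ / 2 ^ i))
        (Set.Ico (ℓ / 2 ^ (j + 1)) (ℓ / 2 ^ j)) := fun i j hij => by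
      refine Set.disjoint_left.2 fun t h1 h2 => ?_
      have : ℓ / 2 ^ j ≤ ℓ / 2 ^ (i + 1) :=
        div_le_div_of_nonneg_left hℓ.le (by positivity) (pow_le_pow_right₀ one_le_two hij)
      exact absurd (h2.2.trans_le this) (not_lt.2 h1.1)
    intro i j hij
    rcases lt_or_gt_of_ne hij with h | h
    · exact key i j h
    · exact (key j i h).symm
  unfold gStarLocal gStarOn
  rw [← ENNReal.rpow_natCast, ← ENNReal.rpow_mul, ← iUnion_dyadic_Ico hℓ,
    lintegral_iUnion (fun j => measurableSet_Ico) hdisj]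
  norm_num
  rfl

theorem one_le_ofReal_rpow (ht : 0 < t) {c : ℝ} (hc : 0 ≤ c) (x y : RSpace n) :
    1 ≤ ENNReal.ofReal ((1 + ‖x - y‖ / t) ^ c) := by
  rw [← ENNReal.ofReal_one]
  refine ENNReal.ofReal_le_ofReal (Real.one_le_rpow ?_ hc)
  have : 0 ≤ ‖x - y‖ / t := by positivity
  linarith

/-- A slot without cancellation holds either f_l or its conditional expectation at x times an
indicator; `slotMax` at x covers both, and recentring from y to x costs (1 + |x - y|/t)^m. -/
theorem poissonAvg_hybrid_le (hm : 0 < m) (hα : 0 < α) (ht : 0 < t) (hμ : IsPowerBounded m A μ)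
    {ℱ : Filtration ℕ (inferInstance : MeasurableSpace (RSpace n))}
    {f : Fin κ → RSpace n → ℂ} (hf : ∀ l, Measurable (f l)) (i j : ℕ) (l : Fin κ)
    (x y : RSpace n) :
    poissonAvg m α μ t (fun w => ‖hybrid f (fun l w =>
      ((μ.restrict Q)[f l|ℱ j]) x * Q.indicator 1 w) i l w‖ₑ) y ≤
      poissonConst m α * (1 + ENNReal.ofReal A) * ENNReal.ofReal ((1 + ‖x - y‖ / t) ^ m) *
        slotMax m μ Q ℱ (f l) x := by
  have hU := one_le_ofReal_rpow ht hm.le x y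
  set U := ENNReal.ofReal ((1 + ‖x - y‖ / t) ^ m)
  unfold hybrid
  split_ifs with h
  · set c := ((μ.restrict Q)[f l|ℱ j]) x with hc
    calc _ ≤ poissonAvg m α μ t (fun _ => ‖c‖ₑ * 1) y := by
          refine poissonAvg_mono (fun w => ?_) y
          rw [enorm_mul]
          refine mul_le_mul_right ?_ _
          by_cases hw : w ∈ Q <;> simp [hw]
      _ ≤ ‖c‖ₑ * (poissonConst m α * ENNReal.ofReal A) := by
          rw [poissonAvg_const_mul (by simp)]
          exact mul_le_mul_right (poissonAvg_one_le hm hα ht hμ y) _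
      _ ≤ slotMax m μ Q ℱ (f l) x * (poissonConst m α * (1 + ENNReal.ofReal A) * U) := by
          refine mul_le_mul' ((le_iSup (fun k => ‖((μ.restrict Q)[f l|ℱ k]) x‖ₑ) j).trans
            le_add_self) ?_
          refine le_trans ?_ (le_mul_of_one_le_right' hU)
          exact mul_le_mul_right le_add_self _
      _ = _ := mul_comm _ _
  · refine (poissonAvg_le_maxFn hm hα ht (hf l).enorm x y).trans ?_
    refine mul_le_mul' (mul_le_mul_left ?_ _) le_self_add
    exact le_mul_of_one_le_right' le_self_add

/-- The constant in the bound for `Theta` at good points. -/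
noncomputable def goodConst (n κ : ℕ) (m α b ε A K : ℝ) : ℝ≥0∞ :=
  slotConst n m α b ε A K * (poissonConst m α * (1 + ENNReal.ofReal A)) ^ (κ - 1)

theorem goodConst_ne_top : goodConst n κ m α b ε A K ≠ ⊤ := by
  have := slotConst_ne_top (n := n) (m := m) (α := α) (b := b) (ε := ε) (A := A) (K := K)
  unfold goodConst; finiteness

/-- The comparison functions are E_j f_l(x) 1_Q, with x fixed and y arbitrary: the constants factor
out of the main term and leave Θ of the indicators, which is what the testing hypothesis controls.
-/
theorem enorm_Theta_le_of_isGridGood [SigmaFinite μ] (hs : IsLPSKernel m α K s) (hK : 0 ≤ K)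
    (hm : 0 < m) (hb0 : 0 < b) (hε : 0 < ε) (hb : b + ε ≤ α) (hμ : IsPowerBounded m A μ)
    (hℓ : 0 < ℓ) (hω : ω ∈ Set.Ico (0 : ℝ) 1) (hQ : MeasurableSet Q) (hQt : μ Q ≠ ⊤)
    (hQa : ∀ x ∈ Q, ∀ i, x i ∈ Set.Icc (a i) (a i + ℓ)) {j : ℕ} (htj' : ℓ / 2 ^ j ≤ t)
    (htj : t ≤ 2 * (ℓ / 2 ^ j)) {f : Fin κ → RSpace n → ℂ} (hf : ∀ l, Measurable (f l))
    (hfi : ∀ l, Integrable (f l) μ) (hfQ : ∀ l, ∀ x ∉ Q, f l x = 0)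
    {x : RSpace n} (hxQ : x ∈ Q) (hx : IsGridGood a ℓ ω j x) (y : RSpace n) :
    ‖Theta μ s f t y‖ₑ ≤
      (∏ l, slotMax m μ Q (gridFiltration a ℓ ω) (f l) x) *
        ‖Theta μ s (fun _ => Q.indicator fun _ => (1 : ℂ)) t y‖ₑ +
      ∑ i, goodConst n κ m α b ε A K *
        (∏ l ∈ Finset.univ.erase i, slotMax m μ Q (gridFiltration a ℓ ω) (f l) x) *
        (ENNReal.ofReal ((1 + ‖x - y‖ / t) ^ (ε + m * (κ - 1 : ℕ))) *
        scaleSum m b ε μ t (increment μ Q (gridFiltration a ℓ ω) (f i)) j x y) := by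
  have hα : 0 < α := by linarith
  have ht : 0 < t := lt_of_lt_of_le (by positivity) htj'
  set ℱ := gridFiltration a ℓ ω with hℱ
  set c : Fin κ → ℂ := fun l => ((μ.restrict Q)[f l|ℱ j]) x with hc
  set g : Fin κ → RSpace n → ℂ := fun l w => c l * Q.indicator 1 w with hg
  have h1m : Measurable (Q.indicator (1 : RSpace n → ℂ)) := measurable_one.indicator hQ
  have h1i : Integrable (Q.indicator (1 : RSpace n → ℂ)) μ :=
    (integrable_indicator_iff hQ).2 (integrableOn_const hQt)
  have hgm : ∀ l, Measurable (g l) := fun l => h1m.const_mul _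
  have hgi : ∀ l, Integrable (g l) μ := fun l => h1i.const_mul _
  rw [Theta_eq_add_sum hs hK hm.le hα.le ht hf hfi hgm hgi y]
  refine (enorm_add_le _ _).trans (add_le_add ?_ ((enorm_sum_le _ _).trans
    (Finset.sum_le_sum fun i _ => ?_)))
  · rw [hg, Theta_const_mul, enorm_mul]
    refine mul_le_mul' ?_ (le_of_eq rfl)
    rw [enorm_eq_nnnorm, nnnorm_prod]
    push_cast
    exact Finset.prod_le_prod' fun l _ =>
      (le_iSup (fun k => ‖((μ.restrict Q)[f l|ℱ k]) x‖ₑ) j).trans le_add_self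
  · have hhm : ∀ l, Measurable (hybrid f g i l) := fun l => by
      unfold hybrid; split_ifs; exacts [hgm l, hf l]
    have hhi : ∀ l, Integrable (hybrid f g i l) μ := fun l => by
      unfold hybrid; split_ifs; exacts [hgi l, hfi l]
    refine (enorm_Theta_slot_le hs hK hm hb0 hε hb hμ hℓ hω hQ hQt hQa htj' htj hhm hhi i (hf i)
      (hfi i) (hfQ i) hxQ hx y).trans ?_
    set S := scaleSum m b ε μ t (increment μ Q ℱ (f i)) j x y
    have hW : ∏ l ∈ Finset.univ.erase i, poissonAvg m α μ t (fun w => ‖hybrid f g i l w‖ₑ) y ≤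
        (poissonConst m α * (1 + ENNReal.ofReal A)) ^ (κ - 1) *
        ENNReal.ofReal ((1 + ‖x - y‖ / t) ^ m) ^ (κ - 1) *
        ∏ l ∈ Finset.univ.erase i, slotMax m μ Q ℱ (f l) x := by
      refine (Finset.prod_le_prod' fun l _ =>
        poissonAvg_hybrid_le hm hα ht hμ hf i j l x y).trans (le_of_eq ?_)
      rw [Finset.prod_mul_distrib, Finset.prod_const, Finset.card_erase_of_mem (Finset.mem_univ i),
        Finset.card_univ, Fintype.card_fin, mul_pow]
    have hUU : ENNReal.ofReal ((1 + ‖x - y‖ / t) ^ (ε + m * (κ - 1 : ℕ))) =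
        ENNReal.ofReal ((1 + ‖x - y‖ / t) ^ ε) *
          ENNReal.ofReal ((1 + ‖x - y‖ / t) ^ m) ^ (κ - 1) := by
      have h0 : 0 < 1 + ‖x - y‖ / t := by positivity
      rw [← ENNReal.ofReal_pow (by positivity), ← ENNReal.ofReal_mul (by positivity),
        Real.rpow_add h0, Real.rpow_mul_natCast h0.le]
    refine (mul_le_mul_right hW _).trans (le_of_eq ?_)
    rw [hUU, goodConst]
    ring

end

/-! ### From pointwise bounds for Θ to the square function at a good point -/

section
variable {n κ : ℕ} {m lam α b ε K A t t' ℓ ω : ℝ} {μ : Measure (RSpace n)}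
  {s : ℝ → RSpace n → (Fin κ → RSpace n) → ℂ} {Q : Set (RSpace n)} {a : Fin n → ℝ}

theorem sqAvg_weight_le (hm : 0 < m) (ht : 0 < t) {r : ℝ} (hr : 0 ≤ r) :
    t ^ (-m) * (1 + r / t) ^ (-(2 * m + b)) ≤ poissonKer m b t r := by
  have h0 : 0 < t + r := by positivity
  have e1 : 1 + r / t = (t + r) / t := by field_simp
  have h1 : (1 + r / t) ^ (-(2 * m + b)) ≤ (1 + r / t) ^ (-(m + b)) := by
    refine Real.rpow_le_rpow_of_exponent_le ?_ (by linarith)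
    have : 0 ≤ r / t := by positivity
    linarith
  calc _ ≤ t ^ (-m) * (1 + r / t) ^ (-(m + b)) := by gcongr
    _ = poissonKer m b t r := by
      rw [e1, Real.div_rpow h0.le ht.le, Real.rpow_neg h0.le (m + b), poissonKer, Real.rpow_neg ht.le,
        Real.rpow_neg ht.le, Real.rpow_add ht]
      field_simp

theorem lintegral_sqAvg_weight_le (hm : 0 < m) (hb : 0 < b) (ht : 0 < t) (hμ : IsPowerBounded m A μ)
    (x : RSpace n) :
    ∫⁻ y, ENNReal.ofReal (t ^ (-m) * (1 + ‖x - y‖ / t) ^ (-(2 * m + b))) ∂μ ≤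
      poissonConst m b * ENNReal.ofReal A := by
  refine le_trans (lintegral_mono fun y => ?_) (poissonAvg_one_le hm hb ht hμ x)
  rw [mul_one]
  exact ENNReal.ofReal_le_ofReal (sqAvg_weight_le hm ht (norm_nonneg _))

/-- Lets all t within a factor 2 share one dyadic scale, so that the square function runs over a
discrete set of scales. -/
theorem sqAvg_le_of_le (hm : 0 < m) (hb : 0 < b) (ht' : 0 < t') (h1 : t' ≤ t) (h2 : t ≤ 2 * t')
    (h : RSpace n → ℝ≥0∞) (x : RSpace n) :
    sqAvg m b μ t h x ≤ ENNReal.ofReal (2 ^ (2 * m + b)) * ENNReal.ofReal (2 ^ b) ^ 2 *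
      sqAvg m b μ t' h x := by
  have ht : 0 < t := ht'.trans_le h1
  have hP : ∀ y, poissonAvg m b μ t h y ≤ ENNReal.ofReal (2 ^ b) * poissonAvg m b μ t' h y := by
    intro y
    unfold poissonAvg
    rw [← lintegral_const_mul' _ _ (by simp)]
    refine lintegral_mono fun z => ?_
    rw [← mul_assoc, ← ENNReal.ofReal_mul (by positivity)]
    refine mul_le_mul_left (ENNReal.ofReal_le_ofReal ?_) _
    have h3 : t ^ b ≤ 2 ^ b * t' ^ b := by
      rw [← Real.mul_rpow (by norm_num) ht'.le]
      exact Real.rpow_le_rpow ht.le h2 hb.le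
    unfold poissonKer
    rw [← mul_div_assoc]
    have := norm_nonneg (y - z)
    gcongr
  unfold sqAvg
  rw [← lintegral_const_mul' _ _ (by finiteness)]
  refine lintegral_mono fun y => ?_
  have hw : ENNReal.ofReal (t ^ (-m) * (1 + ‖x - y‖ / t) ^ (-(2 * m + b))) ≤
      ENNReal.ofReal (2 ^ (2 * m + b)) *
        ENNReal.ofReal (t' ^ (-m) * (1 + ‖x - y‖ / t') ^ (-(2 * m + b))) := by
    rw [← ENNReal.ofReal_mul (by positivity)]
    refine ENNReal.ofReal_le_ofReal ?_
    have h3 : t ^ (-m) ≤ t' ^ (-m) := Real.rpow_le_rpow_of_nonpos ht' h1 (by linarith)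
    have h4 : (1 + ‖x - y‖ / t) ^ (-(2 * m + b)) ≤
        2 ^ (2 * m + b) * (1 + ‖x - y‖ / t') ^ (-(2 * m + b)) := by
      have h5 : (1 + ‖x - y‖ / t') / 2 ≤ 1 + ‖x - y‖ / t := by
        have h6 : ‖x - y‖ / (2 * t') ≤ ‖x - y‖ / t :=
          div_le_div_of_nonneg_left (norm_nonneg _) ht h2
        rw [div_mul_eq_div_div_swap] at h6
        linarith
      refine (Real.rpow_le_rpow_of_nonpos (by positivity) h5 (by linarith)).trans (le_of_eq ?_)
      rw [Real.div_rpow (by positivity) (by norm_num), Real.rpow_neg (by norm_num : (0 : ℝ) ≤ 2)]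
      field_simp
    calc _ ≤ t' ^ (-m) * (2 ^ (2 * m + b) * (1 + ‖x - y‖ / t') ^ (-(2 * m + b))) := by gcongr
      _ = _ := by ring
  calc _ ≤ (ENNReal.ofReal (2 ^ (2 * m + b)) *
        ENNReal.ofReal (t' ^ (-m) * (1 + ‖x - y‖ / t') ^ (-(2 * m + b)))) *
        (ENNReal.ofReal (2 ^ b) * poissonAvg m b μ t' h y) ^ 2 := by
        gcongr
        exact hP y
    _ = _ := by ring

/-- The constant in `lintegral_scaleSum_sq_le`. -/
noncomputable def scaleConst (m b ε A : ℝ) : ℝ≥0∞ :=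
  2 * (1 - gridRate ε)⁻¹ * 2 * (1 + poissonConst m b * ENNReal.ofReal A)

theorem scaleConst_ne_top (hε : 0 < ε) : scaleConst m b ε A ≠ ⊤ := by
  have : (1 - gridRate ε)⁻¹ ≠ ⊤ := ENNReal.inv_ne_top.2 (tsub_pos_of_lt (gridRate_lt_one hε)).ne'
  unfold scaleConst; finiteness

/-- Cauchy–Schwarz in k with the summable geometric weight, then integration of each term in y. -/
theorem lintegral_scaleSum_sq_le [SFinite μ] (hm : 0 < m) (hb : 0 < b) (ht : 0 < t)
    (hμ : IsPowerBounded m A μ) {D : ℕ → RSpace n → ℝ≥0∞} (hD : ∀ k, Measurable (D k)) (j : ℕ)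
    (x : RSpace n) :
    ∫⁻ y, ENNReal.ofReal (t ^ (-m) * (1 + ‖x - y‖ / t) ^ (-(2 * m + b))) *
      scaleSum m b ε μ t D j x y ^ 2 ∂μ ≤ scaleConst m b ε A *
        ∑' k, geomWeight (gridRate ε) j k * (sqAvg m b μ t (D k) x + D k x ^ 2) := by
  set V : RSpace n → ℝ≥0∞ :=
    fun y => ENNReal.ofReal (t ^ (-m) * (1 + ‖x - y‖ / t) ^ (-(2 * m + b))) with hV
  have hVm : Measurable V := by rw [hV]; fun_prop
  have hPm : ∀ k, Measurable (poissonAvg m b μ t (D k)) := fun k => measurable_poissonAvg (hD k)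
  set G := 2 * (1 - gridRate ε)⁻¹ with hG
  have h1 : ∀ y, scaleSum m b ε μ t D j x y ^ 2 ≤
      G * 2 * ∑' k, geomWeight (gridRate ε) j k * (poissonAvg m b μ t (D k) y ^ 2 + D k x ^ 2) := by
    intro y
    have h2 := ENNReal.tsum_mul_rpow_le (fun k => geomWeight (gridRate ε) j k)
      (fun k => poissonAvg m b μ t (D k) y + D k x) one_lt_two
    norm_num at h2
    refine h2.trans ?_
    rw [mul_assoc, ← ENNReal.tsum_mul_left (a := 2)]
    refine mul_le_mul' ?_ (ENNReal.tsum_le_tsum fun k => ?_)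
    · simp only [geomWeight_comm _ j]
      exact tsum_geomWeight_le _ j
    · rw [mul_left_comm]
      exact mul_le_mul_right (ENNReal.add_sq_le _ _) _
  have hkm : ∀ k, Measurable fun y => geomWeight (gridRate ε) j k *
      (V y * poissonAvg m b μ t (D k) y ^ 2 + V y * D k x ^ 2) := fun k =>
    ((hVm.mul ((hPm k).pow_const 2)).add (hVm.mul_const _)).const_mul _
  have hm1 : ∀ k, Measurable fun y => V y * poissonAvg m b μ t (D k) y ^ 2 := fun k =>
    hVm.mul ((hPm k).pow_const 2)
  have hsum : Measurable fun y => ∑' k, geomWeight (gridRate ε) j k *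
      (V y * poissonAvg m b μ t (D k) y ^ 2 + V y * D k x ^ 2) := .tsum hkm
  calc _ ≤ ∫⁻ y, G * 2 * ∑' k, geomWeight (gridRate ε) j k *
        (V y * poissonAvg m b μ t (D k) y ^ 2 + V y * D k x ^ 2) ∂μ := by
        refine lintegral_mono fun y => (mul_le_mul_right (h1 y) _).trans (le_of_eq ?_)
        rw [mul_left_comm, ← ENNReal.tsum_mul_left]
        congr 1
        exact tsum_congr fun k => by ring
    _ = G * 2 * ∑' k, geomWeight (gridRate ε) j k *
        (sqAvg m b μ t (D k) x + (∫⁻ y, V y ∂μ) * D k x ^ 2) := by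
        rw [lintegral_const_mul _ hsum, lintegral_tsum fun k => (hkm k).aemeasurable]
        congr 1
        refine tsum_congr fun k => ?_
        have hm2 : Measurable fun y => V y * poissonAvg m b μ t (D k) y ^ 2 + V y * D k x ^ 2 :=
          (hm1 k).add (hVm.mul_const _)
        rw [lintegral_const_mul _ hm2, lintegral_add_left (hm1 k), lintegral_mul_const _ hVm]
        rfl
    _ ≤ G * 2 * ∑' k, geomWeight (gridRate ε) j k *
        ((1 + poissonConst m b * ENNReal.ofReal A) * (sqAvg m b μ t (D k) x + D k x ^ 2)) := by
        refine mul_le_mul_right (ENNReal.tsum_le_tsum fun k => mul_le_mul_right ?_ _) _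
        rw [mul_add]
        refine add_le_add (le_mul_of_one_le_left' le_self_add) (mul_le_mul_left ?_ _)
        exact (lintegral_sqAvg_weight_le hm hb ht hμ x).trans le_add_self
    _ = _ := by
        rw [scaleConst, ← hG, mul_assoc (G * 2), ← ENNReal.tsum_mul_left (a := 1 + _)]
        congr 1
        exact tsum_congr fun k => mul_left_comm _ _ _

/-- The count of exponents that fixes the admissible λ: the cancellative slot costs ε and each of
the κ - 1 others costs m, all doubled by squaring, and decay of order 2m + b must remain for
`sqAvg`. -/
theorem starWeight_mul_le (ht : 0 < t) (hκ : 1 ≤ κ)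
    (hlam : 2 * (κ : ℝ) * m + 2 * ε + b ≤ m * lam) (x y : RSpace n) :
    starWeight m lam t x y * ENNReal.ofReal ((1 + ‖x - y‖ / t) ^ (ε + m * (κ - 1 : ℕ))) ^ 2 ≤
      ENNReal.ofReal t⁻¹ * ENNReal.ofReal (t ^ (-m) * (1 + ‖x - y‖ / t) ^ (-(2 * m + b))) := by
  unfold starWeight
  have h0 : 0 ≤ ‖x - y‖ / t := by positivity
  set u := 1 + ‖x - y‖ / t with hu
  have hu0 : 0 < u := by positivity
  have e1 : t / (t + ‖x - y‖) = u⁻¹ := by rw [hu]; field_simp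
  rw [e1, ← ENNReal.ofReal_pow (by positivity), ← ENNReal.ofReal_mul (by positivity),
    ← ENNReal.ofReal_mul (by positivity)]
  refine ENNReal.ofReal_le_ofReal ?_
  rw [Real.inv_rpow hu0.le, ← Real.rpow_neg hu0.le, ← Real.rpow_mul_natCast hu0.le]
  have h1 : u ^ (-(m * lam)) * u ^ ((ε + m * (κ - 1 : ℕ)) * (2 : ℕ)) ≤ u ^ (-(2 * m + b)) := by
    rw [← Real.rpow_add hu0]
    refine Real.rpow_le_rpow_of_exponent_le (by rw [hu]; linarith) ?_
    push_cast [Nat.cast_sub hκ]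
    nlinarith
  have h2 : t ^ (m + 1) = t ^ m * t := by rw [Real.rpow_add ht, Real.rpow_one]
  rw [h2, Real.rpow_neg ht.le m]
  calc _ = (t ^ m)⁻¹ * t⁻¹ * (u ^ (-(m * lam)) * u ^ ((ε + m * (κ - 1 : ℕ)) * (2 : ℕ))) := by
        rw [div_eq_mul_inv, mul_inv]; ring
    _ ≤ (t ^ m)⁻¹ * t⁻¹ * u ^ (-(2 * m + b)) := by gcongr
    _ = _ := by ring

/-- The constant in the bound for the local part. -/
noncomputable def localConst (n κ : ℕ) (m α b ε A K : ℝ) : ℝ≥0∞ :=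
  2 * κ * goodConst n κ m α b ε A K ^ 2 * scaleConst m b ε A *
    (ENNReal.ofReal (2 ^ (2 * m + b)) * ENNReal.ofReal (2 ^ b) ^ 2 + 1)

theorem localConst_ne_top (hε : 0 < ε) : localConst n κ m α b ε A K ≠ ⊤ := by
  have h1 := scaleConst_ne_top (m := m) (b := b) (A := A) hε
  have h2 := goodConst_ne_top (n := n) (κ := κ) (m := m) (α := α) (b := b) (ε := ε) (A := A) (K := K)
  unfold localConst; finiteness

theorem lintegral_starWeight_le_of_isGridGood [SigmaFinite μ] (hs : IsLPSKernel m α K s)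
    (hK : 0 ≤ K) (hm : 0 < m) (hκ : 1 ≤ κ) (hb0 : 0 < b) (hε : 0 < ε) (hb : b + ε ≤ α)
    (hlam : 2 * (κ : ℝ) * m + 2 * ε + b ≤ m * lam) (hμ : IsPowerBounded m A μ)
    (hℓ : 0 < ℓ) (hω : ω ∈ Set.Ico (0 : ℝ) 1) (hQ : MeasurableSet Q) (hQt : μ Q ≠ ⊤)
    (hQa : ∀ x ∈ Q, ∀ i, x i ∈ Set.Icc (a i) (a i + ℓ)) {j : ℕ} (htj' : ℓ / 2 ^ j ≤ t)
    (htj : t ≤ 2 * (ℓ / 2 ^ j)) {f : Fin κ → RSpace n → ℂ} (hf : ∀ l, Measurable (f l))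
    (hfi : ∀ l, Integrable (f l) μ) (hfQ : ∀ l, ∀ x ∉ Q, f l x = 0)
    {x : RSpace n} (hxQ : x ∈ Q) (hx : IsGridGood a ℓ ω j x) :
    ∫⁻ y, starWeight m lam t x y * ‖Theta μ s f t y‖ₑ ^ 2 ∂μ ≤
      2 * (∏ l, slotMax m μ Q (gridFiltration a ℓ ω) (f l) x) ^ 2 *
        ∫⁻ y, starWeight m lam t x y *
          ‖Theta μ s (fun _ => Q.indicator fun _ => (1 : ℂ)) t y‖ₑ ^ 2 ∂μ +
      ENNReal.ofReal t⁻¹ * (localConst n κ m α b ε A K *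
        ∑ i, (∏ l ∈ Finset.univ.erase i, slotMax m μ Q (gridFiltration a ℓ ω) (f l) x) ^ 2 *
        ∑' k, geomWeight (gridRate ε) j k *
          (sqAvg m b μ (ℓ / 2 ^ j) (increment μ Q (gridFiltration a ℓ ω) (f i) k) x +
            increment μ Q (gridFiltration a ℓ ω) (f i) k x ^ 2)) := by
  have hj0 : 0 < ℓ / 2 ^ j := by positivity
  have ht : 0 < t := hj0.trans_le htj'
  set ℱ := gridFiltration a ℓ ω with hℱ
  set N : Fin κ → ℝ≥0∞ := fun l => slotMax m μ Q ℱ (f l) x with hN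
  set D : Fin κ → ℕ → RSpace n → ℝ≥0∞ := fun i => increment μ Q ℱ (f i) with hD
  have hDm : ∀ i k, Measurable (D i k) := fun i => measurable_increment μ hQ ℱ (f i)
  set Θ₁ := fun y => ‖Theta μ s (fun _ => Q.indicator fun _ => (1 : ℂ)) t y‖ₑ with hΘ₁
  set G := goodConst n κ m α b ε A K with hG
  set U := fun y => ENNReal.ofReal ((1 + ‖x - y‖ / t) ^ (ε + m * (κ - 1 : ℕ))) with hU
  set S := fun i y => scaleSum m b ε μ t (D i) j x y with hS
  set V : RSpace n → ℝ≥0∞ :=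
    fun y => ENNReal.ofReal (t ^ (-m) * (1 + ‖x - y‖ / t) ^ (-(2 * m + b))) with hV
  set M : Fin κ → ℝ≥0∞ := fun i => ∏ l ∈ Finset.univ.erase i, N l with hM
  have hVm : Measurable V := by rw [hV]; fun_prop
  have hSm : ∀ i, Measurable (S i) := fun i => .tsum fun k =>
    ((measurable_poissonAvg (hDm i k)).add_const _).const_mul _
  have h1 : ∀ y, ‖Theta μ s f t y‖ₑ ^ 2 ≤ 2 * (∏ l, N l) ^ 2 * Θ₁ y ^ 2 +
      2 * κ * G ^ 2 * ∑ i, M i ^ 2 * (U y ^ 2 * S i y ^ 2) := by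
    intro y
    have h2 := enorm_Theta_le_of_isGridGood hs hK hm hb0 hε hb hμ hℓ hω hQ hQt hQa htj' htj hf hfi
      hfQ hxQ hx y
    calc _ ≤ ((∏ l, N l) * Θ₁ y + ∑ i, G * M i * (U y * S i y)) ^ 2 := by
          gcongr
      _ ≤ 2 * (((∏ l, N l) * Θ₁ y) ^ 2 + (∑ i, G * M i * (U y * S i y)) ^ 2) :=
          ENNReal.add_sq_le _ _
      _ ≤ 2 * (((∏ l, N l) * Θ₁ y) ^ 2 + κ * ∑ i, (G * M i * (U y * S i y)) ^ 2) := by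
          have := ENNReal.sum_sq_le fun i => G * M i * (U y * S i y)
          rw [Fintype.card_fin] at this
          gcongr
      _ = _ := by
          rw [mul_add, Finset.mul_sum, Finset.mul_sum, Finset.mul_sum, mul_pow, ← mul_assoc]
          congr 1
          exact Finset.sum_congr rfl fun i _ => by ring
  have hΘm : Measurable fun y => starWeight m lam t x y * Θ₁ y ^ 2 := by
    have h3 : Measurable fun q : ℝ × RSpace n => Theta μ s
        (fun _ => Q.indicator fun _ => (1 : ℂ)) q.1 q.2 :=
      measurable_Theta hs fun _ => measurable_const.indicator hQ
    have h4 : Measurable Θ₁ := (h3.comp (measurable_const.prodMk measurable_id)).enorm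
    have h5 : Measurable fun y => starWeight m lam t x y := by unfold starWeight; fun_prop
    exact h5.mul (h4.pow_const 2)
  have hVSm : ∀ i, Measurable fun y => V y * S i y ^ 2 := fun i => hVm.mul ((hSm i).pow_const 2)
  have hsm : Measurable fun y => ∑ i, M i ^ 2 * (V y * S i y ^ 2) :=
    Finset.measurable_fun_sum _ fun i _ => (hVSm i).const_mul _
  have hm1 : Measurable fun y => 2 * (∏ l, N l) ^ 2 * (starWeight m lam t x y * Θ₁ y ^ 2) :=
    hΘm.const_mul _
  have hVS : ∀ i, ∫⁻ y, V y * S i y ^ 2 ∂μ ≤ scaleConst m b ε A *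
      (ENNReal.ofReal (2 ^ (2 * m + b)) * ENNReal.ofReal (2 ^ b) ^ 2 + 1) *
      ∑' k, geomWeight (gridRate ε) j k * (sqAvg m b μ (ℓ / 2 ^ j) (D i k) x + D i k x ^ 2) := by
    intro i
    refine (lintegral_scaleSum_sq_le hm hb0 ht hμ (hDm i) j x).trans ?_
    rw [mul_assoc, ← ENNReal.tsum_mul_left (a := ENNReal.ofReal _ * _ + 1)]
    refine mul_le_mul_right (ENNReal.tsum_le_tsum fun k => ?_) _
    rw [mul_left_comm]
    refine mul_le_mul_right ?_ _
    rw [mul_add]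
    refine add_le_add ((sqAvg_le_of_le hm hb0 hj0 htj' htj _ x).trans ?_) ?_
    · exact mul_le_mul_left le_self_add _
    · exact le_mul_of_one_le_left' le_add_self
  calc _ ≤ ∫⁻ y, 2 * (∏ l, N l) ^ 2 * (starWeight m lam t x y * Θ₁ y ^ 2) +
        2 * κ * G ^ 2 * ENNReal.ofReal t⁻¹ * ∑ i, M i ^ 2 * (V y * S i y ^ 2) ∂μ := by
        refine lintegral_mono fun y => (mul_le_mul_right (h1 y) _).trans ?_
        rw [mul_add]
        refine add_le_add (le_of_eq (mul_left_comm _ _ _)) ?_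
        calc _ = 2 * κ * G ^ 2 *
              ∑ i, M i ^ 2 * ((starWeight m lam t x y * U y ^ 2) * S i y ^ 2) := by
              rw [mul_left_comm, Finset.mul_sum]
              congr 1
              exact Finset.sum_congr rfl fun i _ => by ring
          _ ≤ 2 * κ * G ^ 2 * ∑ i, M i ^ 2 * ((ENNReal.ofReal t⁻¹ * V y) * S i y ^ 2) := by
              refine mul_le_mul_right (Finset.sum_le_sum fun i _ => ?_) _
              exact mul_le_mul_right (mul_le_mul_left (starWeight_mul_le ht hκ hlam x y) _) _
          _ = _ := by
              rw [mul_assoc (2 * (κ : ℝ≥0∞) * G ^ 2), Finset.mul_sum _ _ (ENNReal.ofReal t⁻¹)]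
              congr 1
              exact Finset.sum_congr rfl fun i _ => by ring
    _ = 2 * (∏ l, N l) ^ 2 * ∫⁻ y, starWeight m lam t x y * Θ₁ y ^ 2 ∂μ +
        2 * κ * G ^ 2 * ENNReal.ofReal t⁻¹ * ∑ i, M i ^ 2 * ∫⁻ y, V y * S i y ^ 2 ∂μ := by
        rw [lintegral_add_left hm1, lintegral_const_mul _ hΘm, lintegral_const_mul _ hsm,
          lintegral_finsetSum _ fun i _ => (hVSm i).const_mul _]
        congr 2
        exact Finset.sum_congr rfl fun i _ => lintegral_const_mul _ (hVSm i)
    _ ≤ 2 * (∏ l, N l) ^ 2 * ∫⁻ y, starWeight m lam t x y * Θ₁ y ^ 2 ∂μ +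
        2 * κ * G ^ 2 * ENNReal.ofReal t⁻¹ * ∑ i, M i ^ 2 * (scaleConst m b ε A *
          (ENNReal.ofReal (2 ^ (2 * m + b)) * ENNReal.ofReal (2 ^ b) ^ 2 + 1) *
          ∑' k, geomWeight (gridRate ε) j k *
            (sqAvg m b μ (ℓ / 2 ^ j) (D i k) x + D i k x ^ 2)) :=
        add_le_add le_rfl (mul_le_mul_right (Finset.sum_le_sum fun i _ =>
          mul_le_mul_right (hVS i) _) _)
    _ = _ := by
        congr 1
        rw [localConst, ← hG, Finset.mul_sum, Finset.mul_sum, Finset.mul_sum]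
        exact Finset.sum_congr rfl fun i _ => by ring

/-- The local part of the square function at good points. -/
theorem tsum_scalePart_le [SigmaFinite μ] (hs : IsLPSKernel m α K s)
    (hK : 0 ≤ K) (hm : 0 < m) (hκ : 1 ≤ κ) (hb0 : 0 < b) (hε : 0 < ε) (hb : b + ε ≤ α)
    (hlam : 2 * (κ : ℝ) * m + 2 * ε + b ≤ m * lam) (hμ : IsPowerBounded m A μ)
    (hℓ : 0 < ℓ) (hω : ω ∈ Set.Ico (0 : ℝ) 1) (hQ : MeasurableSet Q) (hQt : μ Q ≠ ⊤)
    (hQa : ∀ x ∈ Q, ∀ i, x i ∈ Set.Icc (a i) (a i + ℓ))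
    {f : Fin κ → RSpace n → ℂ} (hf : ∀ l, Measurable (f l))
    (hfi : ∀ l, Integrable (f l) μ) (hfQ : ∀ l, ∀ x ∉ Q, f l x = 0)
    {x : RSpace n} (hxQ : x ∈ Q) :
    ∑' j, {w | IsGridGood a ℓ w (j + 1) x}.indicator
        (fun _ => scalePart ℓ m lam μ s f j x) ω ≤
      2 * (∏ l, slotMax m μ Q (gridFiltration a ℓ ω) (f l) x) ^ 2 *
        gStarLocal ℓ m lam μ s (fun _ => Q.indicator fun _ => (1 : ℂ)) x ^ 2 +
      localConst n κ m α b ε A K *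
        ∑ i, (∏ l ∈ Finset.univ.erase i, slotMax m μ Q (gridFiltration a ℓ ω) (f l) x) ^ 2 *
          sqFn m b μ (gridRate ε) (fun j => ℓ / 2 ^ j)
            (increment μ Q (gridFiltration a ℓ ω) (f i)) x := by
  set P := 2 * (∏ l, slotMax m μ Q (gridFiltration a ℓ ω) (f l) x) ^ 2 with hP
  set M : Fin κ → ℝ≥0∞ := fun i =>
    (∏ l ∈ Finset.univ.erase i, slotMax m μ Q (gridFiltration a ℓ ω) (f l) x) ^ 2 with hM
  set R : Fin κ → ℕ → ℝ≥0∞ := fun i j => ∑' k, geomWeight (gridRate ε) j k *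
    (sqAvg m b μ (ℓ / 2 ^ j) (increment μ Q (gridFiltration a ℓ ω) (f i) k) x +
      increment μ Q (gridFiltration a ℓ ω) (f i) k x ^ 2) with hR
  -- The scales of the j-th part lie between ℓ/2^(j+1) and twice that, so goodness and the
  -- martingale are used at generation j + 1.
  have key : ∀ j, {w | IsGridGood a ℓ w (j + 1) x}.indicator
      (fun _ => scalePart ℓ m lam μ s f j x) ω ≤
      P * scalePart ℓ m lam μ s (fun _ => Q.indicator fun _ => (1 : ℂ)) j x +
        localConst n κ m α b ε A K * ∑ i, M i * R i (j + 1) := by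
    intro j
    by_cases hx : IsGridGood a ℓ ω (j + 1) x
    · rw [Set.indicator_of_mem hx]
      unfold scalePart
      have hme : Measurable fun t => ∫⁻ y, starWeight m lam t x y *
          ‖Theta μ s (fun _ => Q.indicator fun _ => (1 : ℂ)) t y‖ₑ ^ 2 ∂μ :=
        (measurable_lintegral_starWeight (lam := lam) hs
          (f := fun _ => Q.indicator fun _ => (1 : ℂ))
          fun _ => measurable_const.indicator hQ).comp (f := fun t : ℝ => (x, t)) (by fun_prop)
      have e : ℓ / 2 ^ j = 2 * (ℓ / 2 ^ (j + 1)) := by rw [pow_succ]; field_simp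
      calc _ ≤ ∫⁻ t in Set.Ico (ℓ / 2 ^ (j + 1)) (ℓ / 2 ^ j),
            (P * (∫⁻ y, starWeight m lam t x y *
              ‖Theta μ s (fun _ => Q.indicator fun _ => (1 : ℂ)) t y‖ₑ ^ 2 ∂μ) +
            ENNReal.ofReal (ℓ / 2 ^ (j + 1))⁻¹ *
              (localConst n κ m α b ε A K * ∑ i, M i * R i (j + 1))) := by
            refine setLIntegral_mono' measurableSet_Ico fun t ht => ?_
            refine (lintegral_starWeight_le_of_isGridGood hs hK hm hκ hb0 hε hb hlam hμ hℓ hω hQ hQt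
              hQa ht.1 (ht.2.le.trans e.le) hf hfi hfQ hxQ hx).trans ?_
            refine add_le_add le_rfl (mul_le_mul_left (ENNReal.ofReal_le_ofReal ?_) _)
            exact inv_anti₀ (by positivity) ht.1
        _ = P * (∫⁻ t in Set.Ico (ℓ / 2 ^ (j + 1)) (ℓ / 2 ^ j), ∫⁻ y, starWeight m lam t x y *
              ‖Theta μ s (fun _ => Q.indicator fun _ => (1 : ℂ)) t y‖ₑ ^ 2 ∂μ) +
            ENNReal.ofReal (ℓ / 2 ^ (j + 1))⁻¹ *
              (localConst n κ m α b ε A K * ∑ i, M i * R i (j + 1)) *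
              volume (Set.Ico (ℓ / 2 ^ (j + 1)) (ℓ / 2 ^ j)) := by
            rw [lintegral_add_left (hme.const_mul _), lintegral_const_mul _ hme,
              setLIntegral_const]
        _ = _ := by
            congr 1
            rw [Real.volume_Ico, e, mul_right_comm, ← ENNReal.ofReal_mul (by positivity)]
            -- The interval of scales has length equal to its left endpoint, so the factor 1/t
            -- integrates to at most 1.
            have : (ℓ / 2 ^ (j + 1))⁻¹ * (2 * (ℓ / 2 ^ (j + 1)) - ℓ / 2 ^ (j + 1)) = 1 := by
              field_simp; ring
            rw [this, ENNReal.ofReal_one, one_mul]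
    · rw [Set.indicator_of_notMem (by simpa using hx)]
      exact zero_le
  refine (ENNReal.tsum_le_tsum key).trans ?_
  rw [ENNReal.tsum_add, ENNReal.tsum_mul_left, ← gStarLocal_sq hℓ, ENNReal.tsum_mul_left]
  refine add_le_add le_rfl (mul_le_mul_right ?_ _)
  rw [Summable.tsum_finsetSum fun _ _ => ENNReal.summable]
  refine Finset.sum_le_sum fun i _ => ?_
  rw [ENNReal.tsum_mul_left]
  refine mul_le_mul_right ?_ _
  exact ENNReal.tsum_comp_le_tsum_of_injective (add_left_injective 1) (R i)

end

/-! ### Integration of the pointwise bounds -/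

/-- Comparison with the largest term, which covers exponents below 1 as well; p/2 may be such. -/
theorem ENNReal.sum_rpow_le_card_mul {ι : Type*} (I : Finset ι) (b : ι → ℝ≥0∞) {ρ : ℝ}
    (hρ : 0 < ρ) : (∑ i ∈ I, b i) ^ ρ ≤ (I.card : ℝ≥0∞) ^ ρ * ∑ i ∈ I, b i ^ ρ := by
  rcases I.eq_empty_or_nonempty with rfl | hI
  · simp [hρ]
  obtain ⟨i₀, hi₀, hmax⟩ := I.exists_max_image b hI
  calc (∑ i ∈ I, b i) ^ ρ ≤ ((I.card : ℝ≥0∞) * b i₀) ^ ρ := by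
        refine ENNReal.rpow_le_rpow ?_ hρ.le
        rw [← nsmul_eq_mul]
        exact Finset.sum_le_card_nsmul I b _ hmax
    _ = (I.card : ℝ≥0∞) ^ ρ * b i₀ ^ ρ := ENNReal.mul_rpow_of_nonneg _ _ hρ.le
    _ ≤ _ := mul_le_mul_right
        (Finset.single_le_sum (f := fun i => b i ^ ρ) (fun _ _ => zero_le) hi₀) _

theorem ENNReal.add_rpow_le_two_mul (a b : ℝ≥0∞) {ρ : ℝ} (hρ : 0 < ρ) :
    (a + b) ^ ρ ≤ 2 ^ ρ * (a ^ ρ + b ^ ρ) := by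
  have := ENNReal.sum_rpow_le_card_mul Finset.univ ![a, b] hρ
  simpa using this

/-- Hölder's inequality for a product of `κ` functions. -/
theorem lintegral_prod_rpow_le {X : Type*} [MeasurableSpace X] {ν : Measure X} {κ : ℕ} {p : ℝ}
    {q : Fin κ → ℝ} (hp : 0 < p) (hq : ∀ i, 0 < q i) (hpq : 1 / p = ∑ i, 1 / q i)
    {h : Fin κ → X → ℝ≥0∞} (hh : ∀ i, Measurable (h i)) {c B : Fin κ → ℝ≥0∞}
    (hB : ∀ i, ∫⁻ x, h i x ^ q i ∂ν ≤ c i * B i) :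
    ∫⁻ x, (∏ i, h i x) ^ p ∂ν ≤ (∏ i, c i ^ (p / q i)) * ∏ i, B i ^ (p / q i) := by
  have h1 : ∑ i, p / q i = 1 := by
    have : ∑ i, p / q i = p * ∑ i, 1 / q i := by
      rw [Finset.mul_sum]; exact Finset.sum_congr rfl fun i _ => by ring
    rw [this, ← hpq, mul_one_div_cancel hp.ne']
  have h2 : ∀ i, 0 ≤ p / q i := fun i => div_nonneg hp.le (hq i).le
  calc ∫⁻ x, (∏ i, h i x) ^ p ∂ν = ∫⁻ x, ∏ i, (h i x ^ q i) ^ (p / q i) ∂ν := by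
        refine lintegral_congr fun x => ?_
        rw [← ENNReal.prod_rpow_of_nonneg hp.le]
        refine Finset.prod_congr rfl fun i _ => ?_
        rw [← ENNReal.rpow_mul, mul_div_cancel₀ _ (hq i).ne']
    _ ≤ ∏ i, (∫⁻ x, h i x ^ q i ∂ν) ^ (p / q i) :=
        ENNReal.lintegral_prod_norm_pow_le _ (fun i _ => ((hh i).pow_const _).aemeasurable) h1
          fun i _ => h2 i
    _ ≤ ∏ i, (c i * B i) ^ (p / q i) :=
        Finset.prod_le_prod' fun i _ => ENNReal.rpow_le_rpow (hB i) (h2 i)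
    _ = _ := by
        rw [← Finset.prod_mul_distrib]
        exact Finset.prod_congr rfl fun i _ => ENNReal.mul_rpow_of_nonneg _ _ (h2 i)

section
variable {n κ : ℕ} {m lam α b ε K A t ℓ ω : ℝ} {μ : Measure (RSpace n)}
  {s : ℝ → RSpace n → (Fin κ → RSpace n) → ℂ} {Q : Set (RSpace n)} {a : Fin n → ℝ}

theorem measurable_slotMax [SFinite μ]
    {ℱ : Filtration ℕ (inferInstance : MeasurableSpace (RSpace n))} {f : RSpace n → ℂ}
    (hf : Measurable f) : Measurable (slotMax m μ Q ℱ f) :=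
  (measurable_maxFn hf.enorm).add (measurable_procMax (measurable_condExp_filtration _ ℱ f))

theorem slotMax_strong_type (hm : 0 < m) (hA : 0 < A) {q : ℝ} (hq : 1 < q) :
    ∃ C : ℝ≥0, ∀ μ : Measure (RSpace n), IsPowerBounded m A μ → ∀ Q : Set (RSpace n), μ Q ≠ ⊤ →
      ∀ (ℱ : Filtration ℕ (inferInstance : MeasurableSpace (RSpace n))) (f : RSpace n → ℂ),
      Measurable f → Integrable f μ →
      ∫⁻ x in Q, slotMax m μ Q ℱ f x ^ q ∂μ ≤ C * ∫⁻ x, ‖f x‖ₑ ^ q ∂μ := by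
  obtain ⟨C₁, hC₁⟩ := maxFn_strong_type (n := n) hm hA hq
  set c₂ : ℝ≥0∞ := 2 * ENNReal.ofReal (q / (q - 1) * (2⁻¹)⁻¹ ^ (q - 1)) with hc₂
  have h2 : (2 : ℝ≥0∞) ^ (q - 1) ≠ ⊤ := ENNReal.rpow_ne_top_of_nonneg (by linarith) (by simp)
  refine ⟨(2 ^ (q - 1) * (C₁ + c₂)).toNNReal, fun μ hμ Q hQ ℱ f hf hfi => ?_⟩
  have := hμ.isLocallyFiniteMeasure
  have : IsFiniteMeasure (μ.restrict Q) := ⟨by simpa using hQ.lt_top⟩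
  rw [ENNReal.coe_toNNReal (by finiteness)]
  have hM : Measurable (maxFn m μ fun z => ‖f z‖ₑ) := measurable_maxFn hf.enorm
  calc _ ≤ ∫⁻ x in Q, 2 ^ (q - 1) * (maxFn m μ (fun z => ‖f z‖ₑ) x ^ q +
        procMax (fun k => (μ.restrict Q)[f|ℱ k]) x ^ q) ∂μ :=
        lintegral_mono fun x => ENNReal.rpow_add_le_mul_rpow_add_rpow _ _ hq.le
    _ = 2 ^ (q - 1) * (∫⁻ x in Q, maxFn m μ (fun z => ‖f z‖ₑ) x ^ q ∂μ +
        ∫⁻ x in Q, procMax (fun k => (μ.restrict Q)[f|ℱ k]) x ^ q ∂μ) := by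
        rw [lintegral_const_mul' _ _ h2, lintegral_add_left (hM.pow_const _)]
    _ ≤ 2 ^ (q - 1) * (C₁ * ∫⁻ x, ‖f x‖ₑ ^ q ∂μ + c₂ * ∫⁻ x, ‖f x‖ₑ ^ q ∂μ) := by
        refine mul_le_mul_right (add_le_add ?_ ?_) _
        · exact (setLIntegral_le_lintegral _ _).trans (hC₁ μ hμ _ hf.enorm)
        · refine (procMax_condExp_strong_type hf hfi.restrict hq).trans ?_
          exact mul_le_mul_right (setLIntegral_le_lintegral _ _) _
    _ = _ := by ring

/-- The local part for a fixed grid. -/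
theorem lintegral_tsum_scalePart_le {p : ℝ} {q : Fin κ → ℝ} (hp : 0 < p) (hq : ∀ i, 1 < q i)
    (hpq : 1 / p = ∑ i, 1 / q i) (hA : 0 < A) (hK : 0 ≤ K) (hm : 0 < m) (hκ : 1 ≤ κ) (hb0 : 0 < b)
    (hε : 0 < ε) (hb : b + ε ≤ α) (hlam : 2 * (κ : ℝ) * m + 2 * ε + b ≤ m * lam) (ζ : ℝ≥0) :
    ∃ C : ℝ≥0, ∀ (μ : Measure (RSpace n)) (s : ℝ → RSpace n → (Fin κ → RSpace n) → ℂ),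
      IsPowerBounded m A μ → IsLPSKernel m α K s → ∀ (Q : Set (RSpace n)) (a : Fin n → ℝ) (ℓ : ℝ),
      0 < ℓ → MeasurableSet Q → μ Q ≠ ⊤ → (∀ x ∈ Q, ∀ i, x i ∈ Set.Icc (a i) (a i + ℓ)) →
      ∀ G ⊆ Q, MeasurableSet G →
      (∀ x ∈ G, gStarLocal ℓ m lam μ s (fun _ => Q.indicator fun _ => (1 : ℂ)) x ≤ ζ) →
      ∀ f : Fin κ → RSpace n → ℂ, (∀ l, Measurable (f l)) → (∀ l, Integrable (f l) μ) →
      (∀ l, MemLp (f l) (ENNReal.ofReal (q l)) μ) → (∀ l, ∀ x ∉ Q, f l x = 0) →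
      ∀ ω ∈ Set.Ico (0 : ℝ) 1,
      ∫⁻ x in G, (∑' j, {w | IsGridGood a ℓ w (j + 1) x}.indicator
        (fun _ => scalePart ℓ m lam μ s f j x) ω) ^ (p / 2) ∂μ ≤
        C * ∏ l, (∫⁻ x, ‖f l x‖ₑ ^ q l ∂μ) ^ (p / q l) := by
  have hρ : 0 < p / 2 := by positivity
  have hq0 : ∀ i, 0 < q i := fun i => by linarith [hq i]
  choose C₁ hC₁ using fun i => slotMax_strong_type (n := n) hm hA (hq i)
  choose C₂ hC₂ using fun i => sqFn_increment_bound (n := n) hm hb0 hA (hq i) (gridRate_lt_one hε)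
  set L := localConst n κ m α b ε A K with hL
  have hLt : L ≠ ⊤ := localConst_ne_top hε
  set c₁ : ℝ≥0∞ := 2 ^ (p / 2) * (2 * (ζ : ℝ≥0∞) ^ 2) ^ (p / 2) with hc₁
  set c₂ : ℝ≥0∞ := 2 ^ (p / 2) * (L ^ (p / 2) * (κ : ℝ≥0∞) ^ (p / 2)) with hc₂
  set e₁ : ℝ≥0∞ := ∏ l, (C₁ l : ℝ≥0∞) ^ (p / q l) with he₁
  set e₂ : Fin κ → ℝ≥0∞ := fun i => ∏ l, ((C₁ l : ℝ≥0∞) + C₂ l) ^ (p / q l) with he₂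
  have hpq0 : ∀ l, 0 ≤ p / q l := fun l => div_nonneg hp.le (hq0 l).le
  have hc₁t : c₁ ≠ ⊤ := by rw [hc₁]; finiteness
  have hc₂t : c₂ ≠ ⊤ := by rw [hc₂]; finiteness
  have he₁t : e₁ ≠ ⊤ := ENNReal.prod_ne_top fun l _ => by have := hpq0 l; finiteness
  have he₂t : ∀ i, e₂ i ≠ ⊤ := fun i => ENNReal.prod_ne_top fun l _ => by
    have := hpq0 l; finiteness
  have hct : c₁ * e₁ + c₂ * ∑ i, e₂ i ≠ ⊤ := by
    have : ∑ i, e₂ i ≠ ⊤ := ENNReal.sum_ne_top.2 fun i _ => he₂t i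
    finiteness
  refine ⟨(c₁ * e₁ + c₂ * ∑ i, e₂ i).toNNReal, fun μ s hμ hs Q a ℓ hℓ hQ hQt hQa G hGQ hG hGζ f hf
    hfi hfq hfQ ω hω => ?_⟩
  rw [ENNReal.coe_toNNReal hct]
  have := hμ.isLocallyFiniteMeasure
  set ℱ := gridFiltration a ℓ ω with hℱ
  set N : Fin κ → RSpace n → ℝ≥0∞ := fun l => slotMax m μ Q ℱ (f l) with hN
  have hNm : ∀ l, Measurable (N l) := fun l => measurable_slotMax (hf l)
  set S : Fin κ → RSpace n → ℝ≥0∞ := fun i =>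
    sqFn m b μ (gridRate ε) (fun j => ℓ / 2 ^ j) (increment μ Q ℱ (f i)) with hS
  have hSm : ∀ i, Measurable (S i) := fun i => measurable_sqFn (measurable_increment μ hQ ℱ (f i))
  set Φ := ∏ l, (∫⁻ x, ‖f l x‖ₑ ^ q l ∂μ) ^ (p / q l) with hΦ
  -- The i-th error term as a product of κ functions, with the square root of the square function in
  -- slot i. The same κ-fold Hölder inequality then treats main and error terms.
  set H : Fin κ → Fin κ → RSpace n → ℝ≥0∞ := fun i =>
    Function.update N i fun x => S i x ^ (1 / 2 : ℝ) with hH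
  have hHm : ∀ i l, Measurable (H i l) := fun i l => by
    rcases eq_or_ne l i with rfl | hl
    · rw [hH]; simp only [Function.update_self]; exact (hSm l).pow_const _
    · rw [hH]; simp only [Function.update_of_ne hl]; exact hNm l
  have hpoint : ∀ x ∈ G, (∑' j, {w | IsGridGood a ℓ w (j + 1) x}.indicator
        (fun _ => scalePart ℓ m lam μ s f j x) ω) ^ (p / 2) ≤
      c₁ * (∏ l, N l x) ^ p + c₂ * ∑ i, (∏ l, H i l x) ^ p := by
    intro x hx
    have h1 := tsum_scalePart_le hs hK hm hκ hb0 hε hb hlam hμ hℓ hω hQ hQt hQa hf hfi hfQ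
      (hGQ hx)
    have h2 : 2 * (∏ l, N l x) ^ 2 *
        gStarLocal ℓ m lam μ s (fun _ => Q.indicator fun _ => (1 : ℂ)) x ^ 2 ≤
        2 * (ζ : ℝ≥0∞) ^ 2 * (∏ l, N l x) ^ 2 := by
      rw [mul_right_comm]
      have := hGζ x hx
      gcongr
    have hsq : ∀ y : ℝ≥0∞, (y ^ 2) ^ (p / 2) = y ^ p := fun y => by
      rw [← ENNReal.rpow_natCast, ← ENNReal.rpow_mul]; congr 1; push_cast; ring
    have h3 : ∀ i, ((∏ l ∈ Finset.univ.erase i, N l x) ^ 2 * S i x) ^ (p / 2) =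
        (∏ l, H i l x) ^ p := by
      intro i
      rw [← hsq (∏ l, H i l x), ← Finset.mul_prod_erase Finset.univ _ (Finset.mem_univ i), mul_pow]
      congr 1
      have e1 : H i i x ^ 2 = S i x := by
        simp only [hH, Function.update_self]
        rw [← ENNReal.rpow_natCast, ← ENNReal.rpow_mul]; norm_num
      rw [e1, mul_comm]
      congr 2
      refine Finset.prod_congr rfl fun l hl => ?_
      simp only [hH]
      rw [Function.update_of_ne (Finset.ne_of_mem_erase hl)]
    calc _ ≤ (2 * (ζ : ℝ≥0∞) ^ 2 * (∏ l, N l x) ^ 2 +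
          L * ∑ i, (∏ l ∈ Finset.univ.erase i, N l x) ^ 2 * S i x) ^ (p / 2) :=
          ENNReal.rpow_le_rpow (h1.trans (add_le_add h2 le_rfl)) hρ.le
      _ ≤ 2 ^ (p / 2) * ((2 * (ζ : ℝ≥0∞) ^ 2 * (∏ l, N l x) ^ 2) ^ (p / 2) +
          (L * ∑ i, (∏ l ∈ Finset.univ.erase i, N l x) ^ 2 * S i x) ^ (p / 2)) :=
          ENNReal.add_rpow_le_two_mul _ _ hρ
      _ ≤ 2 ^ (p / 2) * ((2 * (ζ : ℝ≥0∞) ^ 2) ^ (p / 2) * (∏ l, N l x) ^ p +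
          L ^ (p / 2) * ((κ : ℝ≥0∞) ^ (p / 2) * ∑ i, (∏ l, H i l x) ^ p)) := by
          refine mul_le_mul_right (add_le_add ?_ ?_) _
          · rw [ENNReal.mul_rpow_of_nonneg _ _ hρ.le, hsq]
          · rw [ENNReal.mul_rpow_of_nonneg _ _ hρ.le]
            refine mul_le_mul_right ((ENNReal.sum_rpow_le_card_mul _ _ hρ).trans (le_of_eq ?_)) _
            rw [Finset.card_univ, Fintype.card_fin]
            congr 1
            exact Finset.sum_congr rfl fun i _ => h3 i
      _ = _ := by rw [hc₁, hc₂]; ring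
  have hNint : ∀ l, ∫⁻ x in Q, N l x ^ q l ∂μ ≤ C₁ l * ∫⁻ x, ‖f l x‖ₑ ^ q l ∂μ := fun l =>
    hC₁ l μ hμ Q hQt ℱ (f l) (hf l) (hfi l)
  have hHint : ∀ i l, ∫⁻ x in Q, H i l x ^ q l ∂μ ≤
      ((C₁ l : ℝ≥0∞) + C₂ l) * ∫⁻ x, ‖f l x‖ₑ ^ q l ∂μ := by
    intro i l
    rcases eq_or_ne l i with rfl | hl
    · have e : ∀ x, H l l x ^ q l = S l x ^ (q l / 2) := fun x => by
        simp only [hH, Function.update_self]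
        rw [← ENNReal.rpow_mul]; congr 1; ring
      simp only [e]
      refine (hC₂ l μ hμ Q hQ hQt _ (fun j => by positivity) ℱ (f l) (hf l)
        ((hfq l).restrict Q)).trans ?_
      exact mul_le_mul' le_add_self (setLIntegral_le_lintegral _ _)
    · have e : H i l = N l := by simp only [hH, Function.update_of_ne hl]
      rw [e]
      exact (hNint l).trans (mul_le_mul_left le_self_add _)
  have hI1 := lintegral_prod_rpow_le hp hq0 hpq hNm hNint
  have hI2 := fun i => lintegral_prod_rpow_le hp hq0 hpq (hHm i) (hHint i)
  have hm1 : Measurable fun x => (∏ l, N l x) ^ p :=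
    (Finset.measurable_fun_prod _ fun l _ => hNm l).pow_const _
  have hm2 : ∀ i, Measurable fun x => (∏ l, H i l x) ^ p := fun i =>
    (Finset.measurable_fun_prod _ fun l _ => hHm i l).pow_const _
  calc _ ≤ ∫⁻ x in G, (c₁ * (∏ l, N l x) ^ p + c₂ * ∑ i, (∏ l, H i l x) ^ p) ∂μ :=
        setLIntegral_mono' hG hpoint
    _ ≤ ∫⁻ x in Q, (c₁ * (∏ l, N l x) ^ p + c₂ * ∑ i, (∏ l, H i l x) ^ p) ∂μ :=
        lintegral_mono_set hGQ
    _ = c₁ * ∫⁻ x in Q, (∏ l, N l x) ^ p ∂μ + c₂ * ∑ i, ∫⁻ x in Q, (∏ l, H i l x) ^ p ∂μ := by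
        rw [lintegral_add_left (hm1.const_mul _), lintegral_const_mul' _ _ hc₁t,
          lintegral_const_mul' _ _ hc₂t, lintegral_finsetSum _ fun i _ => hm2 i]
    _ ≤ c₁ * (e₁ * Φ) + c₂ * ∑ i, e₂ i * Φ :=
        add_le_add (mul_le_mul_right hI1 _)
          (mul_le_mul_right (Finset.sum_le_sum fun i _ => hI2 i) _)
    _ = _ := by rw [← Finset.sum_mul]; ring

end

section
variable {n κ : ℕ} {m lam α b ε K A t ℓ ω : ℝ} {μ : Measure (RSpace n)}
  {s : ℝ → RSpace n → (Fin κ → RSpace n) → ℂ} {Q : Set (RSpace n)} {a : Fin n → ℝ}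

/-- The local part of the square function, after averaging over the grids. -/
theorem lintegral_tsum_scalePart_le_of_forall [SigmaFinite μ] (hs : IsLPSKernel m α K s) {ρ : ℝ}
    (hρ : 0 < ρ) {G : Set (RSpace n)} {f : Fin κ → RSpace n → ℂ}
    (hf : ∀ l, Measurable (f l)) {B : ℝ≥0∞}
    (hB : ∀ ω ∈ Set.Ico (0 : ℝ) 1, ∫⁻ x in G, (∑' j, {w | IsGridGood a ℓ w (j + 1) x}.indicator
        (fun _ => scalePart ℓ m lam μ s f j x) ω) ^ ρ ∂μ ≤ B) :
    ∫⁻ x in G, (∑' j, scalePart ℓ m lam μ s f j x) ^ ρ ∂μ ≤ 2 ^ (ρ + 1) * B := by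
  set P : Measure ℝ := volume.restrict (Set.Ico (0 : ℝ) 1) with hP
  have : IsProbabilityMeasure P := ⟨by simp [hP]⟩
  have hS : ∀ j : ℕ, MeasurableSet {w : RSpace n × ℝ | IsGridGood a ℓ w.2 (j + 1) w.1} :=
    fun j => measurableSet_isGridGood a ℓ (j + 1)
  have hFm : Measurable fun w : RSpace n × ℝ => (∑' j, {v | IsGridGood a ℓ v (j + 1) w.1}.indicator
      (fun _ => scalePart ℓ m lam μ s f j w.1) w.2) ^ ρ := by
    refine (Measurable.tsum fun j => ?_).pow_const ρ
    exact ((measurable_scalePart (ℓ := ℓ) (lam := lam) hs hf j).comp measurable_fst).indicator (hS j)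
  calc _ ≤ ∫⁻ x in G, 2 ^ (ρ + 1) * ∫⁻ ω, (∑' j, {v | IsGridGood a ℓ v (j + 1) x}.indicator
        (fun _ => scalePart ℓ m lam μ s f j x) ω) ^ ρ ∂P ∂μ := by
        refine lintegral_mono fun x => ?_
        refine rpow_tsum_le_lintegral P (fun j => ?_) (fun j => ?_) hρ _
        · exact measurable_prodMk_left (hS j)
        · exact volume_not_isGridGood_le a ℓ (j + 1) x
    -- After Tonelli the shift is fixed and every good point sees the same grid, so the martingale
    -- bounds apply, uniformly in the shift.
    _ = 2 ^ (ρ + 1) * ∫⁻ ω, (∫⁻ x in G, (∑' j, {v | IsGridGood a ℓ v (j + 1) x}.indicator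
        (fun _ => scalePart ℓ m lam μ s f j x) ω) ^ ρ ∂μ) ∂P := by
        rw [lintegral_const_mul' _ _ (ENNReal.rpow_ne_top_of_nonneg (by linarith) (by simp)),
          lintegral_lintegral_swap (hFm.aemeasurable)]
    _ ≤ 2 ^ (ρ + 1) * ∫⁻ ω, B ∂P := by
        refine mul_le_mul_right ?_ _
        exact setLIntegral_mono' measurableSet_Ico hB
    _ = _ := by simp

/-! ### Large scales -/

theorem IsPowerBounded.mono (hμ : IsPowerBounded m A μ) {A' : ℝ} (hA : A ≤ A') :
    IsPowerBounded m A' μ := fun x r hr => (hμ x r hr).trans (ENNReal.ofReal_le_ofReal (by gcongr))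

theorem norm_sub_le_of_mem_box (hℓ : 0 ≤ ℓ) {x z : RSpace n}
    (hx : ∀ i, x i ∈ Set.Icc (a i) (a i + ℓ)) (hz : ∀ i, z i ∈ Set.Icc (a i) (a i + ℓ)) :
    ‖x - z‖ ≤ √n * ℓ := by
  rw [EuclideanSpace.norm_eq]
  refine Real.sqrt_le_iff.2 ⟨by positivity, ?_⟩
  rw [mul_pow, Real.sq_sqrt (by positivity)]
  have h1 : ∀ i, ‖(x - z) i‖ ^ 2 ≤ ℓ ^ 2 := fun i => by
    refine pow_le_pow_left₀ (norm_nonneg _) ?_ 2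
    rw [Real.norm_eq_abs, PiLp.sub_apply, abs_le]
    constructor <;> linarith [(hx i).1, (hx i).2, (hz i).1, (hz i).2]
  refine (Finset.sum_le_sum fun i _ => h1 i).trans ?_
  simp

theorem lintegral_Ici_inv_mul_rpow (hℓ : 0 < ℓ) {c : ℝ} (hc : 0 < c) :
    ∫⁻ t in Set.Ici ℓ, ENNReal.ofReal (t⁻¹ * (ℓ / t) ^ c) = ENNReal.ofReal (1 / c) := by
  have h1 : -1 - c < -1 := by linarith
  rw [setLIntegral_congr Ioi_ae_eq_Ici.symm]
  have h2 : ∀ t ∈ Set.Ioi ℓ, t⁻¹ * (ℓ / t) ^ c = ℓ ^ c * t ^ (-1 - c) := fun t ht => by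
    have ht0 : 0 < t := hℓ.trans ht
    rw [Real.div_rpow hℓ.le ht0.le, Real.rpow_sub ht0, Real.rpow_neg_one]
    ring
  rw [setLIntegral_congr_fun measurableSet_Ioi fun t ht => by rw [h2 t ht],
    ← ofReal_integral_eq_lintegral_ofReal ((integrableOn_Ioi_rpow_of_lt h1 hℓ).const_mul _)
      ((ae_restrict_mem measurableSet_Ioi).mono fun t ht => by
        have : 0 < t := hℓ.trans ht
        positivity), integral_const_mul, integral_Ioi_rpow_of_lt h1 hℓ]
  congr 1
  rw [show -1 - c + 1 = -c by ring, Real.rpow_neg hℓ.le]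
  field_simp

/-- The constant in the bound for the large scales. -/
noncomputable def largeConst (n κ : ℕ) (m b A K : ℝ) : ℝ≥0∞ :=
  ENNReal.ofReal K ^ 2 * ENNReal.ofReal ((2 * (√n + 1)) ^ m) ^ (2 * κ) *
    (poissonConst m b * ENNReal.ofReal A) * ENNReal.ofReal (1 / (m * (2 * κ : ℕ)))

/-- Seen from x in Q, the cube lies in a ball of radius (√n + 1) ℓ, so the L¹ norm of f_l is at most
a multiple of ℓ^m times its maximal function at x. The size bound t^(-m) per slot then gives
(ℓ/t)^(2κm) after squaring, which is integrable against dt/t on [ℓ, ∞). -/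
theorem lintegral_large_le [SigmaFinite μ] (hs : IsLPSKernel m α K s) (hK : 0 ≤ K) (hm : 0 < m)
    (hα : 0 < α) (hκ : 1 ≤ κ) (hb : 0 < b) (hε : 0 ≤ ε)
    (hlam : 2 * (κ : ℝ) * m + 2 * ε + b ≤ m * lam) (hμ : IsPowerBounded m A μ) (hℓ : 0 < ℓ)
    (hQa : ∀ x ∈ Q, ∀ i, x i ∈ Set.Icc (a i) (a i + ℓ)) {f : Fin κ → RSpace n → ℂ}
    (hf : ∀ l, Measurable (f l)) (hfQ : ∀ l, ∀ x ∉ Q, f l x = 0) {x : RSpace n} (hx : x ∈ Q) :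
    ∫⁻ t in Set.Ici ℓ, ∫⁻ y, starWeight m lam t x y * ‖Theta μ s f t y‖ₑ ^ 2 ∂μ ≤
      largeConst n κ m b A K * (∏ l, maxFn m μ (fun z => ‖f l z‖ₑ) x) ^ 2 := by
  set M := ∏ l, maxFn m μ (fun z => ‖f l z‖ₑ) x with hM
  set d := 2 * (√n + 1) with hd
  have hd0 : 0 < d := by positivity
  have hint : ∀ l, ∫⁻ z, ‖f l z‖ₑ ∂μ ≤
      ENNReal.ofReal ((d * ℓ) ^ m) * maxFn m μ (fun z => ‖f l z‖ₑ) x := by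
    intro l
    have hR : 0 < (√n + 1) * ℓ := by positivity
    have h1 := setLIntegral_ball_le_maxFn (μ := μ) hm hR (fun z => ‖f l z‖ₑ) x
    rw [← Real.mul_rpow (by norm_num) hR.le, show 2 * ((√n + 1) * ℓ) = d * ℓ by rw [hd]; ring] at h1
    refine le_trans ?_ h1
    rw [← lintegral_indicator Metric.isOpen_ball.measurableSet]
    refine lintegral_mono fun z => ?_
    by_cases hz : z ∈ Q
    · have : z ∈ Metric.ball x ((√n + 1) * ℓ) := by
        rw [Metric.mem_ball, dist_eq_norm]
        refine (norm_sub_le_of_mem_box hℓ.le (hQa z hz) (hQa x hx)).trans_lt ?_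
        linarith
      rw [Set.indicator_of_mem this]
    · simp [hfQ l z hz]
  have hΘ : ∀ t, 0 < t → ∀ y, ‖Theta μ s f t y‖ₑ ^ 2 ≤ ENNReal.ofReal K ^ 2 *
      ENNReal.ofReal (d ^ m) ^ (2 * κ) * ENNReal.ofReal ((ℓ / t) ^ (m * (2 * κ : ℕ))) * M ^ 2 := by
    intro t ht y
    have h1 : ∀ l, poissonAvg m α μ t (fun z => ‖f l z‖ₑ) y ≤ ENNReal.ofReal (d ^ m) *
        ENNReal.ofReal ((ℓ / t) ^ m) * maxFn m μ (fun z => ‖f l z‖ₑ) x := fun l => by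
      refine (poissonAvg_le_lintegral hm.le hα.le ht _ y).trans
        ((mul_le_mul_right (hint l) _).trans (le_of_eq ?_))
      rw [← mul_assoc, ← ENNReal.ofReal_mul (by positivity), ← ENNReal.ofReal_mul (by positivity),
        Real.mul_rpow hd0.le hℓ.le, Real.div_rpow hℓ.le ht.le, Real.rpow_neg ht.le]
      congr 2
      ring
    calc _ ≤ (ENNReal.ofReal K * ∏ l, (ENNReal.ofReal (d ^ m) * ENNReal.ofReal ((ℓ / t) ^ m) *
          maxFn m μ (fun z => ‖f l z‖ₑ) x)) ^ 2 := by
          refine pow_le_pow_left' ((enorm_Theta_le hs hK ht hf y).trans ?_) 2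
          exact mul_le_mul_right (Finset.prod_le_prod' fun l _ => h1 l) _
      _ = _ := by
          rw [Finset.prod_mul_distrib, Finset.prod_const, Finset.card_univ, Fintype.card_fin, ← hM,
            Real.rpow_mul_natCast (by positivity), ENNReal.ofReal_pow (by positivity)]
          ring
  have hw : ∀ t, 0 < t → ∫⁻ y, starWeight m lam t x y ∂μ ≤
      ENNReal.ofReal t⁻¹ * (poissonConst m b * ENNReal.ofReal A) := by
    intro t ht
    refine le_trans ?_ (mul_le_mul_right (lintegral_sqAvg_weight_le hm hb ht hμ x) _)
    rw [← lintegral_const_mul' _ _ (by simp)]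
    refine lintegral_mono fun y => le_trans ?_ (starWeight_mul_le ht hκ hlam x y)
    exact le_mul_of_one_le_right' (one_le_pow₀ (one_le_ofReal_rpow ht (by positivity) x y))
  have hwm : ∀ t, Measurable fun y => starWeight m lam t x y := fun t => by
    unfold starWeight; fun_prop
  have hc : 0 < m * (2 * κ : ℕ) := by
    have : (0 : ℝ) < (2 * κ : ℕ) := by exact_mod_cast (by omega : 0 < 2 * κ)
    positivity
  have hm3 : Measurable fun t : ℝ => ENNReal.ofReal (t⁻¹ * (ℓ / t) ^ (m * (2 * κ : ℕ))) := by
    fun_prop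
  calc _ ≤ ∫⁻ t in Set.Ici ℓ, (ENNReal.ofReal K ^ 2 * ENNReal.ofReal (d ^ m) ^ (2 * κ) *
        (poissonConst m b * ENNReal.ofReal A) * M ^ 2) *
        ENNReal.ofReal (t⁻¹ * (ℓ / t) ^ (m * (2 * κ : ℕ))) := by
        refine setLIntegral_mono' measurableSet_Ici fun t ht => ?_
        have ht0 : 0 < t := hℓ.trans_le ht
        refine (lintegral_mono fun y => mul_le_mul_right (hΘ t ht0 y) _).trans ?_
        rw [lintegral_mul_const _ (hwm t)]
        refine (mul_le_mul_left (hw t ht0) _).trans (le_of_eq ?_)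
        rw [ENNReal.ofReal_mul (by positivity)]
        ring
    _ = _ := by
        rw [lintegral_const_mul _ hm3, lintegral_Ici_inv_mul_rpow hℓ hc, largeConst]
        ring

theorem gStar_sq_eq (hℓ : 0 < ℓ) (f : Fin κ → RSpace n → ℂ) (x : RSpace n) :
    gStar m lam μ s f x ^ 2 = ∑' j, scalePart ℓ m lam μ s f j x +
      ∫⁻ t in Set.Ici ℓ, ∫⁻ y, starWeight m lam t x y * ‖Theta μ s f t y‖ₑ ^ 2 ∂μ := by
  have e : Set.Ioi (0 : ℝ) = Set.Ioo 0 ℓ ∪ Set.Ici ℓ := (Set.Ioo_union_Ici_eq_Ioi hℓ).symm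
  have hd : Disjoint (Set.Ioo 0 ℓ) (Set.Ici ℓ) :=
    Set.disjoint_left.2 fun t h1 h2 => absurd h1.2 (not_lt.2 h2)
  rw [← gStarLocal_sq hℓ]
  unfold gStar gStarLocal gStarOn
  rw [← ENNReal.rpow_natCast, ← ENNReal.rpow_natCast, ← ENNReal.rpow_mul, ← ENNReal.rpow_mul, e,
    lintegral_union measurableSet_Ici hd]
  norm_num
  rfl

/-! ### Reductions -/

/-- Each side differs from an open interval by at most its two endpoints. -/
theorem IsCube.measurableSet (hQ : IsCube Q ℓ) : MeasurableSet Q := by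
  obtain ⟨-, a, I, hI, rfl⟩ := hQ
  have hIm : ∀ i, MeasurableSet (I i) := by
    intro i
    have e : I i = Set.Ioo (a i) (a i + ℓ) ∪ (I i \ Set.Ioo (a i) (a i + ℓ)) :=
      (Set.union_sdiff_cancel (hI i).1).symm
    rw [e]
    refine measurableSet_Ioo.union (Set.Finite.measurableSet
      ((Set.toFinite {a i, a i + ℓ}).subset fun t ht => ?_))
    have h1 := (hI i).2 ht.1
    have h2 := ht.2
    simp only [Set.mem_Ioo, not_and, not_lt] at h2
    rcases h1.1.eq_or_lt with h | h
    · exact Or.inl h.symm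
    · exact Or.inr (le_antisymm h1.2 (h2 h))
  simp only [Set.ofPred_forall]
  exact .iInter fun i => (by fun_prop : Measurable fun x : RSpace n => x i) (hIm i)

theorem measure_ne_top_of_box (hμ : IsPowerBounded m A μ) (hℓ : 0 < ℓ)
    (hQa : ∀ x ∈ Q, ∀ i, x i ∈ Set.Icc (a i) (a i + ℓ)) : μ Q ≠ ⊤ := by
  refine ne_top_of_le_ne_top ENNReal.ofReal_ne_top ((measure_mono fun x hx => ?_).trans
    (hμ (WithLp.toLp 2 a) ((√n + 1) * ℓ) (by positivity)))
  rw [Metric.mem_ball, dist_eq_norm]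
  refine (norm_sub_le_of_mem_box hℓ.le (hQa x hx) fun i => ?_).trans_lt (by linarith)
  simpa using hℓ.le

theorem Theta_congr_ae [SigmaFinite μ] {f g : Fin κ → RSpace n → ℂ} (h : ∀ l, f l =ᵐ[μ] g l) :
    Theta μ s f = Theta μ s g := by
  funext t y
  refine integral_congr_ae ?_
  filter_upwards [Measure.ae_eq_pi (μ := fun _ => μ) h] with z hz
  congr 1
  exact Finset.prod_congr rfl fun l _ => congrFun hz l

/-- At level ζ the exceptional set has measure at most (1 - δ₀)/2 · μ(Q), and H at most δ₀ μ(Q), so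
(1 - δ₀)/2 · μ(Q) remains. H need not be measurable; removing its measurable hull costs no more. -/
theorem exists_good_set [SigmaFinite μ] (hQ : MeasurableSet Q) (hQt : μ Q ≠ ⊤)
    {g : RSpace n → ℝ≥0∞} (hg : Measurable g) {H : Set (RSpace n)} {p₀ δ₀ : ℝ} {C₀ : ℝ≥0}
    (hδ₀ : 0 ≤ δ₀) (hδ₀' : δ₀ < 1) (hH : μ H ≤ ENNReal.ofReal δ₀ * μ Q) {ζ : ℝ} (hζ : 0 < ζ)
    (hζ' : C₀ * 2 / (1 - δ₀) ≤ ζ ^ p₀)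
    (hw : (⨆ (ζ : ℝ) (_ : 0 < ζ), ENNReal.ofReal (ζ ^ p₀) *
      μ {x | x ∈ Q \ H ∧ ENNReal.ofReal ζ < g x}) ≤ (C₀ : ℝ≥0∞) * μ Q) :
    ∃ G : Set (RSpace n), MeasurableSet G ∧ G ⊆ Q \ H ∧
      ENNReal.ofReal ((1 - δ₀) / 2) * μ Q ≤ μ G ∧ ∀ x ∈ G, g x ≤ ENNReal.ofReal ζ := by
  set H' := toMeasurable μ H with hH'
  set B := {x | x ∈ Q \ H ∧ ENNReal.ofReal ζ < g x} with hB
  have hζp : 0 < ζ ^ p₀ := by positivity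
  have hBμ : μ B ≤ ENNReal.ofReal ((1 - δ₀) / 2) * μ Q := by
    have h1 : ENNReal.ofReal (ζ ^ p₀) * μ B ≤ (C₀ : ℝ≥0∞) * μ Q :=
      (le_iSup₂ (f := fun (ζ : ℝ) (_ : 0 < ζ) => ENNReal.ofReal (ζ ^ p₀) *
        μ {x | x ∈ Q \ H ∧ ENNReal.ofReal ζ < g x}) ζ hζ).trans hw
    have h2 : (C₀ : ℝ≥0∞) ≤ ENNReal.ofReal (ζ ^ p₀) * ENNReal.ofReal ((1 - δ₀) / 2) := by
      rw [← ENNReal.ofReal_mul hζp.le, ← ENNReal.ofReal_coe_nnreal]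
      refine ENNReal.ofReal_le_ofReal ?_
      rw [div_le_iff₀ (by linarith)] at hζ'
      linarith
    have h3 := h1.trans (mul_le_mul_left h2 (μ Q))
    rw [mul_assoc] at h3
    exact (ENNReal.mul_le_mul_iff_right (by simpa using hζp) ENNReal.ofReal_ne_top).1 h3
  have hBm : MeasurableSet {x | ENNReal.ofReal ζ < g x} := measurableSet_lt measurable_const hg
  refine ⟨(Q \ H') \ {x | ENNReal.ofReal ζ < g x},
    (hQ.diff (measurableSet_toMeasurable μ H)).diff hBm, fun x hx =>
    ⟨hx.1.1, fun h => hx.1.2 (subset_toMeasurable μ H h)⟩, ?_, fun x hx => not_lt.1 hx.2⟩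
  set G := (Q \ H') \ {x | ENNReal.ofReal ζ < g x} with hG
  have hcov : Q ⊆ G ∪ (H' ∪ B) := fun x hx => by
    by_cases h1 : x ∈ H'
    · exact Or.inr (Or.inl h1)
    · by_cases h2 : ENNReal.ofReal ζ < g x
      · exact Or.inr (Or.inr ⟨⟨hx, fun h => h1 (subset_toMeasurable μ H h)⟩, h2⟩)
      · exact Or.inl ⟨⟨hx, h1⟩, h2⟩
  have h1 : μ Q ≤ μ G + (ENNReal.ofReal δ₀ * μ Q + ENNReal.ofReal ((1 - δ₀) / 2) * μ Q) := by
    refine (measure_mono hcov).trans ((measure_union_le _ _).trans (add_le_add le_rfl ?_))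
    refine (measure_union_le _ _).trans (add_le_add ?_ hBμ)
    rwa [hH', measure_toMeasurable]
  have h2 : μ Q = ENNReal.ofReal ((1 - δ₀) / 2) * μ Q +
      (ENNReal.ofReal δ₀ * μ Q + ENNReal.ofReal ((1 - δ₀) / 2) * μ Q) := by
    rw [← add_mul, ← add_mul, ← ENNReal.ofReal_add hδ₀ (by linarith),
      ← ENNReal.ofReal_add (by linarith) (by linarith),
      show (1 - δ₀) / 2 + (δ₀ + (1 - δ₀) / 2) = 1 by ring, ENNReal.ofReal_one, one_mul]
  refine (ENNReal.add_le_add_iff_right ?_).1 (h2.symm.le.trans h1)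
  finiteness

end

/-! ### The main theorem: choice of parameters and assembly -/

theorem theorem2p5
    (n κ : ℕ) (hκ : 1 ≤ κ)
    (m lam α : ℝ) (hm : 0 < m) (hlam : 2 * (κ : ℝ) < lam)
    (hα : 0 < α) (hα' : α ≤ m * (lam - 2 * (κ : ℝ)))
    (p : ℝ) (q : Fin κ → ℝ) (hp : 1 < p) (hq : ∀ i, 1 < q i) (hpq : 1 / p = ∑ i, 1 / q i)
    (A K : ℝ)
    (p₀ δ₀ : ℝ) (C₀ : ℝ≥0) (hp₀ : 0 < p₀) (hδ₀ : 0 ≤ δ₀) (hδ₀' : δ₀ < 1) :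
    ∃ C : ℝ≥0,
      ∀ (μ : Measure (RSpace n)) (s : ℝ → RSpace n → (Fin κ → RSpace n) → ℂ),
        IsPowerBounded m A μ → IsLPSKernel m α K s →
      ∀ (Q : Set (RSpace n)) (ℓ : ℝ), IsCube Q ℓ →
      ∀ H : Set (RSpace n), μ H ≤ ENNReal.ofReal δ₀ * μ Q →
        (⨆ (ζ : ℝ) (_ : 0 < ζ), ENNReal.ofReal (ζ ^ p₀) *
          μ {x | x ∈ Q \ H ∧
            ENNReal.ofReal ζ < gStarLocal ℓ m lam μ s (fun _ => Q.indicator fun _ => (1 : ℂ)) x})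
          ≤ (C₀ : ℝ≥0∞) * μ Q →
        ∃ G : Set (RSpace n), MeasurableSet G ∧ G ⊆ Q \ H ∧
          ENNReal.ofReal ((1 - δ₀) / 2) * μ Q ≤ μ G ∧
          ∀ f : Fin κ → RSpace n → ℂ,
            (∀ i, MemLp (f i) (ENNReal.ofReal (q i)) μ) →
            (∀ i, ∀ᵐ x ∂μ, x ∉ Q → f i x = 0) →
            eLpNorm (G.indicator (gStar m lam μ s f)) (ENNReal.ofReal p) μ ≤
              (C : ℝ≥0∞) * ∏ i, eLpNorm (f i) (ENNReal.ofReal (q i)) μ := by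
  have hp0 : 0 < p := by linarith
  have hq0 : ∀ i, 0 < q i := fun i => by linarith [hq i]
  have hρ : 0 < p / 2 := by positivity
  have hpq0 : ∀ l, 0 ≤ p / q l := fun l => div_nonneg hp0.le (hq0 l).le
  -- Enlarging the constants makes A positive and K nonnegative without affecting the hypotheses.
  set A' := max A 1 with hA'
  have hA0 : 0 < A' := lt_max_of_lt_right one_pos
  set K' := max K 0 with hK'
  have hK0 : 0 ≤ K' := le_max_right _ _
  -- The parameters are b = α/2 and ε = α/4. Then b + ε ≤ α, and 2ε + b = α is exactly what α ≤ m(λ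
  -- - 2κ) leaves free in the outer weight.
  have hb0 : 0 < α / 2 := by positivity
  have hε : 0 < α / 4 := by positivity
  have hb : α / 2 + α / 4 ≤ α := by linarith
  have hlam' : 2 * (κ : ℝ) * m + 2 * (α / 4) + α / 2 ≤ m * lam := by nlinarith
  -- the level of the test function
  set ζ : ℝ := ((C₀ + 1) * 2 / (1 - δ₀)) ^ (1 / p₀) with hζ
  have hδ : 0 < 1 - δ₀ := by linarith
  have hζ0 : 0 < ζ := by positivity
  have hζp : C₀ * 2 / (1 - δ₀) ≤ ζ ^ p₀ := by
    rw [hζ, ← Real.rpow_mul (by positivity), one_div_mul_cancel hp₀.ne', Real.rpow_one]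
    gcongr
    linarith
  obtain ⟨C₁, hC₁⟩ := lintegral_tsum_scalePart_le (n := n) hp0 hq hpq hA0 hK0 hm hκ hb0 hε hb hlam'
    ζ.toNNReal
  choose C₂ hC₂ using fun i => maxFn_strong_type (n := n) hm hA0 (hq i)
  set L := largeConst n κ m (α / 2) A' K' with hL
  have hLt : L ≠ ⊤ := by rw [hL, largeConst]; finiteness
  set E : ℝ≥0∞ := ∏ l, (C₂ l : ℝ≥0∞) ^ (p / q l) with hE
  have hEt : E ≠ ⊤ := ENNReal.prod_ne_top fun l _ => by have := hpq0 l; finiteness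
  set C : ℝ≥0∞ := 2 ^ (p / 2) * (2 ^ (p / 2 + 1) * C₁ + L ^ (p / 2) * E) with hC
  have hCt : C ≠ ⊤ := by
    have : (2 : ℝ≥0∞) ^ (p / 2 + 1) ≠ ⊤ := ENNReal.rpow_ne_top_of_nonneg (by positivity) (by simp)
    finiteness
  refine ⟨(C ^ (1 / p)).toNNReal, fun μ s hμA hsK Q ℓ hcube H hH hw => ?_⟩
  rw [ENNReal.coe_toNNReal (by finiteness)]
  have hμ : IsPowerBounded m A' μ := hμA.mono (le_max_left _ _)
  have hs : IsLPSKernel m α K' s := hsK.mono (le_max_left _ _)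
  have := hμ.isLocallyFiniteMeasure
  have hQ := hcube.measurableSet
  obtain ⟨hℓ, a, I, hI, hQI⟩ := hcube
  have hQa : ∀ x ∈ Q, ∀ i, x i ∈ Set.Icc (a i) (a i + ℓ) := fun x hx i => by
    rw [hQI] at hx; exact (hI i).2 (hx i)
  have hQt : μ Q ≠ ⊤ := measure_ne_top_of_box hμ hℓ hQa
  have : IsFiniteMeasure (μ.restrict Q) := ⟨by simpa using hQt.lt_top⟩
  obtain ⟨G, hG, hGQ, hGμ, hGζ⟩ := exists_good_set hQ hQt
    (measurable_gStarOn hs (Set.Ioo 0 ℓ) fun _ => measurable_const.indicator hQ) hδ₀ hδ₀' hH hζ0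
    hζp hw
  refine ⟨G, hG, hGQ, hGμ, fun f' hf' hf'Q => ?_⟩
  -- measurable representatives
  set f : Fin κ → RSpace n → ℂ := fun l => Q.indicator ((hf' l).1.mk (f' l)) with hf_def
  have hf : ∀ l, Measurable (f l) := fun l => (hf' l).1.stronglyMeasurable_mk.measurable.indicator hQ
  have hfQ : ∀ l, ∀ x ∉ Q, f l x = 0 := fun l x hx => Set.indicator_of_notMem hx _
  have hff' : ∀ l, f' l =ᵐ[μ] f l := fun l => by
    filter_upwards [(hf' l).1.ae_eq_mk, hf'Q l] with x h1 h2
    by_cases hx : x ∈ Q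
    · rw [hf_def]; simp only [Set.indicator_of_mem hx]; exact h1
    · rw [h2 hx, hfQ l x hx]
  have hfq : ∀ l, MemLp (f l) (ENNReal.ofReal (q l)) μ := fun l => (memLp_congr_ae (hff' l)).1 (hf' l)
  have hfi : ∀ l, Integrable (f l) μ := fun l => by
    have h1 : IntegrableOn (f l) Q μ := ((hfq l).restrict Q).integrable (by
      rw [← ENNReal.ofReal_one]; exact ENNReal.ofReal_le_ofReal (hq l).le)
    exact (integrableOn_iff_integrable_of_support_subset (fun x hx => by
      by_contra h; exact hx (hfQ l x h))).1 h1
  have hstar : gStar m lam μ s f' = gStar m lam μ s f := by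
    unfold gStar gStarOn
    rw [Theta_congr_ae hff']
  set Φ := ∏ l, (∫⁻ x, ‖f l x‖ₑ ^ q l ∂μ) ^ (p / q l) with hΦ
  have hlocal : ∫⁻ x in G, (∑' j, scalePart ℓ m lam μ s f j x) ^ (p / 2) ∂μ ≤
      2 ^ (p / 2 + 1) * (C₁ * Φ) :=
    lintegral_tsum_scalePart_le_of_forall (a := a) hs hρ hf
      (hC₁ μ s hμ hs Q a ℓ hℓ hQ hQt hQa G (fun x hx => (hGQ hx).1) hG hGζ f hf hfi hfq hfQ)
  have hmax : ∫⁻ x in G, (∏ l, maxFn m μ (fun z => ‖f l z‖ₑ) x) ^ p ∂μ ≤ E * Φ :=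
    lintegral_prod_rpow_le hp0 hq0 hpq (fun l => measurable_maxFn (hf l).enorm) fun l =>
      (setLIntegral_le_lintegral _ _).trans (hC₂ l μ hμ _ (hf l).enorm)
  have hmain : ∫⁻ x in G, gStar m lam μ s f x ^ p ∂μ ≤ C * Φ := by
    have hsq : ∀ y : ℝ≥0∞, (y ^ 2) ^ (p / 2) = y ^ p := fun y => by
      rw [← ENNReal.rpow_natCast, ← ENNReal.rpow_mul]; congr 1; push_cast; ring
    have hsm : Measurable fun x => (∑' j, scalePart ℓ m lam μ s f j x) ^ (p / 2) :=
      (Measurable.tsum fun j => measurable_scalePart hs hf j).pow_const _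
    calc _ ≤ ∫⁻ x in G, 2 ^ (p / 2) * ((∑' j, scalePart ℓ m lam μ s f j x) ^ (p / 2) +
          L ^ (p / 2) * (∏ l, maxFn m μ (fun z => ‖f l z‖ₑ) x) ^ p) ∂μ := by
          refine setLIntegral_mono' hG fun x hx => ?_
          rw [← hsq, gStar_sq_eq hℓ]
          refine (ENNReal.add_rpow_le_two_mul _ _ hρ).trans ?_
          refine mul_le_mul_right (add_le_add le_rfl ?_) _
          rw [← hsq (∏ l, _), ← ENNReal.mul_rpow_of_nonneg _ _ hρ.le]
          exact ENNReal.rpow_le_rpow (lintegral_large_le hs hK0 hm hα hκ hb0 hε.le hlam' hμ hℓ hQa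
            hf hfQ (hGQ hx).1) hρ.le
      _ = 2 ^ (p / 2) * (∫⁻ x in G, (∑' j, scalePart ℓ m lam μ s f j x) ^ (p / 2) ∂μ +
          L ^ (p / 2) * ∫⁻ x in G, (∏ l, maxFn m μ (fun z => ‖f l z‖ₑ) x) ^ p ∂μ) := by
          rw [lintegral_const_mul' _ _ (by finiteness), lintegral_add_left hsm,
            lintegral_const_mul' _ _ (by finiteness)]
      _ ≤ 2 ^ (p / 2) * (2 ^ (p / 2 + 1) * (C₁ * Φ) + L ^ (p / 2) * (E * Φ)) := by gcongr
      _ = _ := by rw [hC]; ring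
  rw [hstar, eLpNorm_eq_lintegral_rpow_enorm_toReal (by simpa using hp0) ENNReal.ofReal_ne_top,
    ENNReal.toReal_ofReal hp0.le]
  have hleft : ∫⁻ x, ‖G.indicator (gStar m lam μ s f) x‖ₑ ^ p ∂μ =
      ∫⁻ x in G, gStar m lam μ s f x ^ p ∂μ := by
    rw [← lintegral_indicator hG]
    refine lintegral_congr fun x => ?_
    by_cases hx : x ∈ G
    · simp [hx]
    · simp [hx, hp0]
  rw [hleft]
  refine (ENNReal.rpow_le_rpow hmain (by positivity)).trans (le_of_eq ?_)
  rw [ENNReal.mul_rpow_of_nonneg _ _ (by positivity), hΦ, ← ENNReal.prod_rpow_of_nonneg (by positivity)]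
  congr 1
  refine Finset.prod_congr rfl fun l _ => ?_
  rw [eLpNorm_congr_ae (hff' l), eLpNorm_eq_lintegral_rpow_enorm_toReal (by simpa using hq0 l)
    ENNReal.ofReal_ne_top, ENNReal.toReal_ofReal (hq0 l).le, ← ENNReal.rpow_mul]
  congr 1
  field_simp
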